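/- Let $m,\gamma,\kappa>0$, let $\mathbb T=\mathbb R/2\pi\mathbb Z$, and let $(\mu_t)_{t\ge 0}$ be a global measure-valued solution of the kinetic Kuramoto equation with inertia $$\partial_t f+\partial_\theta(\omega f)+\partial_\omega\big(\mathcal F_a[f]f\big)=0,\qquad \mathcal F_a[f](\theta,\omega,t)=\frac1m\Big(-\gamma\omega+\kappa\int_{\mathbb T\times\mathbb R}\sin(\theta_*-\theta)\,f(\theta_*,\omega_*,t)\,d\theta_*d\omega_*\Big)$$ on $\mathbb T\times\mathbb R$. That is, each $\mu_t$ is a Borel probability measure on $\mathbb T\times\mathbb R$ with $\int\omega^2\,d\mu_t<\infty$, and for every compactly supported $C^1$ function $\phi(\theta,\omega,t)$ on $\mathbb T\times\mathbb R\times[0,\infty)$ the map $t\mapsto\int\phi(\cdot,\cdot,t)\,d\mu_t$ is continuous on $[0,\infty)$ and $$\int\phi(\cdot,\cdot,t)\,d\mu_t-\int\phi(\cdot,\cdot,0)\,d\mu_0=\int_0^t\int\big(\partial_s\phi+\omega\,\partial_\theta\phi+\mathcal F_a[\mu_s]\,\partial_\omega\phi\big)\,d\mu_s\,ds,\qquad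 t\ge0 .$$ Let $R_k(t)=\big|\int_{\mathbb T\times\mathbb R}e^{\mathrm i\theta}\,d\mu_t(\theta,\omega)\big|$ be the order parameter, and suppose that $$\frac12\int_{\mathbb T\times\mathbb R}\omega^2\,d\mu_0(\theta,\omega)\le\frac{\kappa R_k(0)^2}{2m}.$$ Then the following holds. 1. If $R_k(0)=0$, then the solution stays in a phase-locked state: for all $t\ge0$, $\mu_t=\mu_0$, $\mu_t$ is concentrated on $\{\omega=0\}$, and $R_k(t)=0$. 2. If $R_k(0)>0$, then there is $R_*>0$ with $R_k(t)\ge R_*$ for all $t\ge0$, the limit $\lim_{t\to\infty}R_k(t)$ exists and is positive, and $\mu_t$ tends to a bi-polar state of type $(c_1,c_2)$: there are $c_1>c_2\ge0$ with $c_1+c_2=1$ and $\varphi^*\in\mathbb T$ such that, as $t\to\infty$, $$\mu_t\to\big(c_1\delta_{\varphi^*}+c_2\delta_{\varphi^*+\pi}\big)\otimes\delta_0$$ weakly and in the Wasserstein 2-distance on $\mathbb T\times\mathbb R$ (for the distance $(|\theta-\theta'|^2+|\omega-\omega'|^2)^{1/2}$, with $|\theta-\theta'|$ the arc length). -/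

import Mathlib

open MeasureTheory Filter Set
open scoped ENNReal Topology

namespace KineticKuramoto

noncomputable section

/-- The circle `ℝ / 2πℤ`, with its arc-length distance. -/
abbrev Torus : Type := AddCircle (2 * Real.pi)

/-- The phase space of pairs (phase `θ`, frequency `ω`). -/
abbrev Phase : Type := Torus × ℝ

/-- The sine function on the circle. -/
def torusSin : Torus → ℝ := Real.sin_periodic.lift

/-- The complex number `e^{iθ}` for `θ` in the circle. -/
def torusExp (θ : Torus) : ℂ := (AddCircle.toCircle θ : ℂ)

/-- The force
`F_a[μ](θ, ω) = (1/m) (-γ ω + κ ∫ sin (θ_* - θ) dμ(θ_*, ω_*))`. -/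
def force (m γ κ : ℝ) (μ : Measure Phase) (θ : Torus) (ω : ℝ) : ℝ :=
  (1 / m) * (-γ * ω + κ * ∫ z, torusSin (z.1 - θ) ∂μ)

/-- The order parameter `R_k = |∫ e^{iθ} dμ(θ, ω)|`. -/
def orderParameter (μ : Measure Phase) : ℝ := ‖∫ z, torusExp z.1 ∂μ‖

/-- Test functions `φ(θ, ω, t)`: continuously differentiable and compactly supported on
`Torus × ℝ × ℝ`. Only their values at times `t ≥ 0` are used. -/
structure IsTestFunction (φ : Torus → ℝ → ℝ → ℝ) : Prop where
  contDiff : ContDiff ℝ 1 (fun p : ℝ × ℝ × ℝ => φ (p.1 : Torus) p.2.1 p.2.2)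
  hasCompactSupport : HasCompactSupport (fun p : Torus × ℝ × ℝ => φ p.1 p.2.1 p.2.2)

/-- The partial derivative in the phase variable. -/
def dTheta (φ : Torus → ℝ → ℝ → ℝ) (θ : Torus) (ω t : ℝ) : ℝ :=
  deriv (fun h : ℝ => φ (θ + (h : Torus)) ω t) 0

/-- The partial derivative in the frequency variable. -/
def dOmega (φ : Torus → ℝ → ℝ → ℝ) (θ : Torus) (ω t : ℝ) : ℝ :=
  deriv (fun w : ℝ => φ θ w t) ω

/-- The partial derivative in the time variable. -/
def dTime (φ : Torus → ℝ → ℝ → ℝ) (θ : Torus) (ω t : ℝ) : ℝ :=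
  deriv (fun s : ℝ => φ θ ω s) t

/-- `μ` is a global measure-valued solution, weakly continuous with values in the probability
measures with finite second moment, of the kinetic Kuramoto equation with inertia
`∂_t f + ∂_θ (ω f) + ∂_ω (F_a[f] f) = 0` on `Torus × ℝ`. Only times `t ≥ 0` matter; the second
moment only involves `ω` because the circle is bounded. -/
structure IsMeasureValuedSolution (m γ κ : ℝ) (μ : ℝ → ProbabilityMeasure Phase) : Prop where
  finite_second_moment : ∀ t, 0 ≤ t → Integrable (fun z : Phase => z.2 ^ 2) (μ t : Measure Phase)
  weakly_continuous : ∀ φ, IsTestFunction φ →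
    ContinuousOn (fun t : ℝ => ∫ z, φ z.1 z.2 t ∂(μ t : Measure Phase)) (Ici 0)
  weak_equation : ∀ φ, IsTestFunction φ → ∀ t, 0 ≤ t →
    (∫ z, φ z.1 z.2 t ∂(μ t : Measure Phase)) - ∫ z, φ z.1 z.2 0 ∂(μ 0 : Measure Phase) =
      ∫ s in (0 : ℝ)..t, ∫ z, (dTime φ z.1 z.2 s + z.2 * dTheta φ z.1 z.2 s
        + force m γ κ (μ s : Measure Phase) z.1 z.2 * dOmega φ z.1 z.2 s) ∂(μ s : Measure Phase)

/-- `ν` is a bi-polar state of type `(c₁, c₂)`: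
`ν = (c₁ δ_φ + c₂ δ_{φ+π}) ⊗ δ_0` for some `φ`, with `c₁ > c₂ ≥ 0` and `c₁ + c₂ = 1`. -/
def IsBipolarState (c₁ c₂ : ℝ) (ν : Measure Phase) : Prop :=
  0 ≤ c₂ ∧ c₂ < c₁ ∧ c₁ + c₂ = 1 ∧ ∃ φ : Torus,
    ν = (ENNReal.ofReal c₁ • Measure.dirac φ
      + ENNReal.ofReal c₂ • Measure.dirac (φ + ((Real.pi : ℝ) : Torus))).prod
        (Measure.dirac (0 : ℝ))

/-- The Wasserstein 2-distance on `Torus × ℝ`, as an infimum over all couplings, for the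
product distance `‖(θ, ω) - (θ', ω')‖² = |θ - θ'|² + |ω - ω'|²`. -/
def wasserstein2 (μ ν : Measure Phase) : ℝ≥0∞ :=
  ⨅ (ρ : Measure (Phase × Phase)) (_ : ρ.map Prod.fst = μ) (_ : ρ.map Prod.snd = ν),
    (∫⁻ p, (edist p.1.1 p.2.1 ^ 2 + edist p.1.2 p.2.2 ^ 2) ∂ρ) ^ (1 / 2 : ℝ)

end

end KineticKuramoto

namespace KineticKuramoto

open scoped ContDiff

/-! ### Smooth functions on the circle -/

/-! Notation: z = C + iS is the mean of e^{iθ}, ρ = |z|², K is the mean of ω², q = Im(z̄ e^{iθ}) and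
r = Re(z̄ e^{iθ}) are `normal` and `tangent`, Q is the mean of q² and W the mean of qω. The force is
-(γω + κq)/m, so ρ' = -2W, and the energy E = K/2 - κρ/(2m) satisfies E' = -(γ/m)K
(`hasDerivAt_energy`). The hypothesis on the initial data is E(0) ≤ 0, hence K ≤ (κ/m)ρ at all times
t ≥ 0.

If ρ(0) = 0, then |W| ≤ (Q + K)/2 and Q ≤ ρ bound |ρ'| by a multiple of ρ. Grönwall gives ρ = 0, so
K = 0: all mass sits at ω = 0, phase moments are constant, and density of trigonometric polynomials
shows that the measure does not move.

If ρ(0) > 0, then E(t) < 0 for t > 0, and ρ ≥ -(2m/κ)E with E nonincreasing keeps ρ away from zero.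
The dissipation controls K but not Q. The latter is reached through the mean V of q sin ω: its
derivative contains -(κ/m) times the mean of q² cos ω, and the rest is absorbed into half of this
term and a multiple of K (`virialRate_le`). Thus V plus a large multiple of E is a Lyapunov
functional, and K and Q are integrable in time (`integrableOn_kinetic_and_spread`). Both are bounded
with bounded derivative, so they tend to 0; ρ then converges because E does.

The delicate point is the argument of z. It turns at speed α/ρ, where α is the mean of rω, and the
available bound |α| ≤ √K is not integrable. The remedy is the mean N of qr (`twist`): N' = D - α,
where D consists of ρ times the mean frequency, which decays exponentially, and of terms O(Q + K)
(`hasDerivAt_twist`, `abs_rotationDefect_le`). Hence (ρ + iN)z has an integrable derivative and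
converges. Since N² ≤ Q tends to 0 and ρ has a positive limit, z itself converges to some Re^{iφ}
with R > 0, and no angle has to be lifted to the line.

In the limit the mean of sin²(θ - φ) vanishes while that of cos(θ - φ) is R, which forces the masses
(1 ± R)/2 at φ and φ + π. An explicit splitting of each point between the two poles bounds both the
Wasserstein distance and integrals of Lipschitz functions by `bipolarDefect`.

The definition of solution only admits compactly supported test functions and gives no uniformity in
time of the second moment. Friction provides that uniformity
(`IsMeasureValuedSolution.moment_sq_le`), and a cutoff argument then yields the weak equation for
observables of quadratic growth (`IsMeasureValuedSolution.moment_sub_moment`). Third moments are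
never available, which dictates the choice of observables later on. -/

instance factTwoPiPos : Fact (0 < 2 * Real.pi) := ⟨Real.two_pi_pos⟩

/-- The cosine function on the circle. -/
noncomputable def torusCos : Torus → ℝ := Real.cos_periodic.lift

/-- The derivative of a function on the circle. -/
noncomputable def torusDeriv (a : Torus → ℝ) (θ : Torus) : ℝ :=
  deriv (fun h : ℝ => a (θ + (h : Torus))) 0

/-- Smooth functions on the circle. -/
def TorusSmooth (a : Torus → ℝ) : Prop := ContDiff ℝ ∞ (fun x : ℝ => a (x : Torus))

@[simp] lemma torusSin_coe (x : ℝ) : torusSin (x : Torus) = Real.sin x := rfl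

@[simp] lemma torusCos_coe (x : ℝ) : torusCos (x : Torus) = Real.cos x := rfl

lemma torusExp_coe (x : ℝ) : torusExp (x : Torus) = Complex.exp (x * Complex.I) := by
  unfold torusExp
  rw [AddCircle.toCircle_apply_mk, div_self (by positivity), one_mul, Circle.coe_exp]

lemma torusExp_eq (θ : Torus) : torusExp θ = (torusCos θ : ℂ) + torusSin θ * Complex.I := by
  induction θ using QuotientAddGroup.induction_on with
  | H x =>
    rw [torusExp_coe, Complex.exp_mul_I]
    simp

lemma torusSin_sub (α β : Torus) :
    torusSin (α - β) = torusSin α * torusCos β - torusCos α * torusSin β := by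
  induction α using QuotientAddGroup.induction_on with
  | H x =>
    induction β using QuotientAddGroup.induction_on with
    | H y => exact Real.sin_sub x y

lemma torusCos_sub (α β : Torus) :
    torusCos (α - β) = torusCos α * torusCos β + torusSin α * torusSin β := by
  induction α using QuotientAddGroup.induction_on with
  | H x =>
    induction β using QuotientAddGroup.induction_on with
    | H y => exact Real.cos_sub x y

lemma torusSin_sq_add_torusCos_sq (θ : Torus) : torusSin θ ^ 2 + torusCos θ ^ 2 = 1 := by
  induction θ using QuotientAddGroup.induction_on with
  | H x => exact Real.sin_sq_add_cos_sq x

lemma torusDeriv_coe (a : Torus → ℝ) (x : ℝ) :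
    torusDeriv a (x : Torus) = deriv (fun y : ℝ => a (y : Torus)) x := by
  unfold torusDeriv
  have : (fun h : ℝ => a ((x : Torus) + (h : Torus)))
      = fun h : ℝ => (fun y : ℝ => a (y : Torus)) (x + h) := by
    funext h; simp
  rw [this, deriv_comp_const_add (fun y : ℝ => a (y : Torus)) x 0, add_zero]

lemma torusDeriv_eq_of_hasDerivAt {a a' : Torus → ℝ}
    (h : ∀ x : ℝ, HasDerivAt (fun y : ℝ => a (y : Torus)) (a' (x : Torus)) x) :
    torusDeriv a = a' := by
  funext θ
  induction θ using QuotientAddGroup.induction_on with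
  | H x => exact (torusDeriv_coe a x).trans (h x).deriv

@[simp] lemma torusDeriv_torusSin : torusDeriv torusSin = torusCos :=
  torusDeriv_eq_of_hasDerivAt fun x => Real.hasDerivAt_sin x

@[simp] lemma torusDeriv_torusCos : torusDeriv torusCos = fun θ => -torusSin θ :=
  torusDeriv_eq_of_hasDerivAt fun x => Real.hasDerivAt_cos x

@[simp] lemma torusDeriv_const (c : ℝ) : torusDeriv (fun _ => c) = fun _ => 0 :=
  torusDeriv_eq_of_hasDerivAt fun x => hasDerivAt_const x c

namespace TorusSmooth

lemma const (c : ℝ) : TorusSmooth (fun _ => c) := contDiff_const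

lemma torusSin : TorusSmooth torusSin := Real.contDiff_sin

lemma torusCos : TorusSmooth torusCos := Real.contDiff_cos

variable {a b : Torus → ℝ}

lemma mul (ha : TorusSmooth a) (hb : TorusSmooth b) : TorusSmooth (fun θ => a θ * b θ) :=
  ContDiff.mul ha hb

lemma add (ha : TorusSmooth a) (hb : TorusSmooth b) : TorusSmooth (fun θ => a θ + b θ) :=
  ContDiff.add ha hb

lemma torusDeriv (ha : TorusSmooth a) : TorusSmooth (torusDeriv a) := by
  unfold TorusSmooth
  simp_rw [torusDeriv_coe]
  exact (contDiff_infty_iff_deriv.1 ha).2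

lemma hasDerivAt (ha : TorusSmooth a) (x : ℝ) :
    HasDerivAt (fun y : ℝ => a (y : Torus)) (KineticKuramoto.torusDeriv a (x : Torus)) x := by
  rw [torusDeriv_coe]
  exact ((contDiff_infty_iff_deriv.1 ha).1 x).hasDerivAt

lemma torusDeriv_mul (ha : TorusSmooth a) (hb : TorusSmooth b) :
    KineticKuramoto.torusDeriv (fun θ => a θ * b θ) =
      fun θ => KineticKuramoto.torusDeriv a θ * b θ + a θ * KineticKuramoto.torusDeriv b θ :=
  torusDeriv_eq_of_hasDerivAt fun x => (ha.hasDerivAt x).mul (hb.hasDerivAt x)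

lemma continuous (ha : TorusSmooth a) : Continuous a :=
  continuous_coinduced_dom.2 (ContDiff.continuous ha)

lemma exists_bound (ha : TorusSmooth a) : ∃ A : ℝ, 0 ≤ A ∧ ∀ θ, |a θ| ≤ A := by
  obtain ⟨A, hA⟩ := isCompact_univ.exists_bound_of_continuousOn ha.continuous.continuousOn
  exact ⟨A, (norm_nonneg _).trans (hA 0 (mem_univ _)), fun θ => hA θ (mem_univ _)⟩

end TorusSmooth

lemma abs_torusSin_le_one (θ : Torus) : |torusSin θ| ≤ 1 := by
  have := torusSin_sq_add_torusCos_sq θ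
  exact abs_le_one_iff_mul_self_le_one.2 (by nlinarith [sq_nonneg (torusCos θ)])

lemma abs_torusCos_le_one (θ : Torus) : |torusCos θ| ≤ 1 := by
  have := torusSin_sq_add_torusCos_sq θ
  exact abs_le_one_iff_mul_self_le_one.2 (by nlinarith [sq_nonneg (torusSin θ)])

/-! ### Cutoff functions -/

/-- A smooth bump function, equal to `1` on `[-1, 1]` and to `0` outside `[-√2, √2]`. -/
noncomputable def bump (x : ℝ) : ℝ := Real.smoothTransition (2 - x ^ 2)

/-- The rescaled bump function, equal to `1` on `[-(n + 1), n + 1]`. -/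
noncomputable def cutoff (n : ℕ) (x : ℝ) : ℝ := bump (x / (n + 1))

lemma contDiff_bump : ContDiff ℝ ∞ bump := by
  unfold bump
  exact Real.smoothTransition.contDiff.comp (by fun_prop)

lemma bump_eq_one {x : ℝ} (hx : |x| ≤ 1) : bump x = 1 := by
  refine Real.smoothTransition.one_of_one_le ?_
  have := (sq_le_one_iff_abs_le_one x).2 hx
  linarith

lemma bump_eq_zero {x : ℝ} (hx : 2 ≤ x ^ 2) : bump x = 0 :=
  Real.smoothTransition.zero_of_nonpos (by linarith)

lemma hasCompactSupport_bump : HasCompactSupport bump := by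
  refine HasCompactSupport.intro (isCompact_Icc (a := (-2 : ℝ)) (b := 2)) fun x hx => ?_
  refine bump_eq_zero ?_
  by_contra h
  exact hx ⟨by nlinarith, by nlinarith⟩

lemma contDiff_cutoff (n : ℕ) : ContDiff ℝ ∞ (cutoff n) :=
  contDiff_bump.comp (contDiff_id.div_const _)

lemma cutoff_nonneg (n : ℕ) (x : ℝ) : 0 ≤ cutoff n x := Real.smoothTransition.nonneg _

lemma cutoff_le_one (n : ℕ) (x : ℝ) : cutoff n x ≤ 1 := Real.smoothTransition.le_one _

lemma abs_cutoff_le_one (n : ℕ) (x : ℝ) : |cutoff n x| ≤ 1 := by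
  rw [abs_of_nonneg (cutoff_nonneg n x)]; exact cutoff_le_one n x

lemma cutoff_eq_one {n : ℕ} {x : ℝ} (hx : |x| ≤ n + 1) : cutoff n x = 1 := by
  refine bump_eq_one ?_
  have : (0 : ℝ) < n + 1 := by positivity
  rw [abs_div, abs_of_pos this]
  exact (div_le_one this).2 hx

lemma hasCompactSupport_cutoff (n : ℕ) : HasCompactSupport (cutoff n) := by
  have : (0 : ℝ) < n + 1 := by positivity
  exact hasCompactSupport_bump.comp_homeomorph
    (Homeomorph.mulRight₀ ((n : ℝ) + 1)⁻¹ (by positivity))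

lemma deriv_cutoff (n : ℕ) (x : ℝ) :
    deriv (cutoff n) x = deriv bump (x / (n + 1)) / (n + 1) := by
  have h1 := ((contDiff_infty_iff_deriv.1 contDiff_bump).1 (x / (n + 1))).hasDerivAt
  have h2 := h1.comp x ((hasDerivAt_id x).div_const ((n : ℝ) + 1))
  refine (h2.deriv).trans ?_
  simp [div_eq_mul_inv]

lemma deriv_cutoff_eq_zero {n : ℕ} {x : ℝ} (hx : |x| < n + 1) : deriv (cutoff n) x = 0 := by
  have : cutoff n =ᶠ[𝓝 x] fun _ => 1 := by
    filter_upwards [(isOpen_lt continuous_abs continuous_const).mem_nhds hx] with y hy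
    exact cutoff_eq_one (le_of_lt hy)
  rw [this.deriv_eq, deriv_const]

/-- Scale invariance: x times the derivative of the rescaled bump at x is y times the derivative of
the bump at y = x / (n + 1), so one bound serves all n. -/
lemma exists_bound_mul_deriv_cutoff :
    ∃ B : ℝ, 0 ≤ B ∧ ∀ (n : ℕ) (x : ℝ), |x * deriv (cutoff n) x| ≤ B := by
  have hc : Continuous fun x : ℝ => x * deriv bump x :=
    continuous_id.mul (contDiff_bump.continuous_deriv (by simp))
  obtain ⟨B, hB⟩ := hc.bounded_above_of_compact_support
    (hasCompactSupport_bump.deriv.mul_left)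
  refine ⟨B, (norm_nonneg _).trans (hB 0), fun n x => ?_⟩
  have := hB (x / (n + 1))
  rw [deriv_cutoff]
  rw [Real.norm_eq_abs] at this
  convert this using 2
  ring

/-- The derivative vanishes for |x| < n + 1, so where it matters 1 ≤ |x| and the weight 1 + |x| is
at most 2|x|. This uniform bound makes the commutator with the cutoff harmless. -/
lemma exists_bound_deriv_cutoff :
    ∃ B : ℝ, 0 ≤ B ∧ ∀ (n : ℕ) (x : ℝ), |deriv (cutoff n) x| * (1 + |x|) ≤ B := by
  obtain ⟨B, hB0, hB⟩ := exists_bound_mul_deriv_cutoff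
  refine ⟨2 * B, by positivity, fun n x => ?_⟩
  by_cases hx : |x| < n + 1
  · rw [deriv_cutoff_eq_zero hx]; simpa using hB0
  · have h1 : (1 : ℝ) ≤ |x| := by
      have : (0 : ℝ) ≤ n := by positivity
      linarith
    have h2 := hB n x
    rw [abs_mul] at h2
    nlinarith [abs_nonneg (deriv (cutoff n) x)]

lemma tendsto_cutoff (x : ℝ) : Tendsto (fun n : ℕ => cutoff n x) atTop (𝓝 1) := by
  refine tendsto_const_nhds.congr' ?_
  filter_upwards [eventually_ge_atTop ⌈|x|⌉₊] with n hn
  have : |x| ≤ n := (Nat.le_ceil _).trans (by exact_mod_cast hn)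
  exact (cutoff_eq_one (by linarith)).symm

lemma tendsto_deriv_cutoff (x : ℝ) : Tendsto (fun n : ℕ => deriv (cutoff n) x) atTop (𝓝 0) := by
  refine tendsto_const_nhds.congr' ?_
  filter_upwards [eventually_ge_atTop ⌈|x|⌉₊] with n hn
  have : |x| ≤ n := (Nat.le_ceil _).trans (by exact_mod_cast hn)
  exact (deriv_cutoff_eq_zero (by linarith)).symm

end KineticKuramoto

namespace KineticKuramoto

open scoped ContDiff

/-! ### Moments and the weak equation for compactly supported observables -/

/-- The moment `∫ a(θ) b(ω) dμ_t`, extended by its initial value to negative times. -/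
noncomputable def moment (μ : ℝ → ProbabilityMeasure Phase) (a : Torus → ℝ) (b : ℝ → ℝ)
    (t : ℝ) : ℝ :=
  ∫ z, a z.1 * b z.2 ∂(μ (max t 0) : Measure Phase)

/-- The action of the generator on `a(θ) b(ω)`, integrated against `ν`. -/
noncomputable def generatorIntegral (m γ κ : ℝ) (ν : Measure Phase) (a : Torus → ℝ) (b : ℝ → ℝ) :
    ℝ :=
  ∫ z, (torusDeriv a z.1 * (z.2 * b z.2) + force m γ κ ν z.1 z.2 * (a z.1 * deriv b z.2)) ∂ν

lemma integrable_of_growth {ν : Measure Phase} [IsFiniteMeasure ν]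
    (h2 : Integrable (fun z : Phase => z.2 ^ 2) ν) {f : Phase → ℝ} (hf : Continuous f) {B : ℝ}
    (hB : ∀ z, |f z| ≤ B * (1 + z.2 ^ 2)) : Integrable f ν :=
  Integrable.mono' (((integrable_const 1).add h2).const_mul B) hf.aestronglyMeasurable
    (Eventually.of_forall hB)

lemma TorusSmooth.integrable {ν : Measure Phase} [IsFiniteMeasure ν] {a : Torus → ℝ}
    (ha : TorusSmooth a) : Integrable (fun z : Phase => a z.1) ν := by
  obtain ⟨A, -, hA⟩ := ha.exists_bound
  exact Integrable.of_bound (ha.continuous.comp continuous_fst).aestronglyMeasurable A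
    (Eventually.of_forall fun z => hA z.1)

lemma integral_torusSin_sub {ν : Measure Phase} [IsFiniteMeasure ν] (θ : Torus) :
    ∫ z, torusSin (z.1 - θ) ∂ν =
      (∫ z, torusSin z.1 ∂ν) * torusCos θ - (∫ z, torusCos z.1 ∂ν) * torusSin θ := by
  simp_rw [torusSin_sub]
  rw [integral_sub (TorusSmooth.torusSin.integrable.mul_const _)
    (TorusSmooth.torusCos.integrable.mul_const _), integral_mul_const, integral_mul_const]

lemma abs_integral_torusSin_sub_le {ν : Measure Phase} [IsProbabilityMeasure ν] (θ : Torus) :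
    |∫ z, torusSin (z.1 - θ) ∂ν| ≤ 1 := by
  have := norm_integral_le_of_norm_le_const (μ := ν) (f := fun z : Phase => torusSin (z.1 - θ))
    (C := 1) (Eventually.of_forall fun z => abs_torusSin_le_one _)
  simpa using this

lemma continuous_force (m γ κ : ℝ) (ν : Measure Phase) [IsFiniteMeasure ν] :
    Continuous fun z : Phase => force m γ κ ν z.1 z.2 := by
  unfold force
  simp_rw [integral_torusSin_sub]
  have h1 := TorusSmooth.torusSin.continuous
  have h2 := TorusSmooth.torusCos.continuous
  fun_prop

lemma abs_force_le {m γ κ : ℝ} (hm : 0 < m) (hγ : 0 < γ) (hκ : 0 < κ) (ν : Measure Phase)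
    [IsProbabilityMeasure ν] (θ : Torus) (w : ℝ) :
    |force m γ κ ν θ w| ≤ (γ + κ) / m * (1 + |w|) := by
  unfold force
  have h := abs_integral_torusSin_sub_le (ν := ν) θ
  set σ := ∫ z, torusSin (z.1 - θ) ∂ν
  rw [abs_mul, abs_of_pos (by positivity : 0 < 1 / m)]
  have h1 : |-γ * w + κ * σ| ≤ γ * |w| + κ * |σ| := by
    refine (abs_add_le _ _).trans (le_of_eq ?_)
    rw [abs_mul, abs_mul, abs_neg, abs_of_pos hγ, abs_of_pos hκ]
  have h2 : |-γ * w + κ * σ| ≤ (γ + κ) * (1 + |w|) := by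
    nlinarith [abs_nonneg w, abs_nonneg σ]
  calc 1 / m * |-γ * w + κ * σ| ≤ 1 / m * ((γ + κ) * (1 + |w|)) := by gcongr
    _ = _ := by ring

/-- Test functions must have compact support in time as well; the factor `cutoff n t` supplies it
and is constant on any prescribed [0, t] once n is large. -/
lemma isTestFunction_mul {a : Torus → ℝ} {b : ℝ → ℝ} (ha : TorusSmooth a) (hb : ContDiff ℝ ∞ b)
    (hs : HasCompactSupport b) (n : ℕ) :
    IsTestFunction fun θ w t => a θ * b w * cutoff n t where
  contDiff := by
    have h1 : ContDiff ℝ ∞ fun p : ℝ × ℝ × ℝ => a (p.1 : Torus) :=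
      ContDiff.comp (g := fun x : ℝ => a (x : Torus)) ha contDiff_fst
    have h2 : ContDiff ℝ ∞ fun p : ℝ × ℝ × ℝ => b p.2.1 :=
      hb.comp (contDiff_fst.comp contDiff_snd)
    have h3 : ContDiff ℝ ∞ fun p : ℝ × ℝ × ℝ => cutoff n p.2.2 :=
      (contDiff_cutoff n).comp (contDiff_snd.comp contDiff_snd)
    exact ((h1.mul h2).mul h3).of_le (by exact_mod_cast le_top)
  hasCompactSupport := by
    refine HasCompactSupport.intro
      (isCompact_univ.prod (hs.isCompact.prod (hasCompactSupport_cutoff n).isCompact)) ?_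
    rintro ⟨θ, w, t⟩ h
    simp only [mem_prod, mem_univ, true_and, not_and_or] at h
    rcases h with h | h
    · simp [image_eq_zero_of_notMem_tsupport h]
    · simp [image_eq_zero_of_notMem_tsupport h]

variable {m γ κ : ℝ} {μ : ℝ → ProbabilityMeasure Phase}

lemma IsMeasureValuedSolution.continuous_moment (hμ : IsMeasureValuedSolution m γ κ μ)
    {a : Torus → ℝ} {b : ℝ → ℝ} (ha : TorusSmooth a) (hb : ContDiff ℝ ∞ b)
    (hs : HasCompactSupport b) : Continuous (moment μ a b) := by
  refine continuous_iff_continuousAt.2 fun t₀ => ?_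
  obtain ⟨n, hn⟩ := exists_nat_gt |t₀|
  -- Freezing time at 0 on the negative axis turns continuity on `Ici 0` into continuity on the
  -- whole line.
  have h1 := (hμ.weakly_continuous _ (isTestFunction_mul ha hb hs n)).comp_continuous
    (f := fun t : ℝ => max t 0) (by fun_prop) (fun t => le_max_right t 0)
  refine h1.continuousAt.congr ?_
  filter_upwards [(isOpen_lt continuous_abs continuous_const).mem_nhds hn] with t ht
  have ht' : |max t 0| ≤ n + 1 := by
    have := abs_lt.1 (show |t| < n from ht)
    have hn0 : (0 : ℝ) ≤ n := by positivity
    rw [abs_of_nonneg (le_max_right _ _)]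
    exact max_le (by linarith) (by linarith)
  simp [moment, cutoff_eq_one ht']

lemma IsMeasureValuedSolution.moment_sub_moment_of_hasCompactSupport
    (hμ : IsMeasureValuedSolution m γ κ μ)
    {a : Torus → ℝ} {b : ℝ → ℝ} (ha : TorusSmooth a) (hb : ContDiff ℝ ∞ b)
    (hs : HasCompactSupport b) {t : ℝ} (ht : 0 ≤ t) :
    moment μ a b t - moment μ a b 0 =
      ∫ s in (0 : ℝ)..t, generatorIntegral m γ κ (μ (max s 0) : Measure Phase) a b := by
  obtain ⟨n, hn⟩ := exists_nat_gt t
  have hn0 : (0 : ℝ) ≤ n := by positivity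
  have h := hμ.weak_equation _ (isTestFunction_mul ha hb hs n) t ht
  have e1 : cutoff n t = 1 := cutoff_eq_one (by rw [abs_of_nonneg ht]; linarith)
  have e0 : cutoff n 0 = 1 := cutoff_eq_one (by rw [abs_zero]; linarith)
  simp only [e1, e0, mul_one] at h
  unfold moment
  rw [max_eq_left ht, max_self, h]
  refine intervalIntegral.integral_congr fun s hs' => ?_
  rw [uIcc_of_le ht] at hs'
  have es : cutoff n s = 1 := cutoff_eq_one (by rw [abs_of_nonneg hs'.1]; linarith [hs'.2])
  have ds : deriv (cutoff n) s = 0 :=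
    deriv_cutoff_eq_zero (by rw [abs_of_nonneg hs'.1]; linarith [hs'.2])
  simp only [max_eq_left hs'.1, generatorIntegral]
  refine integral_congr_ae (Eventually.of_forall fun z => ?_)
  simp only [dTime, dTheta, dOmega, deriv_const_mul_field, deriv_mul_const_field, ds, es,
    torusDeriv]
  ring

/-- No integrability is assumed: the integral of a non-integrable function is 0 by convention, which
is below c t because c ≥ 0. -/
lemma intervalIntegral_le_of_le {f : ℝ → ℝ} {c t : ℝ} (hc : 0 ≤ c) (ht : 0 ≤ t)
    (hf : ∀ s, f s ≤ c) : ∫ s in (0 : ℝ)..t, f s ≤ c * t := by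
  by_cases hi : IntervalIntegrable f volume 0 t
  · calc ∫ s in (0 : ℝ)..t, f s ≤ ∫ _ in (0 : ℝ)..t, c :=
        intervalIntegral.integral_mono_on ht hi (by simp) fun s _ => hf s
      _ = c * t := by simp [mul_comm]
  · rw [intervalIntegral.integral_undef hi]; positivity

/-! ### The second moment is locally bounded in time -/

/-- A smooth nondecreasing function, zero on `(-∞, 0]` and equal to `x` on `[1, ∞)`. -/
noncomputable def ramp (x : ℝ) : ℝ := x * Real.smoothTransition x

lemma contDiff_ramp : ContDiff ℝ ∞ ramp := contDiff_id.mul Real.smoothTransition.contDiff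

lemma monotone_ramp : Monotone ramp := by
  intro x y hxy
  unfold ramp
  rcases le_total x 0 with hx | hx
  · rw [Real.smoothTransition.zero_of_nonpos hx, mul_zero]
    rcases le_total y 0 with hy | hy
    · rw [Real.smoothTransition.zero_of_nonpos hy, mul_zero]
    · exact mul_nonneg hy (Real.smoothTransition.nonneg y)
  · exact mul_le_mul hxy (Real.smoothTransition.monotone hxy) (Real.smoothTransition.nonneg x)
      (hx.trans hxy)

lemma deriv_ramp_of_one_lt {x : ℝ} (hx : 1 < x) : deriv ramp x = 1 := by
  have : ramp =ᶠ[𝓝 x] fun y => y := by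
    filter_upwards [lt_mem_nhds hx] with y hy
    simp [ramp, Real.smoothTransition.one_of_one_le hy.le]
  exact this.deriv_eq.trans (deriv_id x)

/-- A compactly supported function, nondecreasing in `|ω|`, which differs from `ω ^ 2` by
the constant `2 (n + 1) ^ 2` on `[-(n + 1), n + 1]`. -/
noncomputable def squareCutoff (n : ℕ) (w : ℝ) : ℝ :=
  -(n + 1 : ℝ) ^ 2 * ramp (2 - (w / (n + 1)) ^ 2)

lemma contDiff_squareCutoff (n : ℕ) : ContDiff ℝ ∞ (squareCutoff n) :=
  contDiff_const.mul (contDiff_ramp.comp (by fun_prop))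

lemma squareCutoff_eq (n : ℕ) (w : ℝ) :
    squareCutoff n w = (w ^ 2 - 2 * (n + 1 : ℝ) ^ 2) * cutoff n w := by
  have : (n + 1 : ℝ) ≠ 0 := by positivity
  unfold squareCutoff ramp cutoff bump
  field_simp
  ring

lemma hasCompactSupport_squareCutoff (n : ℕ) : HasCompactSupport (squareCutoff n) := by
  have : squareCutoff n = (fun w : ℝ => w ^ 2 - 2 * (n + 1 : ℝ) ^ 2) * cutoff n := by
    funext w; exact squareCutoff_eq n w
  rw [this]
  exact (hasCompactSupport_cutoff n).mul_left

lemma deriv_squareCutoff (n : ℕ) (w : ℝ) :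
    deriv (squareCutoff n) w = 2 * w * deriv ramp (2 - (w / (n + 1)) ^ 2) := by
  have hn : (n + 1 : ℝ) ≠ 0 := by positivity
  have h1 := ((contDiff_infty_iff_deriv.1 contDiff_ramp).1 (2 - (w / (n + 1)) ^ 2)).hasDerivAt
  have h2 : HasDerivAt (fun x : ℝ => 2 - (x / (n + 1)) ^ 2)
      (-(2 * (w / (n + 1)) * (1 / (n + 1)))) w := by
    simpa using (((hasDerivAt_id w).div_const ((n : ℝ) + 1)).pow 2).const_sub 2
  refine ((h1.comp w h2).const_mul (-(n + 1 : ℝ) ^ 2)).deriv.trans ?_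
  field_simp

lemma sq_mul_cutoff_le_squareCutoff_add (n : ℕ) (w : ℝ) :
    w ^ 2 * cutoff n w ≤ squareCutoff n w + 2 * (n + 1 : ℝ) ^ 2 := by
  rw [squareCutoff_eq]
  nlinarith [cutoff_le_one n w, sq_nonneg (n + 1 : ℝ)]

lemma squareCutoff_add_le (n : ℕ) (w : ℝ) :
    squareCutoff n w + 2 * (n + 1 : ℝ) ^ 2 ≤ 2 * w ^ 2 := by
  rw [squareCutoff_eq]
  by_cases h : |w| ≤ n + 1
  · rw [cutoff_eq_one h]; nlinarith [sq_nonneg w]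
  · push Not at h
    have : (n + 1 : ℝ) ^ 2 ≤ w ^ 2 := by
      rw [← sq_abs w]; gcongr
    nlinarith [cutoff_le_one n w, cutoff_nonneg n w, mul_nonneg (cutoff_nonneg n w) (sq_nonneg w)]

/-- Friction beats the coupling for |ω| ≥ κ/γ, where the product is nonpositive because
`squareCutoff n` is nondecreasing in |ω|. For smaller |ω| the condition on n puts ω where the
truncation is inactive, and κ|ω| ≤ κ²/γ. The bound does not depend on n. -/
lemma force_mul_deriv_squareCutoff_le (hm : 0 < m) (hγ : 0 < γ) (hκ : 0 < κ)
    (ν : Measure Phase) [IsProbabilityMeasure ν] {n : ℕ} (hn : κ / γ < n + 1) (θ : Torus) (w : ℝ) :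
    force m γ κ ν θ w * deriv (squareCutoff n) w ≤ 2 / m * (κ ^ 2 / γ) := by
  rw [deriv_squareCutoff]
  unfold force
  have h := abs_integral_torusSin_sub_le (ν := ν) θ
  set σ := ∫ z, torusSin (z.1 - θ) ∂ν
  set d := deriv ramp (2 - (w / (n + 1)) ^ 2) with hd
  have hd0 : 0 ≤ d := monotone_ramp.deriv_nonneg
  have hn0 : (0 : ℝ) < n + 1 := by positivity
  have hσ : κ * σ * w ≤ κ * |w| := by
    have h1 : σ * w ≤ |w| := by
      calc σ * w ≤ |σ * w| := le_abs_self _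
        _ = |σ| * |w| := abs_mul _ _
        _ ≤ 1 * |w| := by gcongr
        _ = |w| := one_mul _
    nlinarith
  have key : 1 / m * (-γ * w + κ * σ) * (2 * w * d) =
      2 / m * ((-γ * w ^ 2 + κ * σ * w) * d) := by ring
  rw [key]
  refine mul_le_mul_of_nonneg_left ?_ (by positivity)
  have hsq : w ^ 2 = |w| ^ 2 := (sq_abs w).symm
  by_cases hw : κ / γ ≤ |w|
  · have h2 : κ ≤ γ * |w| := by rw [div_le_iff₀ hγ] at hw; linarith
    have h3 : -γ * w ^ 2 + κ * σ * w ≤ 0 := by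
      rw [hsq]; nlinarith [abs_nonneg w]
    have : 0 ≤ κ ^ 2 / γ := by positivity
    nlinarith
  · push Not at hw
    have h4 : |w / (n + 1)| < 1 := by
      rw [abs_div, abs_of_pos hn0, div_lt_one hn0]; linarith
    have h5 : d = 1 := by
      rw [hd]
      refine deriv_ramp_of_one_lt ?_
      have := (sq_lt_one_iff_abs_lt_one _).2 h4
      linarith
    rw [h5, mul_one]
    have h6 : κ * |w| ≤ κ * (κ / γ) := by gcongr
    have h7 : κ * (κ / γ) = κ ^ 2 / γ := by ring
    nlinarith [mul_nonneg hγ.le (sq_nonneg w)]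

lemma integrable_mul_of_hasCompactSupport {ν : Measure Phase} [IsFiniteMeasure ν]
    {a : Torus → ℝ} {b : ℝ → ℝ} (ha : TorusSmooth a) (hb : Continuous b)
    (hs : HasCompactSupport b) : Integrable (fun z : Phase => a z.1 * b z.2) ν := by
  obtain ⟨A, hA0, hA⟩ := ha.exists_bound
  obtain ⟨B, hB⟩ := hb.bounded_above_of_compact_support hs
  refine Integrable.of_bound (C := A * B) ((ha.continuous.comp continuous_fst).mul
    (hb.comp continuous_snd)).aestronglyMeasurable (Eventually.of_forall fun z => ?_)
  rw [norm_mul]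
  exact mul_le_mul (hA _) (hB _) (norm_nonneg _) hA0

lemma integrable_sq (hμ : IsMeasureValuedSolution m γ κ μ) (t : ℝ) :
    Integrable (fun z : Phase => z.2 ^ 2) (μ (max t 0) : Measure Phase) :=
  hμ.finite_second_moment _ (le_max_right t 0)

lemma moment_one_sq (μ : ℝ → ProbabilityMeasure Phase) (t : ℝ) :
    moment μ (fun _ => 1) (fun w => w ^ 2) t = ∫ z, z.2 ^ 2 ∂(μ (max t 0) : Measure Phase) := by
  simp [moment]

/-- The definition of solution gives finiteness of the second moment at each time only. The weak
equation for `squareCutoff n`, whose growth rate is bounded uniformly in n, gives local boundedness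
in time, which dominates all later limits. -/
lemma IsMeasureValuedSolution.moment_sq_le (hμ : IsMeasureValuedSolution m γ κ μ)
    (hm : 0 < m) (hγ : 0 < γ) (hκ : 0 < κ) {t : ℝ} (ht : 0 ≤ t) :
    moment μ (fun _ => 1) (fun w => w ^ 2) t ≤
      2 * moment μ (fun _ => 1) (fun w => w ^ 2) 0 + 2 / m * (κ ^ 2 / γ) * t := by
  have hlim : Tendsto (fun n : ℕ => ∫ z, z.2 ^ 2 * cutoff n z.2 ∂(μ (max t 0) : Measure Phase))
      atTop (𝓝 (∫ z, z.2 ^ 2 ∂(μ (max t 0) : Measure Phase))) := by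
    refine tendsto_integral_of_dominated_convergence (fun z : Phase => z.2 ^ 2) (fun n => ?_)
      (integrable_sq hμ t) (fun n => Eventually.of_forall fun z => ?_)
      (Eventually.of_forall fun z => ?_)
    · exact ((continuous_snd.pow 2).mul
        ((contDiff_cutoff n).continuous.comp continuous_snd)).aestronglyMeasurable
    · rw [norm_mul, Real.norm_eq_abs, Real.norm_eq_abs, abs_of_nonneg (sq_nonneg z.2)]
      exact mul_le_of_le_one_right (sq_nonneg _) (abs_cutoff_le_one n _)
    · simpa using (tendsto_cutoff z.2).const_mul (z.2 ^ 2)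
  rw [moment_one_sq, moment_one_sq]
  refine le_of_tendsto hlim ?_
  obtain ⟨n₀, hn₀⟩ := exists_nat_gt (κ / γ)
  filter_upwards [eventually_ge_atTop n₀] with n hn
  have hn' : κ / γ < n + 1 := by
    have : (n₀ : ℝ) ≤ n := by exact_mod_cast hn
    linarith
  have hcs := hasCompactSupport_squareCutoff n
  have hcd := contDiff_squareCutoff n
  have hw := hμ.moment_sub_moment_of_hasCompactSupport (TorusSmooth.const 1) hcd hcs ht
  have hle : ∫ s in (0 : ℝ)..t, generatorIntegral m γ κ (μ (max s 0) : Measure Phase)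
      (fun _ => 1) (squareCutoff n) ≤ 2 / m * (κ ^ 2 / γ) * t := by
    refine intervalIntegral_le_of_le (by positivity) ht fun s => ?_
    have hb := fun z : Phase =>
      force_mul_deriv_squareCutoff_le hm hγ hκ (μ (max s 0) : Measure Phase) hn' z.1 z.2
    unfold generatorIntegral
    simp only [torusDeriv_const, zero_mul, zero_add, one_mul]
    by_cases hi : Integrable (fun z : Phase => force m γ κ (μ (max s 0) : Measure Phase) z.1 z.2 *
        deriv (squareCutoff n) z.2) (μ (max s 0) : Measure Phase)
    · refine (integral_mono hi (integrable_const _) hb).trans ?_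
      simp
    -- A non-integrable integrand would have integral 0, still below the bound.
    · rw [integral_undef hi]; positivity
  have hI : ∀ s, Integrable (fun z : Phase => squareCutoff n z.2)
      (μ (max s 0) : Measure Phase) := fun s => by
    simpa using integrable_mul_of_hasCompactSupport (ν := (μ (max s 0) : Measure Phase))
      (TorusSmooth.const 1) hcd.continuous hcs
  -- The constant 2(n + 1)² separates `squareCutoff n` from a nonnegative truncation of ω². As each
  -- measure has mass one, it contributes equally at times t and 0 and cancels.
  have h1 : ∫ z, z.2 ^ 2 * cutoff n z.2 ∂(μ (max t 0) : Measure Phase) ≤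
      moment μ (fun _ => 1) (squareCutoff n) t + 2 * (n + 1 : ℝ) ^ 2 := by
    have : moment μ (fun _ => 1) (squareCutoff n) t + 2 * (n + 1 : ℝ) ^ 2 =
        ∫ z, (squareCutoff n z.2 + 2 * (n + 1 : ℝ) ^ 2) ∂(μ (max t 0) : Measure Phase) := by
      rw [integral_add (hI t) (integrable_const _)]
      simp [moment]
    rw [this]
    refine integral_mono ?_ ((hI t).add (integrable_const _))
      fun z => sq_mul_cutoff_le_squareCutoff_add n z.2
    refine (integrable_sq hμ t).mono' ((continuous_snd.pow 2).mul
        ((contDiff_cutoff n).continuous.comp continuous_snd)).aestronglyMeasurable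
        (Eventually.of_forall fun z => ?_)
    rw [norm_mul, Real.norm_eq_abs, Real.norm_eq_abs, abs_of_nonneg (sq_nonneg z.2)]
    exact mul_le_of_le_one_right (sq_nonneg _) (abs_cutoff_le_one n _)
  have h2 : moment μ (fun _ => 1) (squareCutoff n) 0 + 2 * (n + 1 : ℝ) ^ 2 ≤
      2 * ∫ z, z.2 ^ 2 ∂(μ (max 0 0) : Measure Phase) := by
    have : moment μ (fun _ => 1) (squareCutoff n) 0 + 2 * (n + 1 : ℝ) ^ 2 =
        ∫ z, (squareCutoff n z.2 + 2 * (n + 1 : ℝ) ^ 2) ∂(μ (max 0 0) : Measure Phase) := by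
      rw [integral_add (hI 0) (integrable_const _)]
      simp [moment]
    rw [this, ← integral_const_mul]
    exact integral_mono ((hI 0).add (integrable_const _)) ((integrable_sq hμ 0).const_mul 2)
      fun z => squareCutoff_add_le n z.2
  linarith

end KineticKuramoto

namespace KineticKuramoto

open scoped ContDiff

/-! ### The weak equation for observables of quadratic growth -/

/-- Observables `a(θ) b(ω)` of at most quadratic growth whose image under the generator has at most
quadratic growth. -/
structure Admissible (a : Torus → ℝ) (b : ℝ → ℝ) (B : ℝ) : Prop where
  smooth_left : TorusSmooth a
  smooth_right : ContDiff ℝ ∞ b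
  abs_le : ∀ w, |b w| ≤ B * (1 + w ^ 2)
  abs_deriv_le : ∀ w, |deriv b w| ≤ B * (1 + |w|)
  abs_transport_le : ∀ θ w, |torusDeriv a θ * (w * b w)| ≤ B * (1 + w ^ 2)

lemma one_add_abs_mul_self_le (w : ℝ) : (1 + |w|) * (1 + |w|) ≤ 2 * (1 + w ^ 2) := by
  nlinarith [sq_nonneg (1 - |w|), sq_abs w]

lemma one_add_abs_le (w : ℝ) : 1 + |w| ≤ 2 * (1 + w ^ 2) := by
  nlinarith [sq_nonneg (1 - |w|), sq_abs w, abs_nonneg w]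

/-- Observables of linear growth with derivative of linear growth are admissible. -/
lemma exists_admissible {a : Torus → ℝ} {b : ℝ → ℝ} (ha : TorusSmooth a) (hb : ContDiff ℝ ∞ b)
    {B : ℝ} (h0 : ∀ w, |b w| ≤ B * (1 + |w|)) (h1 : ∀ w, |deriv b w| ≤ B * (1 + |w|)) :
    ∃ B', Admissible a b B' := by
  obtain ⟨A, hA0, hA⟩ := ha.torusDeriv.exists_bound
  have hB : 0 ≤ B := by simpa using (abs_nonneg _).trans (h0 0)
  refine ⟨2 * (A + 1) * B, ha, hb, fun w => ?_, fun w => ?_, fun θ w => ?_⟩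
  · calc |b w| ≤ B * (1 + |w|) := h0 w
      _ ≤ B * (2 * (1 + w ^ 2)) := by gcongr; exact one_add_abs_le w
      _ ≤ 2 * (A + 1) * B * (1 + w ^ 2) := by
        have : 0 ≤ A * (B * (1 + w ^ 2)) := by positivity
        nlinarith
  · calc |deriv b w| ≤ B * (1 + |w|) := h1 w
      _ ≤ 2 * (A + 1) * B * (1 + |w|) := by
        have : 0 ≤ A * (B * (1 + |w|)) := by positivity
        have : 0 ≤ B * (1 + |w|) := by positivity
        nlinarith
  · rw [abs_mul, abs_mul]
    calc |torusDeriv a θ| * (|w| * |b w|) ≤ A * ((1 + |w|) * (B * (1 + |w|))) := by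
          gcongr
          · exact hA θ
          · linarith
          · exact h0 w
      _ = A * B * ((1 + |w|) * (1 + |w|)) := by ring
      _ ≤ A * B * (2 * (1 + w ^ 2)) :=
        mul_le_mul_of_nonneg_left (one_add_abs_mul_self_le w) (by positivity)
      _ ≤ 2 * (A + 1) * B * (1 + w ^ 2) := by
        have : 0 ≤ B * (1 + w ^ 2) := by positivity
        nlinarith

variable {m γ κ : ℝ} {μ : ℝ → ProbabilityMeasure Phase} {a : Torus → ℝ} {b : ℝ → ℝ} {B : ℝ}

lemma integrable_mul_of_growth {ν : Measure Phase} [IsFiniteMeasure ν]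
    (h2 : Integrable (fun z : Phase => z.2 ^ 2) ν) (ha : TorusSmooth a) (hb : Continuous b)
    (hB : ∀ w, |b w| ≤ B * (1 + w ^ 2)) : Integrable (fun z : Phase => a z.1 * b z.2) ν := by
  obtain ⟨A, hA0, hA⟩ := ha.exists_bound
  refine integrable_of_growth (B := A * B) h2
    ((ha.continuous.comp continuous_fst).mul (hb.comp continuous_snd)) fun z => ?_
  rw [abs_mul, mul_assoc]
  exact mul_le_mul (hA _) (hB _) (abs_nonneg _) hA0

lemma Admissible.bound_nonneg (h : Admissible a b B) : 0 ≤ B := by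
  simpa using (abs_nonneg _).trans (h.abs_le 0)

lemma Admissible.continuous_deriv (h : Admissible a b B) : Continuous (deriv b) :=
  h.smooth_right.continuous_deriv (by simp)

/-- The generator applied to `a(θ) b(ω)`, in terms of moments. -/
lemma Admissible.generatorIntegral_eq (h : Admissible a b B) {ν : Measure Phase}
    [IsFiniteMeasure ν] (h2 : Integrable (fun z : Phase => z.2 ^ 2) ν) :
    generatorIntegral m γ κ ν a b =
      ∫ z, torusDeriv a z.1 * (z.2 * b z.2) ∂ν + 1 / m * (-γ * ∫ z, a z.1 * (z.2 * deriv b z.2) ∂ν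
        + κ * ((∫ z, torusSin z.1 ∂ν) * ∫ z, a z.1 * torusCos z.1 * deriv b z.2 ∂ν
          - (∫ z, torusCos z.1 ∂ν) * ∫ z, a z.1 * torusSin z.1 * deriv b z.2 ∂ν)) := by
  have hB := h.bound_nonneg
  have hd := h.continuous_deriv
  have i1 : Integrable (fun z : Phase => torusDeriv a z.1 * (z.2 * b z.2)) ν :=
    integrable_of_growth h2 ((h.smooth_left.torusDeriv.continuous.comp continuous_fst).mul
      (continuous_snd.mul (h.smooth_right.continuous.comp continuous_snd)))
      fun z => h.abs_transport_le z.1 z.2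
  have i2 : Integrable (fun z : Phase => a z.1 * (z.2 * deriv b z.2)) ν :=
    integrable_mul_of_growth (b := fun w => w * deriv b w) (B := 2 * B) h2 h.smooth_left
      (continuous_id.mul hd) fun w => by
        rw [abs_mul]
        calc |w| * |deriv b w| ≤ (1 + |w|) * (B * (1 + |w|)) := by
              gcongr
              · linarith
              · exact h.abs_deriv_le w
          _ = B * ((1 + |w|) * (1 + |w|)) := by ring
          _ ≤ B * (2 * (1 + w ^ 2)) :=
            mul_le_mul_of_nonneg_left (one_add_abs_mul_self_le w) hB
          _ = _ := by ring
  have hbd : ∀ w, |deriv b w| ≤ 2 * B * (1 + w ^ 2) := fun w => by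
    calc |deriv b w| ≤ B * (1 + |w|) := h.abs_deriv_le w
      _ ≤ B * (2 * (1 + w ^ 2)) := by gcongr; exact one_add_abs_le w
      _ = _ := by ring
  have i3 : Integrable (fun z : Phase => a z.1 * torusCos z.1 * deriv b z.2) ν :=
    integrable_mul_of_growth h2 (h.smooth_left.mul .torusCos) hd hbd
  have i4 : Integrable (fun z : Phase => a z.1 * torusSin z.1 * deriv b z.2) ν :=
    integrable_mul_of_growth h2 (h.smooth_left.mul .torusSin) hd hbd
  unfold generatorIntegral force
  simp_rw [integral_torusSin_sub]
  set S := ∫ z : Phase, torusSin z.1 ∂ν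
  set C := ∫ z : Phase, torusCos z.1 ∂ν
  have e : ∀ z : Phase, torusDeriv a z.1 * (z.2 * b z.2) +
      1 / m * (-γ * z.2 + κ * (S * torusCos z.1 - C * torusSin z.1)) * (a z.1 * deriv b z.2) =
      torusDeriv a z.1 * (z.2 * b z.2) + (1 / m * -γ) * (a z.1 * (z.2 * deriv b z.2))
        + (1 / m * κ * S) * (a z.1 * torusCos z.1 * deriv b z.2)
        - (1 / m * κ * C) * (a z.1 * torusSin z.1 * deriv b z.2) := fun z => by ring
  simp_rw [e]
  have j2 := i2.const_mul (1 / m * -γ)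
  have j3 := i3.const_mul (1 / m * κ * S)
  have j4 := i4.const_mul (1 / m * κ * C)
  rw [integral_sub (f := fun z : Phase => torusDeriv a z.1 * (z.2 * b z.2) +
      (1 / m * -γ) * (a z.1 * (z.2 * deriv b z.2)) +
      (1 / m * κ * S) * (a z.1 * torusCos z.1 * deriv b z.2)) ((i1.add j2).add j3) j4,
    integral_add (f := fun z : Phase => torusDeriv a z.1 * (z.2 * b z.2) +
      (1 / m * -γ) * (a z.1 * (z.2 * deriv b z.2))) (i1.add j2) j3,
    integral_add i1 j2, integral_const_mul, integral_const_mul, integral_const_mul]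
  ring

lemma Admissible.tendsto_cutoff_moment (h : Admissible a b B) (hμ : IsMeasureValuedSolution m γ κ μ)
    (t : ℝ) : Tendsto (fun n : ℕ => moment μ a (fun w => b w * cutoff n w) t) atTop
      (𝓝 (moment μ a b t)) := by
  unfold moment
  obtain ⟨A, hA0, hA⟩ := h.smooth_left.exists_bound
  have hi := integrable_mul_of_growth (integrable_sq hμ t) h.smooth_left h.smooth_right.continuous
    h.abs_le
  refine tendsto_integral_of_dominated_convergence _ (fun n => ?_) hi.norm
    (fun n => Eventually.of_forall fun z => ?_) (Eventually.of_forall fun z => ?_)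
  · exact ((h.smooth_left.continuous.comp continuous_fst).mul
      ((h.smooth_right.continuous.mul (contDiff_cutoff n).continuous).comp
        continuous_snd)).aestronglyMeasurable
  · rw [← mul_assoc, norm_mul _ (cutoff n z.2)]
    exact mul_le_of_le_one_right (norm_nonneg _) (abs_cutoff_le_one n _)
  · simpa [mul_assoc] using ((tendsto_cutoff z.2).const_mul (b z.2)).const_mul (a z.1)

lemma deriv_mul_cutoff (hb : ContDiff ℝ ∞ b) (n : ℕ) (w : ℝ) :
    deriv (fun w => b w * cutoff n w) w = deriv b w * cutoff n w + b w * deriv (cutoff n) w :=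
  (((contDiff_infty_iff_deriv.1 hb).1 w).hasDerivAt.mul
    ((contDiff_infty_iff_deriv.1 (contDiff_cutoff n)).1 w).hasDerivAt).deriv

/-- Cutting off preserves admissibility, uniformly in the cutoff. -/
lemma Admissible.exists_cutoff (h : Admissible a b B) :
    ∃ B', ∀ n, Admissible a (fun w => b w * cutoff n w) B' := by
  obtain ⟨D, hD0, hD⟩ := exists_bound_deriv_cutoff
  have hB := h.bound_nonneg
  refine ⟨B * (1 + D), fun n => ⟨h.smooth_left, h.smooth_right.mul (contDiff_cutoff n),
    fun w => ?_, fun w => ?_, fun θ w => ?_⟩⟩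
  · rw [abs_mul]
    calc |b w| * |cutoff n w| ≤ |b w| * 1 := by gcongr; exact abs_cutoff_le_one n w
      _ ≤ B * (1 + w ^ 2) := by rw [mul_one]; exact h.abs_le w
      _ ≤ _ := by
        have : 0 ≤ B * D * (1 + w ^ 2) := by positivity
        nlinarith
  · rw [deriv_mul_cutoff h.smooth_right]
    have h1 : |deriv b w * cutoff n w| ≤ B * (1 + |w|) := by
      rw [abs_mul]
      calc |deriv b w| * |cutoff n w| ≤ |deriv b w| * 1 := by
            gcongr; exact abs_cutoff_le_one n w
        _ ≤ _ := by rw [mul_one]; exact h.abs_deriv_le w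
    -- One factor 1 + |w| of the quadratic growth of b is spent on the derivative of the cutoff, the
    -- other one remains.
    have h2 : |b w * deriv (cutoff n) w| ≤ B * D * (1 + |w|) := by
      rw [abs_mul]
      calc |b w| * |deriv (cutoff n) w| ≤ B * (1 + w ^ 2) * |deriv (cutoff n) w| := by
            gcongr; exact h.abs_le w
        _ ≤ B * ((1 + |w|) * (1 + |w|)) * |deriv (cutoff n) w| := by
            gcongr
            nlinarith [sq_abs w, abs_nonneg w]
        _ = B * (|deriv (cutoff n) w| * (1 + |w|)) * (1 + |w|) := by ring
        _ ≤ B * D * (1 + |w|) := by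
          gcongr
          exact hD n w
    calc _ ≤ |deriv b w * cutoff n w| + |b w * deriv (cutoff n) w| := abs_add_le _ _
      _ ≤ _ := by linarith
  · rw [← mul_assoc w, ← mul_assoc, abs_mul]
    calc |torusDeriv a θ * (w * b w)| * |cutoff n w| ≤ |torusDeriv a θ * (w * b w)| * 1 := by
          gcongr; exact abs_cutoff_le_one n w
      _ ≤ B * (1 + w ^ 2) := by rw [mul_one]; exact h.abs_transport_le θ w
      _ ≤ _ := by
        have : 0 ≤ B * D * (1 + w ^ 2) := by positivity
        nlinarith

/-- The integrand of `generatorIntegral` has quadratic growth. -/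
lemma Admissible.exists_generator_bound (h : ∀ n : ℕ, Admissible a (fun w => b w * cutoff n w) B)
    (hm : 0 < m) (hγ : 0 < γ) (hκ : 0 < κ) :
    ∃ D, 0 ≤ D ∧ ∀ (n : ℕ) (ν : Measure Phase) [IsProbabilityMeasure ν] (z : Phase),
      |torusDeriv a z.1 * (z.2 * (b z.2 * cutoff n z.2)) + force m γ κ ν z.1 z.2 *
        (a z.1 * deriv (fun w => b w * cutoff n w) z.2)| ≤ D * (1 + z.2 ^ 2) := by
  obtain ⟨A, hA0, hA⟩ := (h 0).smooth_left.exists_bound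
  have hB := (h 0).bound_nonneg
  refine ⟨B + (γ + κ) / m * A * B * 2, by positivity, fun n ν _ z => ?_⟩
  refine (abs_add_le _ _).trans ?_
  have h1 := (h n).abs_transport_le z.1 z.2
  have h2 : |force m γ κ ν z.1 z.2 * (a z.1 * deriv (fun w => b w * cutoff n w) z.2)| ≤
      (γ + κ) / m * A * B * (2 * (1 + z.2 ^ 2)) := by
    rw [abs_mul, abs_mul]
    calc _ ≤ (γ + κ) / m * (1 + |z.2|) * (A * (B * (1 + |z.2|))) := by
          gcongr
          · exact abs_force_le hm hγ hκ ν z.1 z.2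
          · exact hA _
          · exact (h n).abs_deriv_le _
      _ = (γ + κ) / m * A * B * ((1 + |z.2|) * (1 + |z.2|)) := by ring
      _ ≤ _ := mul_le_mul_of_nonneg_left (one_add_abs_mul_self_le _) (by positivity)
  linarith

lemma moment_torusSin_one (μ : ℝ → ProbabilityMeasure Phase) (t : ℝ) :
    moment μ torusSin (fun _ => 1) t = ∫ z, torusSin z.1 ∂(μ (max t 0) : Measure Phase) := by
  simp [moment]

lemma moment_torusCos_one (μ : ℝ → ProbabilityMeasure Phase) (t : ℝ) :
    moment μ torusCos (fun _ => 1) t = ∫ z, torusCos z.1 ∂(μ (max t 0) : Measure Phase) := by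
  simp [moment]

lemma exists_admissible_one (ha : TorusSmooth a) : ∃ B, Admissible a (fun _ => 1) B := by
  refine exists_admissible (B := 1) ha contDiff_const (fun w => ?_) (fun w => ?_)
  · simp
  · rw [deriv_const, abs_zero]; positivity

/-- A pointwise limit of continuous truncated moments. Continuity itself has to wait for the weak
equation, whose proof needs this measurability. -/
lemma IsMeasureValuedSolution.measurable_moment (hμ : IsMeasureValuedSolution m γ κ μ)
    (h : Admissible a b B) : Measurable (moment μ a b) := by
  refine measurable_of_tendsto_metrizable (f := fun n : ℕ => moment μ a (fun w => b w * cutoff n w))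
    (fun n => ?_) (tendsto_pi_nhds.2 fun t => h.tendsto_cutoff_moment hμ t)
  exact (hμ.continuous_moment h.smooth_left (h.smooth_right.mul (contDiff_cutoff n))
    (hasCompactSupport_cutoff n).mul_left).measurable

lemma Admissible.generatorIntegral_eq_moment (h : Admissible a b B)
    (hμ : IsMeasureValuedSolution m γ κ μ) (t : ℝ) :
    generatorIntegral m γ κ (μ (max t 0) : Measure Phase) a b =
      moment μ (torusDeriv a) (fun w => w * b w) t +
        1 / m * (-γ * moment μ a (fun w => w * deriv b w) t + κ *
          (moment μ torusSin (fun _ => 1) t * moment μ (fun θ => a θ * torusCos θ) (deriv b) t -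
            moment μ torusCos (fun _ => 1) t *
              moment μ (fun θ => a θ * torusSin θ) (deriv b) t)) := by
  rw [h.generatorIntegral_eq (integrable_sq hμ t), moment_torusSin_one, moment_torusCos_one]
  rfl

/-- After expansion of the sine of a difference, the nonlocal force factors, and the integral is a
polynomial in moments of separate variables. -/
lemma IsMeasureValuedSolution.measurable_generatorIntegral_cutoff
    (hμ : IsMeasureValuedSolution m γ κ μ)
    (h : ∀ n : ℕ, Admissible a (fun w => b w * cutoff n w) B) (n : ℕ) :
    Measurable fun t => generatorIntegral m γ κ (μ (max t 0) : Measure Phase) a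
      (fun w => b w * cutoff n w) := by
  set g := fun w => b w * cutoff n w
  have hg : ContDiff ℝ ∞ g := (h n).smooth_right
  have hs : HasCompactSupport g := (hasCompactSupport_cutoff n).mul_left
  have hg' : ContDiff ℝ ∞ (deriv g) := (contDiff_infty_iff_deriv.1 hg).2
  have ha := (h n).smooth_left
  have h1 := (hμ.continuous_moment (b := fun w => w * g w) ha.torusDeriv (contDiff_id.mul hg)
    hs.mul_left).measurable
  have h2 := (hμ.continuous_moment (b := fun w => w * deriv g w) ha (contDiff_id.mul hg')
    hs.deriv.mul_left).measurable
  have h3 := (hμ.continuous_moment (ha.mul .torusCos) hg' hs.deriv).measurable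
  have h4 := (hμ.continuous_moment (ha.mul .torusSin) hg' hs.deriv).measurable
  obtain ⟨_, hS⟩ := exists_admissible_one TorusSmooth.torusSin
  obtain ⟨_, hC⟩ := exists_admissible_one TorusSmooth.torusCos
  have h5 := hμ.measurable_moment hS
  have h6 := hμ.measurable_moment hC
  have hn : Admissible a g B := h n
  simp_rw [hn.generatorIntegral_eq_moment hμ]
  exact h1.add ((((h2.const_mul _)).add (((h5.mul h3).sub (h6.mul h4)).const_mul κ)).const_mul _)

/-- The weak equation for admissible observables. -/
lemma IsMeasureValuedSolution.moment_sub_moment (hμ : IsMeasureValuedSolution m γ κ μ)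
    (hm : 0 < m) (hγ : 0 < γ) (hκ : 0 < κ) (h : Admissible a b B) {t : ℝ} (ht : 0 ≤ t) :
    IntervalIntegrable (fun s => generatorIntegral m γ κ (μ (max s 0) : Measure Phase) a b)
      volume 0 t ∧
    moment μ a b t - moment μ a b 0 =
      ∫ s in (0 : ℝ)..t, generatorIntegral m γ κ (μ (max s 0) : Measure Phase) a b := by
  obtain ⟨B', hB'⟩ := h.exists_cutoff
  obtain ⟨D, hD0, hD⟩ := Admissible.exists_generator_bound hB' hm hγ hκ
  -- The bound of `moment_sq_le` at the final time. It dominates the second moment on (0, t], so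
  -- that dominated convergence applies in s as well as in phase space.
  set M := 2 * moment μ (fun _ => 1) (fun w => w ^ 2) 0 + 2 / m * (κ ^ 2 / γ) * t with hM
  have hbdi : ∀ s, Integrable (fun z : Phase => D * (1 + z.2 ^ 2))
      (μ (max s 0) : Measure Phase) := fun s =>
    ((integrable_const 1).add (integrable_sq hμ s)).const_mul D
  have hint : ∀ s, ∫ z, D * (1 + z.2 ^ 2) ∂(μ (max s 0) : Measure Phase) =
      D * (1 + moment μ (fun _ => 1) (fun w => w ^ 2) s) := fun s => by
    rw [integral_const_mul, integral_add (integrable_const _) (integrable_sq hμ s), moment_one_sq]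
    simp
  have hlim : ∀ s, Tendsto (fun n : ℕ => generatorIntegral m γ κ (μ (max s 0) : Measure Phase) a
      (fun w => b w * cutoff n w)) atTop
      (𝓝 (generatorIntegral m γ κ (μ (max s 0) : Measure Phase) a b)) := fun s => by
    refine tendsto_integral_of_dominated_convergence _ (fun n => ?_) (hbdi s)
      (fun n => Eventually.of_forall fun z => hD n _ z) (Eventually.of_forall fun z => ?_)
    · refine Continuous.aestronglyMeasurable ?_
      have h1 := h.smooth_left.torusDeriv.continuous
      have h2 := h.smooth_left.continuous
      have h3 := h.smooth_right.continuous
      have h4 := (contDiff_cutoff n).continuous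
      have h5 := (hB' n).continuous_deriv
      have h6 := continuous_force m γ κ (μ (max s 0) : Measure Phase)
      fun_prop
    · simp_rw [deriv_mul_cutoff h.smooth_right]
      have t1 := tendsto_cutoff z.2
      have t2 := tendsto_deriv_cutoff z.2
      have := (((t1.const_mul (b z.2)).const_mul z.2).const_mul (torusDeriv a z.1)).add
        ((((t1.const_mul (deriv b z.2)).add (t2.const_mul (b z.2))).const_mul
          (a z.1)).const_mul (force m γ κ (μ (max s 0) : Measure Phase) z.1 z.2))
      simpa using this
  have hbound : ∀ n : ℕ, ∀ s ∈ Ioc 0 t,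
      ‖generatorIntegral m γ κ (μ (max s 0) : Measure Phase) a (fun w => b w * cutoff n w)‖ ≤
        D * (1 + M) := fun n s hs => by
    refine (norm_integral_le_of_norm_le (hbdi s) (Eventually.of_forall fun z => hD n _ z)).trans ?_
    rw [hint]
    have h1 := hμ.moment_sq_le hm hγ hκ hs.1.le
    have h2 : 2 / m * (κ ^ 2 / γ) * s ≤ 2 / m * (κ ^ 2 / γ) * t := by
      have := hs.2
      gcongr
    gcongr
    linarith
  have hmeas := hμ.measurable_generatorIntegral_cutoff hB'
  have hmeas' : Measurable fun s => generatorIntegral m γ κ (μ (max s 0) : Measure Phase) a b :=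
    measurable_of_tendsto_metrizable hmeas (tendsto_pi_nhds.2 hlim)
  refine ⟨?_, ?_⟩
  · rw [intervalIntegrable_iff_integrableOn_Ioc_of_le ht]
    refine Measure.integrableOn_of_bounded (M := D * (1 + M)) (by simp)
      hmeas'.aestronglyMeasurable ?_
    refine (ae_restrict_iff' measurableSet_Ioc).2 (Eventually.of_forall fun s hs => ?_)
    exact le_of_tendsto (hlim s).norm (Eventually.of_forall fun n => hbound n s hs)
  · have l1 := (h.tendsto_cutoff_moment hμ t).sub (h.tendsto_cutoff_moment hμ 0)
    have l2 : Tendsto (fun n : ℕ => ∫ s in (0 : ℝ)..t, generatorIntegral m γ κ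
        (μ (max s 0) : Measure Phase) a (fun w => b w * cutoff n w)) atTop
        (𝓝 (∫ s in (0 : ℝ)..t, generatorIntegral m γ κ (μ (max s 0) : Measure Phase) a b)) := by
      refine intervalIntegral.tendsto_integral_filter_of_dominated_convergence
        (fun _ => D * (1 + M)) (Eventually.of_forall fun n => (hmeas n).aestronglyMeasurable)
        (Eventually.of_forall fun n => Eventually.of_forall fun s hs => ?_) (by simp)
        (Eventually.of_forall fun s _ => hlim s)
      rw [uIoc_of_le ht] at hs
      exact hbound n s hs
    refine tendsto_nhds_unique l1 (l2.congr fun n => ?_)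
    exact (hμ.moment_sub_moment_of_hasCompactSupport h.smooth_left (hB' n).smooth_right
      (hasCompactSupport_cutoff n).mul_left ht).symm

lemma moment_of_nonpos (μ : ℝ → ProbabilityMeasure Phase) (a : Torus → ℝ) (b : ℝ → ℝ) {t : ℝ}
    (ht : t ≤ 0) : moment μ a b t = moment μ a b 0 := by
  simp [moment, max_eq_right ht]

lemma IsMeasureValuedSolution.continuous_moment_of_admissible
    (hμ : IsMeasureValuedSolution m γ κ μ)
    (hm : 0 < m) (hγ : 0 < γ) (hκ : 0 < κ) (h : Admissible a b B) : Continuous (moment μ a b) := by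
  have h1 : Continuous fun t : ℝ => moment μ a b (max t 0) := by
    refine continuous_iff_continuousAt.2 fun t₀ => ?_
    obtain ⟨T, hT⟩ : ∃ T, max t₀ 0 < T := exists_gt _
    have hT0 : 0 ≤ T := (le_max_right _ _).trans hT.le
    have hc : ContinuousOn (fun t => moment μ a b 0 +
        ∫ s in (0 : ℝ)..t, generatorIntegral m γ κ (μ (max s 0) : Measure Phase) a b)
        (Icc 0 T) := by
      have := intervalIntegral.continuousOn_primitive_interval'
        (hμ.moment_sub_moment hm hγ hκ h hT0).1 left_mem_uIcc
      rw [uIcc_of_le hT0] at this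
      exact continuousOn_const.add this
    -- The primitive is known to be continuous only on [0, T]; clamping the argument extends it to
    -- the line without changing it near `max t₀ 0`.
    have hc' : Continuous fun t : ℝ => (fun t => moment μ a b 0 +
        ∫ s in (0 : ℝ)..t, generatorIntegral m γ κ (μ (max s 0) : Measure Phase) a b)
        (min (max t 0) T) :=
      hc.comp_continuous (by fun_prop) fun t => ⟨le_min (le_max_right _ _) hT0, min_le_right _ _⟩
    refine hc'.continuousAt.congr ?_
    have hnear : ∀ᶠ t in 𝓝 t₀, max t 0 < T :=
      (continuous_id.max continuous_const).continuousAt.eventually_lt continuousAt_const hT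
    filter_upwards [hnear] with t ht
    have := (hμ.moment_sub_moment hm hγ hκ h (le_max_right t 0)).2
    simp only [min_eq_left ht.le]
    linarith
  refine h1.congr fun t => ?_
  rcases le_total t 0 with ht | ht
  · rw [max_eq_right ht, moment_of_nonpos μ a b ht]
  · rw [max_eq_left ht]

/-- The evolution of an admissible moment. -/
lemma IsMeasureValuedSolution.hasDerivAt_moment (hμ : IsMeasureValuedSolution m γ κ μ)
    (hm : 0 < m) (hγ : 0 < γ) (hκ : 0 < κ) (h : Admissible a b B) {g : ℝ → ℝ} (hg : Continuous g)
    (hgen : ∀ s, generatorIntegral m γ κ (μ (max s 0) : Measure Phase) a b = g s)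
    {t : ℝ} (ht : 0 < t) : HasDerivAt (moment μ a b) (g t) t := by
  -- The pointwise derivative comes from continuity of g; integrability of the generator alone would
  -- only give it almost everywhere.
  have h1 : HasDerivAt (fun t => moment μ a b 0 + ∫ s in (0 : ℝ)..t, g s) (g t) t :=
    (intervalIntegral.integral_hasDerivAt_right (hg.intervalIntegrable _ _)
      hg.stronglyMeasurable.stronglyMeasurableAtFilter hg.continuousAt).const_add _
  refine h1.congr_of_eventuallyEq ?_
  filter_upwards [lt_mem_nhds ht] with s hs
  have := (hμ.moment_sub_moment hm hγ hκ h hs.le).2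
  simp_rw [hgen] at this
  linarith

end KineticKuramoto

namespace KineticKuramoto

open scoped ContDiff

/-! ### Observables of linear growth -/

/-- Smooth functions of linear growth with derivative of linear growth. -/
def LinearGrowth (b : ℝ → ℝ) : Prop :=
  ContDiff ℝ ∞ b ∧ ∃ B, (∀ w, |b w| ≤ B * (1 + |w|)) ∧ ∀ w, |deriv b w| ≤ B * (1 + |w|)

namespace LinearGrowth

lemma admissible {a : Torus → ℝ} {b : ℝ → ℝ} (hb : LinearGrowth b) (ha : TorusSmooth a) :
    ∃ B, Admissible a b B := by
  obtain ⟨h, B, h0, h1⟩ := hb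
  exact exists_admissible ha h h0 h1

lemma const (c : ℝ) : LinearGrowth (fun _ => c) := by
  refine ⟨contDiff_const, |c|, fun w => ?_, fun w => ?_⟩
  · nlinarith [abs_nonneg w, abs_nonneg c]
  · rw [deriv_const, abs_zero]; positivity

lemma id : LinearGrowth (fun w => w) := by
  refine ⟨contDiff_id, 1, fun w => ?_, fun w => ?_⟩
  · linarith
  · rw [deriv_id'']; simp

lemma sin : LinearGrowth Real.sin := by
  refine ⟨Real.contDiff_sin, 1, fun w => ?_, fun w => ?_⟩
  · linarith [Real.abs_sin_le_one w, abs_nonneg w]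
  · rw [Real.deriv_sin]; linarith [Real.abs_cos_le_one w, abs_nonneg w]

lemma cos : LinearGrowth Real.cos := by
  refine ⟨Real.contDiff_cos, 1, fun w => ?_, fun w => ?_⟩
  · linarith [Real.abs_cos_le_one w, abs_nonneg w]
  · rw [Real.deriv_cos, abs_neg]; linarith [Real.abs_sin_le_one w, abs_nonneg w]

lemma mul_sin : LinearGrowth (fun w => w * Real.sin w) := by
  refine ⟨contDiff_id.mul Real.contDiff_sin, 1, fun w => ?_, fun w => ?_⟩
  · rw [abs_mul]; nlinarith [Real.abs_sin_le_one w, abs_nonneg w]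
  · have : deriv (fun w => w * Real.sin w) w = 1 * Real.sin w + w * Real.cos w :=
      ((hasDerivAt_id w).mul (Real.hasDerivAt_sin w)).deriv
    rw [this]
    refine (abs_add_le _ _).trans ?_
    rw [abs_mul w, one_mul]
    nlinarith [Real.abs_sin_le_one w, Real.abs_cos_le_one w, abs_nonneg w]

lemma mul_cos : LinearGrowth (fun w => w * Real.cos w) := by
  refine ⟨contDiff_id.mul Real.contDiff_cos, 1, fun w => ?_, fun w => ?_⟩
  · rw [abs_mul]; nlinarith [Real.abs_cos_le_one w, abs_nonneg w]
  · have : deriv (fun w => w * Real.cos w) w = 1 * Real.cos w + w * -Real.sin w :=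
      ((hasDerivAt_id w).mul (Real.hasDerivAt_cos w)).deriv
    rw [this]
    refine (abs_add_le _ _).trans ?_
    rw [abs_mul w, one_mul, abs_neg]
    nlinarith [Real.abs_sin_le_one w, Real.abs_cos_le_one w, abs_nonneg w]

end LinearGrowth

/-- The transport term would involve ω³; it disappears because the phase factor is constant. This is
why only the global second moment is differentiated. -/
lemma admissible_sq : Admissible (fun _ => 1) (fun w => w ^ 2) 2 where
  smooth_left := .const 1
  smooth_right := contDiff_id.pow 2
  abs_le w := by rw [abs_of_nonneg (sq_nonneg w)]; nlinarith [sq_nonneg w]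
  abs_deriv_le w := by
    have : deriv (fun w : ℝ => w ^ 2) w = 2 * w := by simp
    rw [this, abs_mul, abs_two]; linarith
  abs_transport_le θ w := by
    simp only [torusDeriv_const, zero_mul, abs_zero]
    positivity

/-! ### Linear and quadratic relations between moments at a fixed time -/

/-- The quadratic polynomial s ↦ ∫ (s f + g)² is nonnegative, so its discriminant is nonpositive. -/
lemma sq_integral_mul_le {α : Type*} [MeasurableSpace α] {ν : Measure α} {f g : α → ℝ}
    (hf : Integrable (fun x => f x ^ 2) ν) (hg : Integrable (fun x => g x ^ 2) ν)
    (hfg : Integrable (fun x => f x * g x) ν) :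
    (∫ x, f x * g x ∂ν) ^ 2 ≤ (∫ x, f x ^ 2 ∂ν) * ∫ x, g x ^ 2 ∂ν := by
  have h : ∀ s : ℝ, 0 ≤ (∫ x, f x ^ 2 ∂ν) * (s * s) + (2 * ∫ x, f x * g x ∂ν) * s
      + ∫ x, g x ^ 2 ∂ν := fun s => by
    have e : ∫ x, (s * f x + g x) ^ 2 ∂ν = (∫ x, f x ^ 2 ∂ν) * (s * s)
        + (2 * ∫ x, f x * g x ∂ν) * s + ∫ x, g x ^ 2 ∂ν := by
      have e1 : ∀ x, (s * f x + g x) ^ 2 = s ^ 2 * f x ^ 2 + 2 * s * (f x * g x) + g x ^ 2 :=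
        fun x => by ring
      have j1 := hf.const_mul (s ^ 2)
      have j2 := hfg.const_mul (2 * s)
      simp_rw [e1]
      rw [integral_add (f := fun x => s ^ 2 * f x ^ 2 + 2 * s * (f x * g x)) (j1.add j2) hg,
        integral_add j1 j2, integral_const_mul, integral_const_mul]
      ring
    rw [← e]
    exact integral_nonneg fun x => sq_nonneg _
  have := discrim_le_zero h
  unfold discrim at this
  nlinarith

variable {m γ κ : ℝ} {μ : ℝ → ProbabilityMeasure Phase} {a a₁ a₂ a₃ : Torus → ℝ} {b : ℝ → ℝ}
  {B : ℝ}

lemma LinearGrowth.integrable (hμ : IsMeasureValuedSolution m γ κ μ) (hb : LinearGrowth b)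
    (ha : TorusSmooth a) (t : ℝ) :
    Integrable (fun z : Phase => a z.1 * b z.2) (μ (max t 0) : Measure Phase) := by
  obtain ⟨B, h⟩ := hb.admissible ha
  exact integrable_mul_of_growth (integrable_sq hμ t) ha h.smooth_right.continuous h.abs_le

lemma moment_add (hμ : IsMeasureValuedSolution m γ κ μ) (hb : LinearGrowth b)
    (h₁ : TorusSmooth a₁) (h₂ : TorusSmooth a₂) (x y t : ℝ) :
    moment μ (fun θ => x * a₁ θ + y * a₂ θ) b t = x * moment μ a₁ b t + y * moment μ a₂ b t := by
  unfold moment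
  have e : ∀ z : Phase, (x * a₁ z.1 + y * a₂ z.1) * b z.2 =
      x * (a₁ z.1 * b z.2) + y * (a₂ z.1 * b z.2) := fun z => by ring
  simp_rw [e]
  rw [integral_add ((hb.integrable hμ h₁ t).const_mul x) ((hb.integrable hμ h₂ t).const_mul y),
    integral_const_mul, integral_const_mul]

lemma moment_const_mul_right (μ : ℝ → ProbabilityMeasure Phase) (a : Torus → ℝ) (b : ℝ → ℝ)
    (c t : ℝ) : moment μ a (fun w => c * b w) t = c * moment μ a b t := by
  unfold moment
  rw [← integral_const_mul]
  congr 1; funext z; ring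

lemma moment_const_mul_left (μ : ℝ → ProbabilityMeasure Phase) (a : Torus → ℝ) (b : ℝ → ℝ)
    (c t : ℝ) : moment μ (fun θ => c * a θ) b t = c * moment μ a b t := by
  unfold moment
  rw [← integral_const_mul]
  congr 1; funext z; ring

lemma moment_neg_left (μ : ℝ → ProbabilityMeasure Phase) (a : Torus → ℝ) (b : ℝ → ℝ)
    (t : ℝ) : moment μ (fun θ => -a θ) b t = -moment μ a b t := by
  unfold moment
  rw [← integral_neg]
  congr 1; funext z; ring

@[simp] lemma moment_zero_left (μ : ℝ → ProbabilityMeasure Phase) (b : ℝ → ℝ)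
    (t : ℝ) : moment μ (fun _ => 0) b t = 0 := by
  simp [moment]

@[simp] lemma moment_zero_right (μ : ℝ → ProbabilityMeasure Phase) (a : Torus → ℝ)
    (t : ℝ) : moment μ a (fun _ => 0) t = 0 := by
  simp [moment]

@[simp] lemma moment_one_one (μ : ℝ → ProbabilityMeasure Phase) (t : ℝ) :
    moment μ (fun _ => 1) (fun _ => 1) t = 1 := by
  simp [moment]

/-! ### The basic moments -/

/-- The square of the sine on the circle. -/
noncomputable def torusSS (θ : Torus) : ℝ := torusSin θ * torusSin θ

/-- The product `sin cos` on the circle. -/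
noncomputable def torusSC (θ : Torus) : ℝ := torusSin θ * torusCos θ

/-- The square of the cosine on the circle. -/
noncomputable def torusCC (θ : Torus) : ℝ := torusCos θ * torusCos θ

lemma TorusSmooth.torusSS : TorusSmooth torusSS := TorusSmooth.torusSin.mul .torusSin

lemma TorusSmooth.torusSC : TorusSmooth torusSC := TorusSmooth.torusSin.mul .torusCos

lemma TorusSmooth.torusCC : TorusSmooth torusCC := TorusSmooth.torusCos.mul .torusCos

lemma torusDeriv_torusSC : torusDeriv torusSC = fun θ => 1 * torusCC θ + (-1) * torusSS θ := by
  refine (TorusSmooth.torusSin.torusDeriv_mul TorusSmooth.torusCos).trans ?_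
  funext θ
  simp [torusCC, torusSS]

lemma torusDeriv_torusCC : torusDeriv torusCC = fun θ => -2 * torusSC θ := by
  refine (TorusSmooth.torusCos.torusDeriv_mul TorusSmooth.torusCos).trans ?_
  funext θ
  simp only [torusDeriv_torusCos, torusSC]
  ring

lemma torusDeriv_torusSS : torusDeriv torusSS = fun θ => 2 * torusSC θ := by
  refine (TorusSmooth.torusSin.torusDeriv_mul TorusSmooth.torusSin).trans ?_
  funext θ
  simp only [torusDeriv_torusSin, torusSC]
  ring

lemma moment_torusSS_add (hμ : IsMeasureValuedSolution m γ κ μ) (hb : LinearGrowth b) (t : ℝ) :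
    moment μ torusSS b t + moment μ torusCC b t = moment μ (fun _ => 1) b t := by
  have := moment_add hμ hb .torusSS .torusCC 1 1 t
  rw [one_mul, one_mul] at this
  rw [← this]
  congr 1
  funext θ
  have := torusSin_sq_add_torusCos_sq θ
  simp only [torusSS, torusCC]
  linarith

/-- The real part of the complex order parameter. -/
noncomputable def cosMean (μ : ℝ → ProbabilityMeasure Phase) : ℝ → ℝ :=
  moment μ torusCos (fun _ => 1)

/-- The imaginary part of the complex order parameter. -/
noncomputable def sinMean (μ : ℝ → ProbabilityMeasure Phase) : ℝ → ℝ :=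
  moment μ torusSin (fun _ => 1)

/-- Twice the kinetic energy per unit mass. -/
noncomputable def kinetic (μ : ℝ → ProbabilityMeasure Phase) : ℝ → ℝ :=
  moment μ (fun _ => 1) (fun w => w ^ 2)

/-- The squared order parameter. -/
noncomputable def orderSq (μ : ℝ → ProbabilityMeasure Phase) (t : ℝ) : ℝ :=
  cosMean μ t ^ 2 + sinMean μ t ^ 2

/-- The component of `e^{iθ}` orthogonal to the complex order parameter, times its modulus. -/
noncomputable def normal (μ : ℝ → ProbabilityMeasure Phase) (t : ℝ) (θ : Torus) : ℝ :=
  cosMean μ t * torusSin θ - sinMean μ t * torusCos θ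

/-- The component of `e^{iθ}` along the complex order parameter, times its modulus. -/
noncomputable def tangent (μ : ℝ → ProbabilityMeasure Phase) (t : ℝ) (θ : Torus) : ℝ :=
  cosMean μ t * torusCos θ + sinMean μ t * torusSin θ

lemma TorusSmooth.normal (t : ℝ) : TorusSmooth (normal μ t) := by
  have h := ((TorusSmooth.const (cosMean μ t)).mul .torusSin).add
    ((TorusSmooth.const (-sinMean μ t)).mul .torusCos)
  refine (congrArg TorusSmooth ?_).mp h
  funext θ
  unfold KineticKuramoto.normal
  ring

lemma TorusSmooth.tangent (t : ℝ) : TorusSmooth (tangent μ t) :=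
  ((TorusSmooth.const (cosMean μ t)).mul .torusCos).add
    ((TorusSmooth.const (sinMean μ t)).mul .torusSin)

lemma normal_sq_add_tangent_sq (t : ℝ) (θ : Torus) :
    normal μ t θ ^ 2 + tangent μ t θ ^ 2 = orderSq μ t := by
  have := torusSin_sq_add_torusCos_sq θ
  unfold normal tangent orderSq
  linear_combination (cosMean μ t ^ 2 + sinMean μ t ^ 2) * this

lemma moment_normal (hμ : IsMeasureValuedSolution m γ κ μ) (hb : LinearGrowth b) (t : ℝ) :
    moment μ (normal μ t) b t =
      cosMean μ t * moment μ torusSin b t - sinMean μ t * moment μ torusCos b t := by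
  have h := moment_add hμ hb .torusSin .torusCos (cosMean μ t) (-sinMean μ t) t
  have e : normal μ t = fun θ => cosMean μ t * torusSin θ + -sinMean μ t * torusCos θ := by
    funext θ; unfold normal; ring
  rw [e, h]; ring

lemma moment_tangent (hμ : IsMeasureValuedSolution m γ κ μ) (hb : LinearGrowth b) (t : ℝ) :
    moment μ (tangent μ t) b t =
      cosMean μ t * moment μ torusCos b t + sinMean μ t * moment μ torusSin b t :=
  moment_add hμ hb .torusCos .torusSin (cosMean μ t) (sinMean μ t) t

lemma moment_quadratic (hμ : IsMeasureValuedSolution m γ κ μ) (hb : LinearGrowth b) (x y w t : ℝ) :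
    moment μ (fun θ => x * torusSS θ + y * torusSC θ + w * torusCC θ) b t =
      x * moment μ torusSS b t + y * moment μ torusSC b t + w * moment μ torusCC b t := by
  have h1 := moment_add hμ hb .torusSS .torusSC x y t
  have hs : TorusSmooth fun θ => x * torusSS θ + y * torusSC θ :=
    ((TorusSmooth.const x).mul .torusSS).add ((TorusSmooth.const y).mul .torusSC)
  have h2 := moment_add hμ hb hs .torusCC 1 w t
  simp only [one_mul] at h2
  rw [h2, h1]

lemma moment_normal_sq (hμ : IsMeasureValuedSolution m γ κ μ) (hb : LinearGrowth b) (t : ℝ) :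
    moment μ (fun θ => normal μ t θ ^ 2) b t =
      cosMean μ t ^ 2 * moment μ torusSS b t
        - 2 * cosMean μ t * sinMean μ t * moment μ torusSC b t
        + sinMean μ t ^ 2 * moment μ torusCC b t := by
  have h := moment_quadratic hμ hb (cosMean μ t ^ 2) (-2 * cosMean μ t * sinMean μ t)
    (sinMean μ t ^ 2) t
  have e : (fun θ => normal μ t θ ^ 2) = fun θ => cosMean μ t ^ 2 * torusSS θ +
      -2 * cosMean μ t * sinMean μ t * torusSC θ + sinMean μ t ^ 2 * torusCC θ := by
    funext θ; unfold normal torusSS torusSC torusCC; ring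
  rw [e, h]; ring

lemma moment_normal_mul_tangent (hμ : IsMeasureValuedSolution m γ κ μ) (hb : LinearGrowth b)
    (t : ℝ) : moment μ (fun θ => normal μ t θ * tangent μ t θ) b t =
      cosMean μ t * sinMean μ t * (moment μ torusSS b t - moment μ torusCC b t)
        + (cosMean μ t ^ 2 - sinMean μ t ^ 2) * moment μ torusSC b t := by
  have h := moment_quadratic hμ hb (cosMean μ t * sinMean μ t)
    (cosMean μ t ^ 2 - sinMean μ t ^ 2) (-(cosMean μ t * sinMean μ t)) t
  have e : (fun θ => normal μ t θ * tangent μ t θ) = fun θ =>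
      cosMean μ t * sinMean μ t * torusSS θ + (cosMean μ t ^ 2 - sinMean μ t ^ 2) * torusSC θ
        + -(cosMean μ t * sinMean μ t) * torusCC θ := by
    funext θ; unfold normal tangent torusSS torusSC torusCC; ring
  rw [e, h]; ring

/-! ### Inequalities between moments -/

/-- The second moment of the normal component. -/
noncomputable def spread (μ : ℝ → ProbabilityMeasure Phase) (t : ℝ) : ℝ :=
  moment μ (fun θ => normal μ t θ ^ 2) (fun _ => 1) t

/-- The mixed second moment of the normal and tangential components. -/
noncomputable def twist (μ : ℝ → ProbabilityMeasure Phase) (t : ℝ) : ℝ :=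
  moment μ (fun θ => normal μ t θ * tangent μ t θ) (fun _ => 1) t

/-- Half the rate of decrease of the squared order parameter. -/
noncomputable def drift (μ : ℝ → ProbabilityMeasure Phase) (t : ℝ) : ℝ :=
  moment μ (normal μ t) (fun w => w) t

lemma kinetic_nonneg (μ : ℝ → ProbabilityMeasure Phase) (t : ℝ) : 0 ≤ kinetic μ t :=
  integral_nonneg fun z => by positivity

lemma spread_nonneg (μ : ℝ → ProbabilityMeasure Phase) (t : ℝ) : 0 ≤ spread μ t :=
  integral_nonneg fun z => by positivity

lemma orderSq_nonneg (μ : ℝ → ProbabilityMeasure Phase) (t : ℝ) : 0 ≤ orderSq μ t := by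
  unfold orderSq; positivity

/-- The Cauchy–Schwarz inequality for moments. -/
lemma sq_moment_le (hμ : IsMeasureValuedSolution m γ κ μ) (ha : TorusSmooth a)
    (hb : LinearGrowth b) (hb2 : ∀ w, b w ^ 2 ≤ w ^ 2) (t : ℝ) :
    moment μ a b t ^ 2 ≤ moment μ (fun θ => a θ ^ 2) (fun _ => 1) t * kinetic μ t := by
  have hi : Integrable (fun z : Phase => b z.2 ^ 2) (μ (max t 0) : Measure Phase) :=
    (integrable_sq hμ t).mono'
      ((hb.1.continuous.comp continuous_snd).pow 2).aestronglyMeasurable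
      (Eventually.of_forall fun z => by
        rw [Real.norm_eq_abs, abs_of_nonneg (sq_nonneg _)]; exact hb2 _)
  have ha2 : Integrable (fun z : Phase => a z.1 ^ 2) (μ (max t 0) : Measure Phase) := by
    simpa [sq] using (ha.mul ha).integrable (ν := (μ (max t 0) : Measure Phase))
  have h := sq_integral_mul_le ha2 hi (hb.integrable hμ ha t)
  refine h.trans ?_
  have e1 : moment μ (fun θ => a θ ^ 2) (fun _ => 1) t
      = ∫ z, a z.1 ^ 2 ∂(μ (max t 0) : Measure Phase) := by simp [moment]
  rw [e1, kinetic, moment_one_sq]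
  exact mul_le_mul_of_nonneg_left (integral_mono hi (integrable_sq hμ t) fun z => hb2 z.2)
    (integral_nonneg fun z => sq_nonneg _)

lemma moment_mono_left (h₁ : TorusSmooth a₁) (h₂ : TorusSmooth a₂) (h : ∀ θ, a₁ θ ≤ a₂ θ) (t : ℝ) :
    moment μ a₁ (fun _ => 1) t ≤ moment μ a₂ (fun _ => 1) t := by
  unfold moment
  simp only [mul_one]
  exact integral_mono h₁.integrable h₂.integrable fun z => h z.1

lemma sq_moment_le_kinetic (hμ : IsMeasureValuedSolution m γ κ μ) (ha : TorusSmooth a)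
    (ha1 : ∀ θ, a θ ^ 2 ≤ 1)
    (hb : LinearGrowth b) (hb2 : ∀ w, b w ^ 2 ≤ w ^ 2) (t : ℝ) :
    moment μ a b t ^ 2 ≤ kinetic μ t := by
  have h := sq_moment_le hμ ha hb hb2 t
  have h1 : moment μ (fun θ => a θ ^ 2) (fun _ => 1) t ≤ 1 := by
    have hs : TorusSmooth fun θ => a θ ^ 2 := by simpa [sq] using ha.mul ha
    simpa using moment_mono_left (μ := μ) hs (.const 1) ha1 t
  nlinarith [kinetic_nonneg μ t]

lemma torusSin_sq_le_one (θ : Torus) : torusSin θ ^ 2 ≤ 1 := by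
  nlinarith [torusSin_sq_add_torusCos_sq θ, sq_nonneg (torusCos θ)]

lemma torusCos_sq_le_one (θ : Torus) : torusCos θ ^ 2 ≤ 1 := by
  nlinarith [torusSin_sq_add_torusCos_sq θ, sq_nonneg (torusSin θ)]

lemma orderSq_le_one (μ : ℝ → ProbabilityMeasure Phase) (t : ℝ) : orderSq μ t ≤ 1 := by
  have e1 : cosMean μ t = ∫ z, torusCos z.1 * 1 ∂(μ (max t 0) : Measure Phase) := rfl
  have e2 : sinMean μ t = ∫ z, torusSin z.1 * 1 ∂(μ (max t 0) : Measure Phase) := rfl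
  have i1 : Integrable (fun z : Phase => torusCos z.1 ^ 2) (μ (max t 0) : Measure Phase) := by
    simpa [sq] using (TorusSmooth.torusCos.mul .torusCos).integrable
  have i2 : Integrable (fun z : Phase => torusSin z.1 ^ 2) (μ (max t 0) : Measure Phase) := by
    simpa [sq] using (TorusSmooth.torusSin.mul .torusSin).integrable
  have h1 := sq_integral_mul_le i1 (g := fun _ => 1) (by simp)
    (by simpa using TorusSmooth.torusCos.integrable)
  have h2 := sq_integral_mul_le i2 (g := fun _ => 1) (by simp)
    (by simpa using TorusSmooth.torusSin.integrable)
  have h3 : (∫ z, torusSin z.1 ^ 2 ∂(μ (max t 0) : Measure Phase)) +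
      ∫ z, torusCos z.1 ^ 2 ∂(μ (max t 0) : Measure Phase) = 1 := by
    rw [← integral_add i2 i1]
    simp [torusSin_sq_add_torusCos_sq]
  unfold orderSq
  rw [e1, e2]
  simp at h1 h2 ⊢
  linarith

lemma normal_sq_le_orderSq (t : ℝ) (θ : Torus) : normal μ t θ ^ 2 ≤ orderSq μ t := by
  nlinarith [normal_sq_add_tangent_sq (μ := μ) t θ, sq_nonneg (tangent μ t θ)]

lemma tangent_sq_le_orderSq (t : ℝ) (θ : Torus) : tangent μ t θ ^ 2 ≤ orderSq μ t := by
  nlinarith [normal_sq_add_tangent_sq (μ := μ) t θ, sq_nonneg (normal μ t θ)]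

lemma spread_le_orderSq (μ : ℝ → ProbabilityMeasure Phase) (t : ℝ) : spread μ t ≤ orderSq μ t := by
  have hs : TorusSmooth fun θ => normal μ t θ ^ 2 := by
    simpa [sq] using (TorusSmooth.normal (μ := μ) t).mul (.normal t)
  have := moment_mono_left (μ := μ) hs (.const (orderSq μ t)) (normal_sq_le_orderSq t) t
  refine this.trans (le_of_eq ?_)
  simp [moment]

lemma drift_sq_le (hμ : IsMeasureValuedSolution m γ κ μ) (t : ℝ) :
    drift μ t ^ 2 ≤ spread μ t * kinetic μ t :=
  sq_moment_le hμ (.normal t) .id (fun _ => le_rfl) t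

/-- Cauchy–Schwarz, with the tangential factor bounded by 1. -/
lemma twist_sq_le (μ : ℝ → ProbabilityMeasure Phase) (t : ℝ) : twist μ t ^ 2 ≤ spread μ t := by
  have hn : Integrable (fun z : Phase => normal μ t z.1 ^ 2) (μ (max t 0) : Measure Phase) := by
    simpa [sq] using ((TorusSmooth.normal (μ := μ) t).mul (.normal t)).integrable
  have ht : Integrable (fun z : Phase => tangent μ t z.1 ^ 2) (μ (max t 0) : Measure Phase) := by
    simpa [sq] using ((TorusSmooth.tangent (μ := μ) t).mul (.tangent t)).integrable
  have h := sq_integral_mul_le hn ht ((TorusSmooth.normal (μ := μ) t).mul (.tangent t)).integrable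
  have h1 : ∫ z, tangent μ t z.1 ^ 2 ∂(μ (max t 0) : Measure Phase) ≤ 1 := by
    have := integral_mono ht (integrable_const (1 : ℝ)) fun z =>
      (tangent_sq_le_orderSq t z.1).trans (orderSq_le_one μ t)
    simpa using this
  have e1 : twist μ t = ∫ z, normal μ t z.1 * tangent μ t z.1 ∂(μ (max t 0) : Measure Phase) := by
    simp [twist, moment]
  have e2 : spread μ t = ∫ z, normal μ t z.1 ^ 2 ∂(μ (max t 0) : Measure Phase) := by
    simp [spread, moment]
  have h0 := spread_nonneg μ t
  rw [e2] at h0 ⊢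
  rw [e1]
  nlinarith

/-- Pointwise |q²ω| ≤ (q⁴ + ω²)/2, and q⁴ ≤ q² because |q| ≤ 1. -/
lemma abs_moment_normal_sq_le (hμ : IsMeasureValuedSolution m γ κ μ) (t : ℝ) :
    |moment μ (fun θ => normal μ t θ ^ 2) (fun w => w) t| ≤ (spread μ t + kinetic μ t) / 2 := by
  have hs : TorusSmooth fun θ => normal μ t θ ^ 2 := by
    simpa [sq] using (TorusSmooth.normal (μ := μ) t).mul (.normal t)
  have i1 : Integrable (fun z : Phase => normal μ t z.1 ^ 2) (μ (max t 0) : Measure Phase) :=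
    hs.integrable
  have e : (spread μ t + kinetic μ t) / 2 =
      ∫ z, (normal μ t z.1 ^ 2 + z.2 ^ 2) / 2 ∂(μ (max t 0) : Measure Phase) := by
    rw [integral_div, integral_add i1 (integrable_sq hμ t), kinetic, moment_one_sq]
    simp [spread, moment]
  rw [e]
  refine norm_integral_le_of_norm_le (f := fun z : Phase => normal μ t z.1 ^ 2 * z.2)
    ((i1.add (integrable_sq hμ t)).div_const 2) (Eventually.of_forall fun z => ?_)
  have h1 := (normal_sq_le_orderSq (μ := μ) t z.1).trans (orderSq_le_one μ t)
  have h0 := sq_nonneg (normal μ t z.1)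
  rw [Real.norm_eq_abs, abs_le]
  constructor <;>
    nlinarith [sq_nonneg (normal μ t z.1 ^ 2 + z.2), sq_nonneg (normal μ t z.1 ^ 2 - z.2)]

end KineticKuramoto

namespace KineticKuramoto

open scoped ContDiff

variable {m γ κ : ℝ} {μ : ℝ → ProbabilityMeasure Phase} {a : Torus → ℝ} {b : ℝ → ℝ}

/-! ### Evolution of the basic moments -/

lemma LinearGrowth.continuous_moment (hμ : IsMeasureValuedSolution m γ κ μ)
    (hm : 0 < m) (hγ : 0 < γ) (hκ : 0 < κ) (hb : LinearGrowth b) (ha : TorusSmooth a) :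
    Continuous (moment μ a b) := by
  obtain ⟨B, h⟩ := hb.admissible ha
  exact hμ.continuous_moment_of_admissible hm hγ hκ h

/-- An observable of the phase alone does not feel the force; only transport remains. -/
lemma hasDerivAt_moment_one (hμ : IsMeasureValuedSolution m γ κ μ)
    (hm : 0 < m) (hγ : 0 < γ) (hκ : 0 < κ) (ha : TorusSmooth a) {t : ℝ} (ht : 0 < t) :
    HasDerivAt (moment μ a (fun _ => 1)) (moment μ (torusDeriv a) (fun w => w) t) t := by
  obtain ⟨B, h⟩ := (LinearGrowth.const 1).admissible ha
  refine hμ.hasDerivAt_moment hm hγ hκ h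
    (LinearGrowth.id.continuous_moment hμ hm hγ hκ ha.torusDeriv) (fun s => ?_) ht
  rw [h.generatorIntegral_eq_moment hμ]
  simp

lemma hasDerivAt_cosMean (hμ : IsMeasureValuedSolution m γ κ μ)
    (hm : 0 < m) (hγ : 0 < γ) (hκ : 0 < κ) {t : ℝ} (ht : 0 < t) :
    HasDerivAt (cosMean μ) (-moment μ torusSin (fun w => w) t) t := by
  have := hasDerivAt_moment_one hμ hm hγ hκ .torusCos ht
  rwa [torusDeriv_torusCos, moment_neg_left] at this

lemma hasDerivAt_sinMean (hμ : IsMeasureValuedSolution m γ κ μ)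
    (hm : 0 < m) (hγ : 0 < γ) (hκ : 0 < κ) {t : ℝ} (ht : 0 < t) :
    HasDerivAt (sinMean μ) (moment μ torusCos (fun w => w) t) t := by
  have := hasDerivAt_moment_one hμ hm hγ hκ .torusSin ht
  rwa [torusDeriv_torusSin] at this

lemma continuous_cosMean (hμ : IsMeasureValuedSolution m γ κ μ)
    (hm : 0 < m) (hγ : 0 < γ) (hκ : 0 < κ) : Continuous (cosMean μ) :=
  (LinearGrowth.const 1).continuous_moment hμ hm hγ hκ .torusCos

lemma continuous_sinMean (hμ : IsMeasureValuedSolution m γ κ μ)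
    (hm : 0 < m) (hγ : 0 < γ) (hκ : 0 < κ) : Continuous (sinMean μ) :=
  (LinearGrowth.const 1).continuous_moment hμ hm hγ hκ .torusSin

lemma continuous_orderSq (hμ : IsMeasureValuedSolution m γ κ μ)
    (hm : 0 < m) (hγ : 0 < γ) (hκ : 0 < κ) : Continuous (orderSq μ) :=
  ((continuous_cosMean hμ hm hγ hκ).pow 2).add ((continuous_sinMean hμ hm hγ hκ).pow 2)

lemma continuous_kinetic (hμ : IsMeasureValuedSolution m γ κ μ)
    (hm : 0 < m) (hγ : 0 < γ) (hκ : 0 < κ) : Continuous (kinetic μ) :=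
  hμ.continuous_moment_of_admissible hm hγ hκ admissible_sq

lemma drift_eq (hμ : IsMeasureValuedSolution m γ κ μ) (t : ℝ) :
    drift μ t = cosMean μ t * moment μ torusSin (fun w => w) t
      - sinMean μ t * moment μ torusCos (fun w => w) t :=
  moment_normal hμ .id t

lemma spread_eq (hμ : IsMeasureValuedSolution m γ κ μ) (t : ℝ) :
    spread μ t = cosMean μ t ^ 2 * moment μ torusSS (fun _ => 1) t
        - 2 * cosMean μ t * sinMean μ t * moment μ torusSC (fun _ => 1) t
        + sinMean μ t ^ 2 * moment μ torusCC (fun _ => 1) t :=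
  moment_normal_sq hμ (.const 1) t

lemma twist_eq (hμ : IsMeasureValuedSolution m γ κ μ) (t : ℝ) :
    twist μ t = cosMean μ t * sinMean μ t *
        (moment μ torusSS (fun _ => 1) t - moment μ torusCC (fun _ => 1) t)
        + (cosMean μ t ^ 2 - sinMean μ t ^ 2) * moment μ torusSC (fun _ => 1) t :=
  moment_normal_mul_tangent hμ (.const 1) t

lemma continuous_drift (hμ : IsMeasureValuedSolution m γ κ μ)
    (hm : 0 < m) (hγ : 0 < γ) (hκ : 0 < κ) : Continuous (drift μ) := by
  rw [funext (drift_eq hμ)]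
  have h1 := continuous_cosMean hμ hm hγ hκ
  have h2 := continuous_sinMean hμ hm hγ hκ
  have h3 := LinearGrowth.id.continuous_moment hμ hm hγ hκ .torusSin
  have h4 := LinearGrowth.id.continuous_moment hμ hm hγ hκ .torusCos
  fun_prop

lemma continuous_spread (hμ : IsMeasureValuedSolution m γ κ μ)
    (hm : 0 < m) (hγ : 0 < γ) (hκ : 0 < κ) : Continuous (spread μ) := by
  rw [funext (spread_eq hμ)]
  have h1 := continuous_cosMean hμ hm hγ hκ
  have h2 := continuous_sinMean hμ hm hγ hκ
  have h3 := (LinearGrowth.const 1).continuous_moment hμ hm hγ hκ .torusSS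
  have h4 := (LinearGrowth.const 1).continuous_moment hμ hm hγ hκ .torusSC
  have h5 := (LinearGrowth.const 1).continuous_moment hμ hm hγ hκ .torusCC
  fun_prop

lemma hasDerivAt_orderSq (hμ : IsMeasureValuedSolution m γ κ μ)
    (hm : 0 < m) (hγ : 0 < γ) (hκ : 0 < κ) {t : ℝ} (ht : 0 < t) :
    HasDerivAt (orderSq μ) (-2 * drift μ t) t := by
  have h := ((hasDerivAt_cosMean hμ hm hγ hκ ht).pow 2).add
    ((hasDerivAt_sinMean hμ hm hγ hκ ht).pow 2)
  refine h.congr_deriv ?_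
  rw [drift_eq hμ]
  push_cast
  ring

lemma hasDerivAt_kinetic (hμ : IsMeasureValuedSolution m γ κ μ)
    (hm : 0 < m) (hγ : 0 < γ) (hκ : 0 < κ) {t : ℝ} (ht : 0 < t) :
    HasDerivAt (kinetic μ) (-(2 * γ / m) * kinetic μ t - 2 * κ / m * drift μ t) t := by
  refine hμ.hasDerivAt_moment hm hγ hκ admissible_sq
    (g := fun t => -(2 * γ / m) * kinetic μ t - 2 * κ / m * drift μ t) ?_ (fun s => ?_) ht
  · have h1 := continuous_kinetic hμ hm hγ hκ
    have h2 := continuous_drift hμ hm hγ hκ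
    fun_prop
  · rw [admissible_sq.generatorIntegral_eq_moment hμ, drift_eq hμ]
    have e1 : deriv (fun w : ℝ => w ^ 2) = fun w => 2 * w := by funext w; simp
    have e2 : (fun w : ℝ => w * (2 * w)) = fun w => 2 * w ^ 2 := by funext w; ring
    have e3 := fun a : Torus → ℝ => moment_const_mul_right μ a (fun w => w) 2 s
    simp only [e1, e2, e3, moment_const_mul_right, torusDeriv_const, moment_zero_left, one_mul]
    simp only [kinetic, cosMean, sinMean]
    ring

/-- The mean frequency decays exponentially. -/
lemma hasDerivAt_meanFrequency (hμ : IsMeasureValuedSolution m γ κ μ)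
    (hm : 0 < m) (hγ : 0 < γ) (hκ : 0 < κ) {t : ℝ} (ht : 0 < t) :
    HasDerivAt (moment μ (fun _ => 1) (fun w => w))
      (-(γ / m) * moment μ (fun _ => 1) (fun w => w) t) t := by
  obtain ⟨B, h⟩ := LinearGrowth.id.admissible (TorusSmooth.const 1)
  have hc := LinearGrowth.id.continuous_moment hμ hm hγ hκ (TorusSmooth.const 1)
  refine hμ.hasDerivAt_moment hm hγ hκ h
    (g := fun t => -(γ / m) * moment μ (fun _ => 1) (fun w => w) t) (by fun_prop) (fun s => ?_) ht
  rw [h.generatorIntegral_eq_moment hμ]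
  simp only [deriv_id'', torusDeriv_const, moment_zero_left, one_mul, mul_one]
  ring

/-- The energy per unit mass. -/
noncomputable def energy (m κ : ℝ) (μ : ℝ → ProbabilityMeasure Phase) (t : ℝ) : ℝ :=
  kinetic μ t / 2 - κ / (2 * m) * orderSq μ t

/-- The weight κ/(2m) is the one for which the two drift terms cancel, leaving friction only. -/
lemma hasDerivAt_energy (hμ : IsMeasureValuedSolution m γ κ μ)
    (hm : 0 < m) (hγ : 0 < γ) (hκ : 0 < κ) {t : ℝ} (ht : 0 < t) :
    HasDerivAt (energy m κ μ) (-(γ / m) * kinetic μ t) t := by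
  refine (((hasDerivAt_kinetic hμ hm hγ hκ ht).div_const 2).sub
    ((hasDerivAt_orderSq hμ hm hγ hκ ht).const_mul (κ / (2 * m)))).congr_deriv ?_
  field_simp
  ring

lemma continuous_energy (hμ : IsMeasureValuedSolution m γ κ μ)
    (hm : 0 < m) (hγ : 0 < γ) (hκ : 0 < κ) : Continuous (energy m κ μ) := by
  unfold energy
  have h1 := continuous_kinetic hμ hm hγ hκ
  have h2 := continuous_orderSq hμ hm hγ hκ
  fun_prop

lemma antitoneOn_energy (hμ : IsMeasureValuedSolution m γ κ μ)
    (hm : 0 < m) (hγ : 0 < γ) (hκ : 0 < κ) : AntitoneOn (energy m κ μ) (Ici 0) := by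
  refine antitoneOn_of_deriv_nonpos (convex_Ici 0) (continuous_energy hμ hm hγ hκ).continuousOn
    (fun t ht => ?_) (fun t ht => ?_)
  · rw [interior_Ici] at ht
    exact (hasDerivAt_energy hμ hm hγ hκ ht).differentiableAt.differentiableWithinAt
  · rw [interior_Ici] at ht
    rw [(hasDerivAt_energy hμ hm hγ hκ ht).deriv]
    have := kinetic_nonneg μ t
    have : 0 ≤ γ / m * kinetic μ t := by positivity
    linarith

lemma neg_le_energy (hm : 0 < m) (hκ : 0 < κ) (μ : ℝ → ProbabilityMeasure Phase) (t : ℝ) :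
    -(κ / (2 * m)) ≤ energy m κ μ t := by
  unfold energy
  have h1 := kinetic_nonneg μ t
  have h2 := orderSq_le_one μ t
  have h3 : κ / (2 * m) * orderSq μ t ≤ κ / (2 * m) * 1 := by gcongr
  linarith

/-! ### A Lyapunov functional controlling the spread -/

/-- With ω in place of sin ω, transport would produce the mean of a'(θ)ω², whose continuity in time
would require a third moment. With sin ω the observables produced are all of linear growth, hence
have continuous moments. -/
lemma hasDerivAt_moment_sin (hμ : IsMeasureValuedSolution m γ κ μ)
    (hm : 0 < m) (hγ : 0 < γ) (hκ : 0 < κ) (ha : TorusSmooth a) {t : ℝ} (ht : 0 < t) :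
    HasDerivAt (moment μ a Real.sin)
      (moment μ (torusDeriv a) (fun w => w * Real.sin w) t +
        1 / m * (-γ * moment μ a (fun w => w * Real.cos w) t + κ *
          (sinMean μ t * moment μ (fun θ => a θ * torusCos θ) Real.cos t -
            cosMean μ t * moment μ (fun θ => a θ * torusSin θ) Real.cos t))) t := by
  obtain ⟨B, h⟩ := LinearGrowth.sin.admissible ha
  refine hμ.hasDerivAt_moment hm hγ hκ h (g := fun t =>
    moment μ (torusDeriv a) (fun w => w * Real.sin w) t +
        1 / m * (-γ * moment μ a (fun w => w * Real.cos w) t + κ *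
          (sinMean μ t * moment μ (fun θ => a θ * torusCos θ) Real.cos t -
            cosMean μ t * moment μ (fun θ => a θ * torusSin θ) Real.cos t))) ?_ (fun s => ?_) ht
  · have h1 := continuous_cosMean hμ hm hγ hκ
    have h2 := continuous_sinMean hμ hm hγ hκ
    have h3 := LinearGrowth.mul_sin.continuous_moment hμ hm hγ hκ ha.torusDeriv
    have h4 := LinearGrowth.mul_cos.continuous_moment hμ hm hγ hκ ha
    have h5 := LinearGrowth.cos.continuous_moment hμ hm hγ hκ (ha.mul .torusCos)
    have h6 := LinearGrowth.cos.continuous_moment hμ hm hγ hκ (ha.mul .torusSin)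
    fun_prop
  · rw [h.generatorIntegral_eq_moment hμ, Real.deriv_sin]
    rfl

/-- The bounded version `∫ sin ω (C sin θ - S cos θ) dμ` of the drift. -/
noncomputable def virial (μ : ℝ → ProbabilityMeasure Phase) (t : ℝ) : ℝ :=
  cosMean μ t * moment μ torusSin Real.sin t - sinMean μ t * moment μ torusCos Real.sin t

/-- The derivative of the virial. -/
noncomputable def virialRate (m γ κ : ℝ) (μ : ℝ → ProbabilityMeasure Phase) (t : ℝ) : ℝ :=
  -(moment μ torusSin (fun w => w) t * moment μ torusSin Real.sin t
      + moment μ torusCos (fun w => w) t * moment μ torusCos Real.sin t)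
    + (moment μ (tangent μ t) (fun w => w * Real.sin w) t
      - γ / m * moment μ (normal μ t) (fun w => w * Real.cos w) t
      - κ / m * moment μ (fun θ => normal μ t θ ^ 2) Real.cos t)

lemma hasDerivAt_virial (hμ : IsMeasureValuedSolution m γ κ μ)
    (hm : 0 < m) (hγ : 0 < γ) (hκ : 0 < κ) {t : ℝ} (ht : 0 < t) :
    HasDerivAt (virial μ) (virialRate m γ κ μ t) t := by
  refine (((hasDerivAt_cosMean hμ hm hγ hκ ht).mul
    (hasDerivAt_moment_sin hμ hm hγ hκ .torusSin ht)).sub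
    ((hasDerivAt_sinMean hμ hm hγ hκ ht).mul
      (hasDerivAt_moment_sin hμ hm hγ hκ .torusCos ht))).congr_deriv ?_
  have e1 : (fun θ => torusSin θ * torusCos θ) = torusSC := rfl
  have e2 : (fun θ => torusSin θ * torusSin θ) = torusSS := rfl
  have e3 : (fun θ => torusCos θ * torusCos θ) = torusCC := rfl
  have e4 : (fun θ => torusCos θ * torusSin θ) = torusSC := by
    funext θ; exact mul_comm _ _
  rw [virialRate, moment_tangent hμ .mul_sin, moment_normal hμ .mul_cos, moment_normal_sq hμ .cos,
    torusDeriv_torusSin, torusDeriv_torusCos, moment_neg_left, e1, e2, e3, e4]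
  field_simp
  ring

lemma abs_virial_le (hμ : IsMeasureValuedSolution m γ κ μ) (t : ℝ) :
    |virial μ t| ≤ 1 + kinetic μ t := by
  have h1 := sq_moment_le_kinetic hμ .torusSin torusSin_sq_le_one .sin
    (fun w => sq_le_sq.2 Real.abs_sin_le_abs) t
  have h2 := sq_moment_le_kinetic hμ .torusCos torusCos_sq_le_one .sin
    (fun w => sq_le_sq.2 Real.abs_sin_le_abs) t
  have h3 := orderSq_le_one μ t
  unfold virial
  unfold orderSq at h3
  set C := cosMean μ t
  set S := sinMean μ t
  set x := moment μ torusSin Real.sin t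
  set y := moment μ torusCos Real.sin t
  rw [abs_le]
  constructor <;> nlinarith [sq_nonneg (C + x), sq_nonneg (C - x), sq_nonneg (S + y),
    sq_nonneg (S - y)]

/-- The good term is -(κ/m) q² cos ω, which is -(κ/m) q² up to a multiple of ω². Half of it absorbs
the friction term by Young's inequality; everything else is bounded by K. -/
lemma virialRate_le (hμ : IsMeasureValuedSolution m γ κ μ)
    (hm : 0 < m) (hκ : 0 < κ) (t : ℝ) :
    virialRate m γ κ μ t ≤
      -(κ / (2 * m)) * spread μ t + (3 + γ ^ 2 / (2 * κ * m) + κ / (2 * m)) * kinetic μ t := by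
  have h1 := sq_moment_le_kinetic hμ .torusSin torusSin_sq_le_one .sin
    (fun w => sq_le_sq.2 Real.abs_sin_le_abs) t
  have h2 := sq_moment_le_kinetic hμ .torusCos torusCos_sq_le_one .sin
    (fun w => sq_le_sq.2 Real.abs_sin_le_abs) t
  have h3 := sq_moment_le_kinetic hμ .torusSin torusSin_sq_le_one .id (fun w => le_rfl) t
  have h4 := sq_moment_le_kinetic hμ .torusCos torusCos_sq_le_one .id (fun w => le_rfl) t
  have hs : TorusSmooth fun θ => normal μ t θ ^ 2 := by
    simpa [sq] using (TorusSmooth.normal (μ := μ) t).mul (.normal t)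
  have i0 : Integrable (fun z : Phase => normal μ t z.1 ^ 2) (μ (max t 0) : Measure Phase) :=
    hs.integrable
  have i1 := LinearGrowth.mul_sin.integrable hμ (.tangent (μ := μ) t) t
  have i2 := (LinearGrowth.mul_cos.integrable hμ (.normal (μ := μ) t) t).const_mul (γ / m)
  have i3 := (LinearGrowth.cos.integrable hμ hs t).const_mul (κ / m)
  have key : moment μ (tangent μ t) (fun w => w * Real.sin w) t
      - γ / m * moment μ (normal μ t) (fun w => w * Real.cos w) t
      - κ / m * moment μ (fun θ => normal μ t θ ^ 2) Real.cos t ≤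
      -(κ / (2 * m)) * spread μ t + (1 + γ ^ 2 / (2 * κ * m) + κ / (2 * m)) * kinetic μ t := by
    have j0 := i0.const_mul (-(κ / (2 * m)))
    have j1 := (integrable_sq hμ t).const_mul (1 + γ ^ 2 / (2 * κ * m) + κ / (2 * m))
    have e1 : moment μ (tangent μ t) (fun w => w * Real.sin w) t
        - γ / m * moment μ (normal μ t) (fun w => w * Real.cos w) t
        - κ / m * moment μ (fun θ => normal μ t θ ^ 2) Real.cos t =
        ∫ z, (tangent μ t z.1 * (z.2 * Real.sin z.2)
          - γ / m * (normal μ t z.1 * (z.2 * Real.cos z.2))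
          - κ / m * (normal μ t z.1 ^ 2 * Real.cos z.2)) ∂(μ (max t 0) : Measure Phase) := by
      rw [integral_sub (f := fun z : Phase => tangent μ t z.1 * (z.2 * Real.sin z.2)
          - γ / m * (normal μ t z.1 * (z.2 * Real.cos z.2))) (i1.sub i2) i3, integral_sub i1 i2,
        integral_const_mul, integral_const_mul]
      rfl
    have e2 : -(κ / (2 * m)) * spread μ t + (1 + γ ^ 2 / (2 * κ * m) + κ / (2 * m)) * kinetic μ t =
        ∫ z, (-(κ / (2 * m)) * normal μ t z.1 ^ 2
          + (1 + γ ^ 2 / (2 * κ * m) + κ / (2 * m)) * z.2 ^ 2) ∂(μ (max t 0) : Measure Phase) := by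
      rw [integral_add j0 j1, integral_const_mul, integral_const_mul, kinetic, moment_one_sq]
      simp [spread, moment]
    rw [e1, e2]
    refine integral_mono ((i1.sub i2).sub i3) (j0.add j1) fun z => ?_
    have hr : tangent μ t z.1 ^ 2 ≤ 1 := (tangent_sq_le_orderSq t z.1).trans (orderSq_le_one μ t)
    have hq : normal μ t z.1 ^ 2 ≤ 1 := (normal_sq_le_orderSq t z.1).trans (orderSq_le_one μ t)
    set r := tangent μ t z.1
    set q := normal μ t z.1
    set w := z.2
    have s1 : r * (w * Real.sin w) ≤ w ^ 2 := by
      have hsw : Real.sin w ^ 2 ≤ w ^ 2 := sq_le_sq.2 Real.abs_sin_le_abs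
      have : |r * (w * Real.sin w)| ≤ 1 * (|w| * |w|) := by
        rw [abs_mul, abs_mul]
        have hr1 : |r| ≤ 1 := (sq_le_one_iff_abs_le_one r).1 hr
        exact mul_le_mul hr1 (mul_le_mul_of_nonneg_left Real.abs_sin_le_abs (abs_nonneg w))
          (by positivity) zero_le_one
      rw [one_mul, abs_mul_abs_self] at this
      nlinarith [le_abs_self (r * (w * Real.sin w))]
    -- Young's inequality with weights chosen so that exactly half of (κ/m) q² is spent; the
    -- difference of the two sides is a square.
    have s2 : -(γ / m * (q * (w * Real.cos w))) ≤
        κ / (2 * m) * q ^ 2 + γ ^ 2 / (2 * κ * m) * w ^ 2 := by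
      have hc : Real.cos w ^ 2 ≤ 1 := Real.cos_sq_le_one w
      have hw : (w * Real.cos w) ^ 2 ≤ w ^ 2 := by rw [mul_pow]; nlinarith [sq_nonneg w]
      have e : κ / (2 * m) * q ^ 2 + γ ^ 2 / (2 * κ * m) * (w * Real.cos w) ^ 2
          + γ / m * (q * (w * Real.cos w)) = (κ * q + γ * (w * Real.cos w)) ^ 2 / (2 * κ * m) := by
        field_simp
        ring
      have e0 : 0 ≤ (κ * q + γ * (w * Real.cos w)) ^ 2 / (2 * κ * m) := by positivity
      have e3 : γ ^ 2 / (2 * κ * m) * (w * Real.cos w) ^ 2 ≤ γ ^ 2 / (2 * κ * m) * w ^ 2 := by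
        gcongr
      linarith
    have s3 : -(κ / m * (q ^ 2 * Real.cos w)) ≤ -(κ / m) * q ^ 2 + κ / (2 * m) * w ^ 2 := by
      have hc : 1 - Real.cos w ≤ w ^ 2 / 2 := by linarith [Real.one_sub_sq_div_two_le_cos (x := w)]
      have hc0 : 0 ≤ 1 - Real.cos w := by linarith [Real.cos_le_one w]
      have : q ^ 2 * (1 - Real.cos w) ≤ w ^ 2 / 2 := by nlinarith [sq_nonneg q]
      have h' := mul_le_mul_of_nonneg_left this (by positivity : 0 ≤ κ / m)
      have e : κ / m * (w ^ 2 / 2) = κ / (2 * m) * w ^ 2 := by field_simp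
      linarith
    have e : κ / m = κ / (2 * m) + κ / (2 * m) := by field_simp; norm_num
    have e' : κ / m * q ^ 2 = κ / (2 * m) * q ^ 2 + κ / (2 * m) * q ^ 2 := by rw [e]; ring
    beta_reduce
    linarith
  unfold virialRate
  set x := moment μ torusSin Real.sin t
  set y := moment μ torusCos Real.sin t
  set x' := moment μ torusSin (fun w => w) t
  set y' := moment μ torusCos (fun w => w) t
  -- The four means x, y, x', y' have squares at most K, so the rotation of z costs 2K, which raises
  -- the constant 1 of `key` to 3.
  nlinarith [sq_nonneg (x + x'), sq_nonneg (y + y')]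

end KineticKuramoto

namespace KineticKuramoto

open scoped ContDiff

/-! ### Functions on the half-line -/

lemma exists_tendsto_of_antitoneOn {f : ℝ → ℝ} {c : ℝ} (hf : AntitoneOn f (Ici 0))
    (hc : ∀ t, 0 ≤ t → c ≤ f t) : ∃ l, Tendsto f atTop (𝓝 l) := by
  have h1 : Antitone fun t : ℝ => f (max t 0) := fun s t hst =>
    hf (mem_Ici.2 (le_max_right _ _)) (mem_Ici.2 (le_max_right _ _)) (max_le_max_right 0 hst)
  have h2 := tendsto_atTop_ciInf h1 ⟨c, by rintro _ ⟨t, rfl⟩; exact hc _ (le_max_right _ _)⟩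
  refine ⟨_, h2.congr' ?_⟩
  filter_upwards [eventually_ge_atTop 0] with t ht
  rw [max_eq_left ht]

lemma aestronglyMeasurable_of_hasDerivAt {f f' : ℝ → ℝ} {a : ℝ}
    (h : ∀ t, a < t → HasDerivAt f (f' t) t) :
    AEStronglyMeasurable f' (volume.restrict (Ioi a)) := by
  refine (measurable_deriv f).aestronglyMeasurable.congr ?_
  refine (ae_restrict_iff' measurableSet_Ioi).2 (Eventually.of_forall fun t ht => (h t ht).deriv)

lemma integrableOn_of_hasDerivAt {f f' g : ℝ → ℝ} {a : ℝ}
    (h : ∀ t, a < t → HasDerivAt f (f' t) t) (hb : ∀ t, a < t → |f' t| ≤ g t)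
    (hg : IntegrableOn g (Ioi a)) : IntegrableOn f' (Ioi a) :=
  Integrable.mono' hg (aestronglyMeasurable_of_hasDerivAt h)
    ((ae_restrict_iff' measurableSet_Ioi).2 (Eventually.of_forall hb))

lemma exists_tendsto_of_hasDerivAt {f f' g : ℝ → ℝ} {a : ℝ}
    (h : ∀ t, a < t → HasDerivAt f (f' t) t) (hb : ∀ t, a < t → |f' t| ≤ g t)
    (hg : IntegrableOn g (Ioi a)) : ∃ l, Tendsto f atTop (𝓝 l) :=
  ⟨_, tendsto_limUnder_of_hasDerivAt_of_integrableOn_Ioi h (integrableOn_of_hasDerivAt h hb hg)⟩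

/-- Functions which are bounded with bounded derivative on the positive half-line. -/
def BoundedC1 (f : ℝ → ℝ) : Prop :=
  ∃ (f' : ℝ → ℝ) (B : ℝ), 0 ≤ B ∧ ∀ t, 0 < t → HasDerivAt f (f' t) t ∧ |f t| ≤ B ∧ |f' t| ≤ B

namespace BoundedC1

variable {f g : ℝ → ℝ}

lemma const (c : ℝ) : BoundedC1 (fun _ => c) :=
  ⟨fun _ => 0, |c|, abs_nonneg c, fun t _ => ⟨hasDerivAt_const t c, le_rfl, by simp⟩⟩

lemma add (hf : BoundedC1 f) (hg : BoundedC1 g) : BoundedC1 (fun t => f t + g t) := by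
  obtain ⟨f', B, hB, h⟩ := hf
  obtain ⟨g', D, hD, h'⟩ := hg
  refine ⟨fun t => f' t + g' t, B + D, by positivity, fun t ht => ?_⟩
  obtain ⟨a1, a2, a3⟩ := h t ht
  obtain ⟨b1, b2, b3⟩ := h' t ht
  exact ⟨a1.add b1, (abs_add_le _ _).trans (by linarith), (abs_add_le _ _).trans (by linarith)⟩

lemma mul (hf : BoundedC1 f) (hg : BoundedC1 g) : BoundedC1 (fun t => f t * g t) := by
  obtain ⟨f', B, hB, h⟩ := hf
  obtain ⟨g', D, hD, h'⟩ := hg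
  refine ⟨fun t => f' t * g t + f t * g' t, 2 * (B * D), by positivity, fun t ht => ?_⟩
  obtain ⟨a1, a2, a3⟩ := h t ht
  obtain ⟨b1, b2, b3⟩ := h' t ht
  have k : ∀ x y : ℝ, |x| ≤ B → |y| ≤ D → |x * y| ≤ B * D := fun x y hx hy => by
    rw [abs_mul]; exact mul_le_mul hx hy (abs_nonneg _) hB
  refine ⟨a1.mul b1, (k _ _ a2 b2).trans (by nlinarith [mul_nonneg hB hD]), ?_⟩
  have := k _ _ a3 b2
  have := k _ _ a2 b3
  exact (abs_add_le _ _).trans (by linarith)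

/-- A nonnegative integrable function which is bounded with bounded derivative tends to zero. -/
lemma tendsto_zero (hf : BoundedC1 f) (h0 : ∀ t, 0 ≤ f t) (hi : IntegrableOn f (Ioi 0)) :
    Tendsto f atTop (𝓝 0) := by
  obtain ⟨f', B, hB, h⟩ := hf
  -- The square is used because its derivative 2 f f' is bounded by a multiple of f, hence
  -- integrable, although f' need not be.
  have h1 : ∀ t, 0 < t → HasDerivAt (fun t => f t * f t) (f' t * f t + f t * f' t) t :=
    fun t ht => (h t ht).1.mul (h t ht).1
  have h2 : IntegrableOn (fun t => f' t * f t + f t * f' t) (Ioi 0) := by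
    refine integrableOn_of_hasDerivAt h1 (g := fun t => 2 * B * f t) (fun t ht => ?_)
      (hi.const_mul _)
    obtain ⟨-, -, a3⟩ := h t ht
    have e : f' t * f t + f t * f' t = 2 * f' t * f t := by ring
    rw [e, abs_mul, abs_mul, abs_two, abs_of_nonneg (h0 t)]
    have := h0 t
    gcongr
  have h3 : IntegrableOn (fun t => f t * f t) (Ioi 0) := by
    refine Integrable.mono' (hi.const_mul B) (hi.aestronglyMeasurable.mul hi.aestronglyMeasurable)
      ((ae_restrict_iff' measurableSet_Ioi).2 (Eventually.of_forall fun t ht => ?_))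
    obtain ⟨-, a2, -⟩ := h t ht
    rw [Real.norm_eq_abs, abs_mul, abs_of_nonneg (h0 t)]
    rw [abs_of_nonneg (h0 t)] at a2
    exact mul_le_mul_of_nonneg_right a2 (h0 t)
  have h4 := tendsto_zero_of_hasDerivAt_of_integrableOn_Ioi h1 h2 h3
  have h5 := h4.sqrt
  rw [Real.sqrt_zero] at h5
  exact h5.congr fun t => Real.sqrt_mul_self (h0 t)

end BoundedC1

variable {m γ κ : ℝ} {μ : ℝ → ProbabilityMeasure Phase} {a : Torus → ℝ} {b : ℝ → ℝ}

/-! ### Consequences of a nonpositive initial energy -/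

lemma kinetic_le_orderSq (hμ : IsMeasureValuedSolution m γ κ μ)
    (hm : 0 < m) (hγ : 0 < γ) (hκ : 0 < κ) (h0 : energy m κ μ 0 ≤ 0) {t : ℝ} (ht : 0 ≤ t) :
    kinetic μ t ≤ κ / m * orderSq μ t := by
  have h1 : energy m κ μ t ≤ 0 :=
    (antitoneOn_energy hμ hm hγ hκ self_mem_Ici (mem_Ici.2 ht) ht).trans h0
  unfold energy at h1
  have e : κ / m * orderSq μ t = 2 * (κ / (2 * m) * orderSq μ t) := by field_simp
  linarith

lemma kinetic_le (hμ : IsMeasureValuedSolution m γ κ μ)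
    (hm : 0 < m) (hγ : 0 < γ) (hκ : 0 < κ) (h0 : energy m κ μ 0 ≤ 0) {t : ℝ} (ht : 0 ≤ t) :
    kinetic μ t ≤ κ / m := by
  refine (kinetic_le_orderSq hμ hm hγ hκ h0 ht).trans ?_
  have := orderSq_le_one μ t
  have h : 0 < κ / m := by positivity
  nlinarith

/-- Zero energy at time 0 with positive order parameter forces K(0) > 0, and then dissipation is
strict; if K(0) = 0 the energy is negative from the start. -/
lemma energy_neg (hμ : IsMeasureValuedSolution m γ κ μ)
    (hm : 0 < m) (hγ : 0 < γ) (hκ : 0 < κ) (h0 : energy m κ μ 0 ≤ 0) (hR : 0 < orderSq μ 0)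
    {t : ℝ} (ht : 0 < t) : energy m κ μ t < 0 := by
  have hle := antitoneOn_energy hμ hm hγ hκ self_mem_Ici (mem_Ici.2 ht.le) ht.le
  rcases (kinetic_nonneg μ 0).eq_or_lt with hk | hk
  · have h1 : energy m κ μ 0 < 0 := by
      unfold energy
      rw [← hk]
      have : 0 < κ / (2 * m) * orderSq μ 0 := by positivity
      linarith
    linarith
  · have hc := continuous_kinetic hμ hm hγ hκ
    have h1 : ∫ s in (0 : ℝ)..t, -(γ / m) * kinetic μ s = energy m κ μ t - energy m κ μ 0 :=
      intervalIntegral.integral_eq_sub_of_hasDerivAt_of_le ht.le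
        (continuous_energy hμ hm hγ hκ).continuousOn
        (fun s hs => hasDerivAt_energy hμ hm hγ hκ hs.1)
        ((hc.const_mul _).intervalIntegrable _ _)
    have h2 : 0 < ∫ s in (0 : ℝ)..t, kinetic μ s :=
      intervalIntegral.integral_pos ht hc.continuousOn (fun s _ => kinetic_nonneg μ s)
        ⟨0, left_mem_Icc.2 ht.le, hk⟩
    rw [intervalIntegral.integral_const_mul] at h1
    have h3 : 0 < γ / m * ∫ s in (0 : ℝ)..t, kinetic μ s := by positivity
    linarith

lemma orderSq_lower_of_energy (hm : 0 < m) (hκ : 0 < κ) (t : ℝ) :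
    -(2 * m / κ) * energy m κ μ t ≤ orderSq μ t := by
  have e : -(2 * m / κ) * energy m κ μ t = orderSq μ t - m / κ * kinetic μ t := by
    unfold energy; field_simp; ring
  rw [e]
  have := kinetic_nonneg μ t
  have : 0 ≤ m / κ * kinetic μ t := by positivity
  linarith

/-- The order parameter stays bounded away from zero. -/
lemma exists_orderSq_lower (hμ : IsMeasureValuedSolution m γ κ μ)
    (hm : 0 < m) (hγ : 0 < γ) (hκ : 0 < κ) (h0 : energy m κ μ 0 ≤ 0) (hR : 0 < orderSq μ 0) :
    ∃ r, 0 < r ∧ ∀ t, 0 ≤ t → r ≤ orderSq μ t := by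
  have hpos : ∀ t, 0 ≤ t → 0 < orderSq μ t := fun t ht => by
    rcases ht.eq_or_lt with rfl | ht
    · exact hR
    · have h1 := energy_neg hμ hm hγ hκ h0 hR ht
      have h2 : 0 < 2 * m / κ := by positivity
      nlinarith [orderSq_lower_of_energy (μ := μ) hm hκ t]
  obtain ⟨t₀, ht₀, hmin⟩ := isCompact_Icc.exists_isMinOn (nonempty_Icc.2 zero_le_one)
    (continuous_orderSq hμ hm hγ hκ).continuousOn (s := Icc (0 : ℝ) 1)
  have h1 := energy_neg hμ hm hγ hκ h0 hR one_pos
  have h2 : 0 < 2 * m / κ := by positivity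
  -- Compactness covers [0, 1], where the energy may start at 0; afterwards the negative energy at
  -- time 1 bounds ρ from below by monotonicity.
  refine ⟨min (orderSq μ t₀) (-(2 * m / κ) * energy m κ μ 1), lt_min (hpos _ ht₀.1) (by nlinarith),
    fun t ht => ?_⟩
  rcases le_total t 1 with h | h
  · exact (min_le_left _ _).trans (hmin ⟨ht, h⟩)
  · refine (min_le_right _ _).trans ?_
    have h3 := antitoneOn_energy hμ hm hγ hκ (mem_Ici.2 zero_le_one) (mem_Ici.2 ht) h
    nlinarith [orderSq_lower_of_energy (μ := μ) hm hκ t]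

lemma continuous_virial (hμ : IsMeasureValuedSolution m γ κ μ)
    (hm : 0 < m) (hγ : 0 < γ) (hκ : 0 < κ) : Continuous (virial μ) := by
  have h1 := continuous_cosMean hμ hm hγ hκ
  have h2 := continuous_sinMean hμ hm hγ hκ
  have h3 := LinearGrowth.sin.continuous_moment hμ hm hγ hκ .torusSin
  have h4 := LinearGrowth.sin.continuous_moment hμ hm hγ hκ .torusCos
  unfold virial
  fun_prop

/-- The kinetic energy and the spread are integrable in time. -/
lemma integrableOn_kinetic_and_spread (hμ : IsMeasureValuedSolution m γ κ μ)
    (hm : 0 < m) (hγ : 0 < γ) (hκ : 0 < κ) (h0 : energy m κ μ 0 ≤ 0) :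
    IntegrableOn (kinetic μ) (Ioi 0) ∧ IntegrableOn (spread μ) (Ioi 0) := by
  -- One more than the coefficient of K in `virialRate_le`, so that the energy term leaves -K to
  -- spare.
  set A := 4 + γ ^ 2 / (2 * κ * m) + κ / (2 * m) with hA
  have hA0 : 0 < A := by positivity
  set L : ℝ → ℝ := fun t => virial μ t + A * (m / γ) * energy m κ μ t with hL
  set L' : ℝ → ℝ := fun t => virialRate m γ κ μ t + A * (m / γ) * (-(γ / m) * kinetic μ t) with hL'
  have hd : ∀ t, 0 < t → HasDerivAt L (L' t) t := fun t ht =>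
    (hasDerivAt_virial hμ hm hγ hκ ht).add ((hasDerivAt_energy hμ hm hγ hκ ht).const_mul _)
  have hle : ∀ t, L' t ≤ -(κ / (2 * m) * spread μ t + kinetic μ t) := fun t => by
    have h1 := virialRate_le (γ := γ) hμ hm hκ t
    have e : A * (m / γ) * (-(γ / m) * kinetic μ t) = -(A * kinetic μ t) := by field_simp
    simp only [hL', e]
    have e2 : A * kinetic μ t =
        (3 + γ ^ 2 / (2 * κ * m) + κ / (2 * m)) * kinetic μ t + kinetic μ t := by rw [hA]; ring
    linarith
  have hk2 : 0 < κ / (2 * m) := by positivity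
  have hnn : ∀ t, 0 ≤ κ / (2 * m) * spread μ t + kinetic μ t := fun t =>
    add_nonneg (mul_nonneg hk2.le (spread_nonneg μ t)) (kinetic_nonneg μ t)
  have hc : Continuous L := (continuous_virial hμ hm hγ hκ).add
    ((continuous_energy hμ hm hγ hκ).const_mul _)
  have hanti : AntitoneOn L (Ici 0) := by
    refine antitoneOn_of_deriv_nonpos (convex_Ici 0) hc.continuousOn
      (fun t ht => ?_) (fun t ht => ?_)
    · rw [interior_Ici] at ht
      exact (hd t ht).differentiableAt.differentiableWithinAt
    · rw [interior_Ici] at ht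
      rw [(hd t ht).deriv]
      linarith [hle t, hnn t]
  obtain ⟨l, hl⟩ := exists_tendsto_of_antitoneOn hanti
    (c := -(1 + κ / m) + A * (m / γ) * -(κ / (2 * m))) (fun t ht => by
      have h1 := (abs_le.1 (abs_virial_le hμ t)).1
      have h2 := kinetic_le hμ hm hγ hκ h0 ht
      have h3 : A * (m / γ) * -(κ / (2 * m)) ≤ A * (m / γ) * energy m κ μ t :=
        mul_le_mul_of_nonneg_left (neg_le_energy hm hκ μ t) (by positivity)
      simp only [hL]
      linarith)
  have hi : IntegrableOn L' (Ioi 0) := integrableOn_Ioi_deriv_of_nonpos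
    hc.continuousAt.continuousWithinAt (fun t ht => hd t ht)
    (fun t _ => by linarith [hle t, hnn t]) hl
  constructor
  · refine Integrable.mono' hi.neg
      (continuous_kinetic hμ hm hγ hκ).aestronglyMeasurable (Eventually.of_forall fun t => ?_)
    rw [Real.norm_eq_abs, abs_of_nonneg (kinetic_nonneg μ t)]
    have := mul_nonneg hk2.le (spread_nonneg μ t)
    simp only [Pi.neg_apply]
    linarith [hle t]
  · refine Integrable.mono' (hi.neg.const_mul (κ / (2 * m))⁻¹)
      (continuous_spread hμ hm hγ hκ).aestronglyMeasurable (Eventually.of_forall fun t => ?_)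
    rw [Real.norm_eq_abs, abs_of_nonneg (spread_nonneg μ t)]
    rw [le_inv_mul_iff₀ hk2]
    simp only [Pi.neg_apply]
    linarith [hle t, kinetic_nonneg μ t]

lemma boundedC1_moment_one (hμ : IsMeasureValuedSolution m γ κ μ)
    (hm : 0 < m) (hγ : 0 < γ) (hκ : 0 < κ) (h0 : energy m κ μ 0 ≤ 0) (ha : TorusSmooth a) :
    BoundedC1 (moment μ a (fun _ => 1)) := by
  obtain ⟨A, hA0, hA⟩ := ha.exists_bound
  obtain ⟨A', hA0', hA'⟩ := ha.torusDeriv.exists_bound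
  refine ⟨moment μ (torusDeriv a) (fun w => w), A + A' * (1 + κ / m), by positivity,
    fun t ht => ⟨hasDerivAt_moment_one hμ hm hγ hκ ha ht, ?_, ?_⟩⟩
  · have := norm_integral_le_of_norm_le_const (μ := (μ (max t 0) : Measure Phase))
      (f := fun z : Phase => a z.1 * 1) (C := A) (Eventually.of_forall fun z => by
        simpa using hA z.1)
    have h2 : |moment μ a (fun _ => 1) t| ≤ A := by simpa [moment] using this
    have : 0 ≤ A' * (1 + κ / m) := by positivity
    linarith
  · have hi : Integrable (fun z : Phase => A' * (1 + z.2 ^ 2)) (μ (max t 0) : Measure Phase) :=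
      ((integrable_const 1).add (integrable_sq hμ t)).const_mul A'
    have h1 := norm_integral_le_of_norm_le (f := fun z : Phase => torusDeriv a z.1 * z.2) hi
      (Eventually.of_forall fun z => by
        rw [norm_mul]
        refine mul_le_mul (hA' z.1) ?_ (norm_nonneg _) hA0'
        rw [Real.norm_eq_abs]
        nlinarith [sq_nonneg (1 - |z.2|), sq_abs z.2, abs_nonneg z.2])
    rw [integral_const_mul, integral_add (integrable_const _) (integrable_sq hμ t),
      ← moment_one_sq] at h1
    have h2 := kinetic_le hμ hm hγ hκ h0 ht.le
    have h3 : |moment μ (torusDeriv a) (fun w => w) t| ≤ A' * (1 + kinetic μ t) := by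
      simpa [moment, kinetic] using h1
    have h4 : A' * (1 + kinetic μ t) ≤ A' * (1 + κ / m) := by gcongr
    linarith

lemma abs_drift_le (hμ : IsMeasureValuedSolution m γ κ μ) (t : ℝ) :
    |drift μ t| ≤ (spread μ t + kinetic μ t) / 2 := by
  have h := drift_sq_le hμ t
  have h1 := spread_nonneg μ t
  have h2 := kinetic_nonneg μ t
  refine abs_le_of_sq_le_sq ?_ (by positivity)
  nlinarith [sq_nonneg (spread μ t - kinetic μ t)]

lemma tendsto_spread (hμ : IsMeasureValuedSolution m γ κ μ)
    (hm : 0 < m) (hγ : 0 < γ) (hκ : 0 < κ) (h0 : energy m κ μ 0 ≤ 0) :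
    Tendsto (spread μ) atTop (𝓝 0) := by
  refine BoundedC1.tendsto_zero ?_ (spread_nonneg μ)
    (integrableOn_kinetic_and_spread hμ hm hγ hκ h0).2
  have hC : BoundedC1 (cosMean μ) := boundedC1_moment_one hμ hm hγ hκ h0 .torusCos
  have hS : BoundedC1 (sinMean μ) := boundedC1_moment_one hμ hm hγ hκ h0 .torusSin
  have h1 := boundedC1_moment_one hμ hm hγ hκ h0 .torusSS
  have h2 := boundedC1_moment_one hμ hm hγ hκ h0 .torusSC
  have h3 := boundedC1_moment_one hμ hm hγ hκ h0 .torusCC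
  have h := (((hC.mul hC).mul h1).add (((hC.mul hS).mul h2).mul (.const (-2)))).add
    ((hS.mul hS).mul h3)
  refine (congrArg BoundedC1 ?_).mp h
  funext t
  rw [spread_eq hμ]
  ring

lemma tendsto_kinetic (hμ : IsMeasureValuedSolution m γ κ μ)
    (hm : 0 < m) (hγ : 0 < γ) (hκ : 0 < κ) (h0 : energy m κ μ 0 ≤ 0) :
    Tendsto (kinetic μ) atTop (𝓝 0) := by
  refine BoundedC1.tendsto_zero ⟨fun t => -(2 * γ / m) * kinetic μ t - 2 * κ / m * drift μ t,
    κ / m + (2 * γ / m) * (κ / m) + 2 * κ / m * ((1 + κ / m) / 2), by positivity,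
    fun t ht => ⟨hasDerivAt_kinetic hμ hm hγ hκ ht, ?_, ?_⟩⟩ (kinetic_nonneg μ)
    (integrableOn_kinetic_and_spread hμ hm hγ hκ h0).1
  · rw [abs_of_nonneg (kinetic_nonneg μ t)]
    have h1 := kinetic_le hμ hm hγ hκ h0 ht.le
    have : 0 ≤ (2 * γ / m) * (κ / m) + 2 * κ / m * ((1 + κ / m) / 2) := by positivity
    linarith
  · have h1 := kinetic_le hμ hm hγ hκ h0 ht.le
    have h2 := abs_drift_le hμ t
    have h3 := (spread_le_orderSq μ t).trans (orderSq_le_one μ t)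
    have h4 : |drift μ t| ≤ (1 + κ / m) / 2 := by linarith
    have e : |-(2 * γ / m) * kinetic μ t - 2 * κ / m * drift μ t| ≤
        2 * γ / m * kinetic μ t + 2 * κ / m * |drift μ t| := by
      refine (abs_sub _ _).trans (le_of_eq ?_)
      rw [abs_mul, abs_mul, abs_neg, abs_of_pos (by positivity : 0 < 2 * γ / m),
        abs_of_pos (by positivity : 0 < 2 * κ / m), abs_of_nonneg (kinetic_nonneg μ t)]
    have e1 : 2 * γ / m * kinetic μ t ≤ 2 * γ / m * (κ / m) := by gcongr
    have e2 : 2 * κ / m * |drift μ t| ≤ 2 * κ / m * ((1 + κ / m) / 2) := by gcongr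
    have : 0 ≤ κ / m := by positivity
    linarith

/-- The energy is nonincreasing and bounded below, and its kinetic part vanishes in the limit. -/
lemma tendsto_orderSq (hμ : IsMeasureValuedSolution m γ κ μ)
    (hm : 0 < m) (hγ : 0 < γ) (hκ : 0 < κ) (h0 : energy m κ μ 0 ≤ 0) :
    ∃ l, Tendsto (orderSq μ) atTop (𝓝 l) := by
  obtain ⟨e, he⟩ := exists_tendsto_of_antitoneOn (antitoneOn_energy hμ hm hγ hκ)
    fun t _ => neg_le_energy hm hκ μ t
  have h := (((tendsto_kinetic hμ hm hγ hκ h0).div_const 2).sub he).const_mul (2 * m / κ)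
  refine ⟨_, h.congr fun t => ?_⟩
  unfold energy
  field_simp
  ring

end KineticKuramoto

namespace KineticKuramoto

open scoped ContDiff

variable {m γ κ : ℝ} {μ : ℝ → ProbabilityMeasure Phase} {b : ℝ → ℝ}

/-! ### Convergence of the phase of the order parameter -/

/-- The part of the rotation speed of the order parameter that is not compensated by the twist. -/
noncomputable def rotationDefect (μ : ℝ → ProbabilityMeasure Phase) (t : ℝ) : ℝ :=
  orderSq μ t * moment μ (fun _ => 1) (fun w => w) t
    - 2 * moment μ (fun θ => normal μ t θ ^ 2) (fun w => w) t
    + (2 * moment μ (tangent μ t) (fun w => w) t * spread μ t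
      - 2 * drift μ t * twist μ t) / orderSq μ t

/-- Twice the twist is the imaginary part of z̄² times the mean of e^{2iθ}. Transport contributes
the mean of (r² - q²)ω, where r² - q² = ρ - 2q². The motion of z contributes -2WN/ρ - (α/ρ)(ρ - 2Q),
α being the mean of rω, and this contains the term -α that the twist is designed to produce. -/
lemma hasDerivAt_twist (hμ : IsMeasureValuedSolution m γ κ μ)
    (hm : 0 < m) (hγ : 0 < γ) (hκ : 0 < κ) {t : ℝ} (ht : 0 < t) (hρ : 0 < orderSq μ t) :
    HasDerivAt (twist μ)
      (rotationDefect μ t - moment μ (tangent μ t) (fun w => w) t) t := by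
  have hC := hasDerivAt_cosMean hμ hm hγ hκ ht
  have hS := hasDerivAt_sinMean hμ hm hγ hκ ht
  have h1 := hasDerivAt_moment_one hμ hm hγ hκ .torusSS ht
  have h2 := hasDerivAt_moment_one hμ hm hγ hκ .torusSC ht
  have h3 := hasDerivAt_moment_one hμ hm hγ hκ .torusCC ht
  rw [torusDeriv_torusSS, moment_const_mul_left] at h1
  rw [torusDeriv_torusSC, moment_add hμ .id .torusCC .torusSS] at h2
  rw [torusDeriv_torusCC, moment_const_mul_left] at h3
  have h := ((hC.mul hS).mul (h1.sub h3)).add (((hC.pow 2).sub (hS.pow 2)).mul h2)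
  have e : twist μ = fun t => cosMean μ t * sinMean μ t *
        (moment μ torusSS (fun _ => 1) t - moment μ torusCC (fun _ => 1) t)
        + (cosMean μ t ^ 2 - sinMean μ t ^ 2) * moment μ torusSC (fun _ => 1) t :=
    funext (twist_eq hμ)
  rw [rotationDefect, spread_eq hμ, drift_eq hμ, moment_normal_sq hμ .id, moment_tangent hμ .id]
  rw [e]
  refine h.congr_deriv ?_
  have r1 := moment_torusSS_add hμ (.const 1) t
  have r2 := moment_torusSS_add hμ .id t
  rw [moment_one_one] at r1
  rw [← r2]
  unfold orderSq at hρ ⊢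
  simp only [Pi.mul_apply, Pi.sub_apply, Pi.pow_apply]
  generalize moment μ torusSS (fun w => w) t = vss at *
  generalize moment μ torusCC (fun w => w) t = vcc at *
  generalize moment μ torusSC (fun w => w) t = vsc at *
  generalize moment μ torusSin (fun w => w) t = vs at *
  generalize moment μ torusCos (fun w => w) t = vc at *
  generalize moment μ torusSS (fun _ => 1) t = ss at *
  generalize moment μ torusCC (fun _ => 1) t = cc at *
  generalize moment μ torusSC (fun _ => 1) t = sc at *
  generalize cosMean μ t = C at *
  generalize sinMean μ t = S at *
  -- What remains is a rational identity between the moments, modulo sin² + cos² = 1, here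
  -- eliminated from the means.
  obtain rfl : ss = 1 - cc := by linarith
  have hne := hρ.ne'
  push_cast
  field_simp
  ring

/-- The integrating factor e^{γt/m} makes the product constant. Time 1 serves as base point because
the derivative is only available at positive times. -/
lemma meanFrequency_eq (hμ : IsMeasureValuedSolution m γ κ μ)
    (hm : 0 < m) (hγ : 0 < γ) (hκ : 0 < κ) {t : ℝ} (ht : 1 ≤ t) :
    moment μ (fun _ => 1) (fun w => w) t =
      moment μ (fun _ => 1) (fun w => w) 1 * Real.exp (γ / m) * Real.exp (-(γ / m) * t) := by
  have hd : ∀ s, 0 < s → HasDerivAt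
      (fun s => moment μ (fun _ => 1) (fun w => w) s * Real.exp (γ / m * s)) 0 s := fun s hs => by
    have h2 : HasDerivAt (fun s => Real.exp (γ / m * s)) (Real.exp (γ / m * s) * (γ / m)) s := by
      simpa using ((hasDerivAt_id s).const_mul (γ / m)).exp
    refine ((hasDerivAt_meanFrequency hμ hm hγ hκ hs).mul h2).congr_deriv ?_
    ring
  have h := constant_of_has_deriv_right_zero (a := 1) (b := t)
    (fun s hs => (hd s (by linarith [hs.1])).continuousAt.continuousWithinAt)
    (fun s hs => (hd s (by linarith [hs.1])).hasDerivWithinAt) t ⟨ht, le_rfl⟩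
  simp only [mul_one] at h
  rw [← h, mul_assoc, ← Real.exp_add]
  simp

lemma integrableOn_meanFrequency (hμ : IsMeasureValuedSolution m γ κ μ)
    (hm : 0 < m) (hγ : 0 < γ) (hκ : 0 < κ) :
    IntegrableOn (moment μ (fun _ => 1) (fun w => w)) (Ioi 1) := by
  have h1 : IntegrableOn (fun t : ℝ => moment μ (fun _ => 1) (fun w => w) 1 * Real.exp (γ / m) *
      Real.exp (-(γ / m) * t)) (Ioi 1) :=
    (integrableOn_exp_mul_Ioi (neg_lt_zero.2 (by positivity)) 1).const_mul _
  exact h1.congr_fun (fun t ht => (meanFrequency_eq hμ hm hγ hκ (le_of_lt ht)).symm)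
    measurableSet_Ioi

lemma tangent_sq_le_one (t : ℝ) (θ : Torus) : tangent μ t θ ^ 2 ≤ 1 :=
  (tangent_sq_le_orderSq t θ).trans (orderSq_le_one μ t)

lemma abs_twist_le_one (μ : ℝ → ProbabilityMeasure Phase) (t : ℝ) : |twist μ t| ≤ 1 :=
  (sq_le_one_iff_abs_le_one _).1
    ((twist_sq_le μ t).trans ((spread_le_orderSq μ t).trans (orderSq_le_one μ t)))

lemma abs_rotationDefect_le (hμ : IsMeasureValuedSolution m γ κ μ)
    (hm : 0 < m) (hγ : 0 < γ) (hκ : 0 < κ) (h0 : energy m κ μ 0 ≤ 0) {r : ℝ} (hr : 0 < r)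
    {t : ℝ} (ht : 0 < t) (hrt : r ≤ orderSq μ t) :
    |rotationDefect μ t| ≤ |moment μ (fun _ => 1) (fun w => w) t|
      + (1 + (3 + 2 * (κ / m)) / r) * (spread μ t + kinetic μ t) := by
  have hT := abs_moment_normal_sq_le hμ t
  have hW := abs_drift_le hμ t
  have hN := abs_twist_le_one μ t
  have hα := sq_moment_le_kinetic hμ (.tangent t) (tangent_sq_le_one (μ := μ) t) .id
    (fun _ => le_rfl) t
  have hK := kinetic_le hμ hm hγ hκ h0 ht.le
  have hρ := orderSq_le_one μ t
  have hQ0 := spread_nonneg μ t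
  have hK0 := kinetic_nonneg μ t
  unfold rotationDefect
  set P := moment μ (fun _ => 1) (fun w => w) t
  set T := moment μ (fun θ => normal μ t θ ^ 2) (fun w => w) t
  set α := moment μ (tangent μ t) (fun w => w) t
  set Q := spread μ t
  set K := kinetic μ t
  set W := drift μ t
  set N := twist μ t
  set ρ := orderSq μ t
  have hρ0 : 0 < ρ := hr.trans_le hrt
  have hκm : 0 < κ / m := by positivity
  -- A crude bound suffices here, since α is multiplied by the integrable Q.
  have hα' : |α| ≤ 1 + κ / m := by
    refine abs_le_of_sq_le_sq ?_ (by positivity)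
    nlinarith
  have b1 : |ρ * P| ≤ |P| := by
    rw [abs_mul, abs_of_pos hρ0]
    exact mul_le_of_le_one_left (abs_nonneg _) hρ
  have b2 : |2 * T| ≤ Q + K := by rw [abs_mul, abs_two]; linarith
  have b3 : |2 * α * Q - 2 * W * N| ≤ (3 + 2 * (κ / m)) * (Q + K) := by
    have c1 : |2 * α * Q| ≤ 2 * (1 + κ / m) * Q := by
      rw [abs_mul, abs_mul, abs_two, abs_of_nonneg hQ0]; gcongr
    have c2 : |2 * W * N| ≤ Q + K := by
      rw [abs_mul, abs_mul, abs_two]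
      nlinarith [abs_nonneg W, abs_nonneg N]
    refine (abs_sub _ _).trans ?_
    nlinarith [mul_nonneg hκm.le hK0]
  have b4 : |(2 * α * Q - 2 * W * N) / ρ| ≤ (3 + 2 * (κ / m)) * (Q + K) / r := by
    rw [abs_div, abs_of_pos hρ0]
    gcongr
  calc |ρ * P - 2 * T + (2 * α * Q - 2 * W * N) / ρ|
      ≤ |ρ * P| + |2 * T| + |(2 * α * Q - 2 * W * N) / ρ| :=
        (abs_add_le _ _).trans (add_le_add_left (abs_sub _ _) _)
    _ ≤ |P| + (Q + K) + (3 + 2 * (κ / m)) * (Q + K) / r := by gcongr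
    _ = _ := by ring

lemma abs_cosMean_le_one (μ : ℝ → ProbabilityMeasure Phase) (t : ℝ) : |cosMean μ t| ≤ 1 := by
  have h := orderSq_le_one μ t
  unfold orderSq at h
  exact (sq_le_one_iff_abs_le_one _).1 (by nlinarith [sq_nonneg (sinMean μ t)])

lemma abs_sinMean_le_one (μ : ℝ → ProbabilityMeasure Phase) (t : ℝ) : |sinMean μ t| ≤ 1 := by
  have h := orderSq_le_one μ t
  unfold orderSq at h
  exact (sq_le_one_iff_abs_le_one _).1 (by nlinarith [sq_nonneg (cosMean μ t)])

/-- Real part of (ρ + iN)z. Since ρz' = (ρ'/2 + iα)z with α the mean of rω, the non-integrable iαz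
cancels against the -α in N'; there remain (-3W + iD)z and iNz', where D is `rotationDefect`. -/
lemma hasDerivAt_twisted_cosMean (hμ : IsMeasureValuedSolution m γ κ μ)
    (hm : 0 < m) (hγ : 0 < γ) (hκ : 0 < κ) {t : ℝ} (ht : 0 < t) (hρ : 0 < orderSq μ t) :
    HasDerivAt (fun t => orderSq μ t * cosMean μ t - twist μ t * sinMean μ t)
      (-3 * drift μ t * cosMean μ t - rotationDefect μ t * sinMean μ t
        - twist μ t * moment μ torusCos (fun w => w) t) t := by
  refine (((hasDerivAt_orderSq hμ hm hγ hκ ht).mul (hasDerivAt_cosMean hμ hm hγ hκ ht)).sub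
    ((hasDerivAt_twist hμ hm hγ hκ ht hρ).mul (hasDerivAt_sinMean hμ hm hγ hκ ht))).congr_deriv ?_
  rw [moment_tangent hμ .id, drift_eq hμ]
  unfold orderSq
  ring

lemma hasDerivAt_twisted_sinMean (hμ : IsMeasureValuedSolution m γ κ μ)
    (hm : 0 < m) (hγ : 0 < γ) (hκ : 0 < κ) {t : ℝ} (ht : 0 < t) (hρ : 0 < orderSq μ t) :
    HasDerivAt (fun t => orderSq μ t * sinMean μ t + twist μ t * cosMean μ t)
      (-3 * drift μ t * sinMean μ t + rotationDefect μ t * cosMean μ t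
        - twist μ t * moment μ torusSin (fun w => w) t) t := by
  refine (((hasDerivAt_orderSq hμ hm hγ hκ ht).mul (hasDerivAt_sinMean hμ hm hγ hκ ht)).add
    ((hasDerivAt_twist hμ hm hγ hκ ht hρ).mul (hasDerivAt_cosMean hμ hm hγ hκ ht))).congr_deriv ?_
  rw [moment_tangent hμ .id, drift_eq hμ]
  unfold orderSq
  ring

/-- Handles Nz': each component of z' is at most √K and |N| ≤ √Q, so the product is integrable
though the second factor alone might not be. -/
lemma abs_twist_mul_le (hv : ∀ t, b t ^ 2 ≤ kinetic μ t) (t : ℝ) :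
    |twist μ t * b t| ≤ (spread μ t + kinetic μ t) / 2 := by
  have h1 := twist_sq_le μ t
  have h2 := hv t
  rw [abs_le]
  constructor <;> nlinarith [sq_nonneg (twist μ t + b t), sq_nonneg (twist μ t - b t)]

lemma tendsto_twist (hμ : IsMeasureValuedSolution m γ κ μ)
    (hm : 0 < m) (hγ : 0 < γ) (hκ : 0 < κ) (h0 : energy m κ μ 0 ≤ 0) :
    Tendsto (twist μ) atTop (𝓝 0) := by
  have h1 := (tendsto_spread hμ hm hγ hκ h0).sqrt
  rw [Real.sqrt_zero] at h1
  exact squeeze_zero_norm (fun t => Real.abs_le_sqrt (twist_sq_le μ t)) h1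

/-- The complex order parameter converges to a nonzero limit. -/
lemma exists_tendsto_cosMean_sinMean (hμ : IsMeasureValuedSolution m γ κ μ)
    (hm : 0 < m) (hγ : 0 < γ) (hκ : 0 < κ) (h0 : energy m κ μ 0 ≤ 0) (hR : 0 < orderSq μ 0) :
    ∃ c s, 0 < c ^ 2 + s ^ 2 ∧ Tendsto (cosMean μ) atTop (𝓝 c) ∧
      Tendsto (sinMean μ) atTop (𝓝 s) := by
  obtain ⟨r, hr, hrt⟩ := exists_orderSq_lower hμ hm hγ hκ h0 hR
  obtain ⟨l, hl⟩ := tendsto_orderSq hμ hm hγ hκ h0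
  have hl0 : 0 < l := hr.trans_le
    (ge_of_tendsto hl ((eventually_ge_atTop 0).mono fun t ht => hrt t ht))
  obtain ⟨iK, iQ⟩ := integrableOn_kinetic_and_spread hμ hm hγ hκ h0
  have hsub : Ioi (1 : ℝ) ⊆ Ioi 0 := Ioi_subset_Ioi zero_le_one
  set D := 1 + (3 + 2 * (κ / m)) / r
  set g : ℝ → ℝ := fun t => |moment μ (fun _ => 1) (fun w => w) t|
      + (D + 2) * (spread μ t + kinetic μ t) with hg
  have ig : IntegrableOn g (Ioi 1) := (integrableOn_meanFrequency hμ hm hγ hκ).abs.add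
    (((iQ.mono_set hsub).add (iK.mono_set hsub)).const_mul _)
  -- One estimate for both components: (x, y) is (C, -S) for the real part and (S, C) for the
  -- imaginary part. The extra 2 in D + 2 is 3/2 from the drift and 1/2 from v.
  have est : ∀ t, 1 < t → ∀ x y v : ℝ, |x| ≤ 1 → |y| ≤ 1 → |v| ≤ (spread μ t + kinetic μ t) / 2 →
      |-3 * drift μ t * x + rotationDefect μ t * y - v| ≤ g t := fun t ht x y v hx hy hv => by
    have ht0 : 0 < t := by linarith
    have h1 := abs_rotationDefect_le hμ hm hγ hκ h0 hr ht0 (hrt t ht0.le)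
    have h2 := abs_drift_le hμ t
    have e1 : |-3 * drift μ t * x| ≤ 3 * |drift μ t| := by
      rw [abs_mul, abs_mul, abs_neg, abs_of_pos (by norm_num : (0 : ℝ) < 3)]
      exact mul_le_of_le_one_right (by positivity) hx
    have e2 : |rotationDefect μ t * y| ≤ |rotationDefect μ t| := by
      rw [abs_mul]
      exact mul_le_of_le_one_right (abs_nonneg _) hy
    have e3 := (abs_sub (-3 * drift μ t * x + rotationDefect μ t * y) v).trans
      (add_le_add_left (abs_add_le _ _) _)
    simp only [hg]
    linarith
  have v1 := fun t => sq_moment_le_kinetic hμ .torusSin torusSin_sq_le_one .id (fun w => le_rfl) t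
  have v2 := fun t => sq_moment_le_kinetic hμ .torusCos torusCos_sq_le_one .id (fun w => le_rfl) t
  obtain ⟨x, hx⟩ := exists_tendsto_of_hasDerivAt (a := 1) (g := g)
    (fun t ht => hasDerivAt_twisted_cosMean hμ hm hγ hκ (zero_lt_one.trans ht)
      (hr.trans_le (hrt t (zero_lt_one.trans ht).le)))
    (fun t ht => by
      have := est t ht (cosMean μ t) (-sinMean μ t) _ (abs_cosMean_le_one μ t)
        (by rw [abs_neg]; exact abs_sinMean_le_one μ t) (abs_twist_mul_le v2 t)
      rwa [mul_neg, ← sub_eq_add_neg] at this) ig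
  obtain ⟨y, hy⟩ := exists_tendsto_of_hasDerivAt (a := 1) (g := g)
    (fun t ht => hasDerivAt_twisted_sinMean hμ hm hγ hκ (zero_lt_one.trans ht)
      (hr.trans_le (hrt t (zero_lt_one.trans ht).le)))
    (fun t ht => est t ht (sinMean μ t) (cosMean μ t) _ (abs_sinMean_le_one μ t)
        (abs_cosMean_le_one μ t) (abs_twist_mul_le v1 t)) ig
  have hN := tendsto_twist hμ hm hγ hκ h0
  have hNS : Tendsto (fun t => twist μ t * sinMean μ t) atTop (𝓝 0) :=
    squeeze_zero_norm (fun t => by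
      rw [norm_mul]
      exact mul_le_of_le_one_right (norm_nonneg _) (abs_sinMean_le_one μ t))
      (tendsto_zero_iff_norm_tendsto_zero.1 hN)
  have hNC : Tendsto (fun t => twist μ t * cosMean μ t) atTop (𝓝 0) :=
    squeeze_zero_norm (fun t => by
      rw [norm_mul]
      exact mul_le_of_le_one_right (norm_nonneg _) (abs_cosMean_le_one μ t))
      (tendsto_zero_iff_norm_tendsto_zero.1 hN)
  have hpos : ∀ᶠ t in atTop, orderSq μ t ≠ 0 :=
    (eventually_ge_atTop 0).mono fun t ht => (hr.trans_le (hrt t ht)).ne'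
  -- Undoing the twist: ρC is the convergent quantity plus NS, which tends to 0, and ρ tends to l >
  -- 0.
  have hC : Tendsto (cosMean μ) atTop (𝓝 ((x + 0) / l)) := by
    refine ((hx.add hNS).div hl hl0.ne').congr' ?_
    filter_upwards [hpos] with t ht
    simp only [Pi.div_apply]
    field_simp
    ring
  have hS : Tendsto (sinMean μ) atTop (𝓝 ((y - 0) / l)) := by
    refine ((hy.sub hNC).div hl hl0.ne').congr' ?_
    filter_upwards [hpos] with t ht
    simp only [Pi.div_apply]
    field_simp
    ring
  refine ⟨_, _, ?_, hC, hS⟩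
  have := tendsto_nhds_unique hl ((hC.pow 2).add (hS.pow 2))
  rw [← this]
  exact hl0

end KineticKuramoto

namespace KineticKuramoto

open scoped ContDiff

variable {m γ κ : ℝ} {μ : ℝ → ProbabilityMeasure Phase}

/-! ### Solutions with vanishing initial order parameter -/

lemma abs_drift_le_orderSq (hμ : IsMeasureValuedSolution m γ κ μ)
    (hm : 0 < m) (hγ : 0 < γ) (hκ : 0 < κ) (h0 : energy m κ μ 0 ≤ 0) {t : ℝ} (ht : 0 ≤ t) :
    |drift μ t| ≤ (1 + κ / m) * orderSq μ t := by
  have h1 := abs_drift_le hμ t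
  have h2 := kinetic_le_orderSq hμ hm hγ hκ h0 ht
  have h3 := spread_le_orderSq μ t
  have h4 := orderSq_nonneg μ t
  have h5 : 0 ≤ κ / m * orderSq μ t := by positivity
  linarith

/-- Grönwall: nonpositive energy bounds K by (κ/m)ρ, so the drift is at most a multiple of ρ and
ρe^{-ct} is nonincreasing. -/
lemma orderSq_eq_zero (hμ : IsMeasureValuedSolution m γ κ μ)
    (hm : 0 < m) (hγ : 0 < γ) (hκ : 0 < κ) (h0 : energy m κ μ 0 ≤ 0) (hR : orderSq μ 0 = 0)
    {t : ℝ} (ht : 0 ≤ t) : orderSq μ t = 0 := by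
  set c := 2 * (1 + κ / m)
  set f : ℝ → ℝ := fun t => orderSq μ t * Real.exp (-c * t) with hf
  have hd : ∀ t, 0 < t → HasDerivAt f
      (-2 * drift μ t * Real.exp (-c * t) + orderSq μ t * (Real.exp (-c * t) * -c)) t :=
    fun t ht => by
      have h2 : HasDerivAt (fun s => Real.exp (-c * s)) (Real.exp (-c * t) * -c) t := by
        simpa using ((hasDerivAt_id t).const_mul (-c)).exp
      exact (hasDerivAt_orderSq hμ hm hγ hκ ht).mul h2
  have hc : Continuous f := (continuous_orderSq hμ hm hγ hκ).mul (by fun_prop)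
  have hanti : AntitoneOn f (Ici 0) := by
    refine antitoneOn_of_deriv_nonpos (convex_Ici 0) hc.continuousOn
      (fun t ht => ?_) (fun t ht => ?_)
    · rw [interior_Ici] at ht
      exact (hd t ht).differentiableAt.differentiableWithinAt
    · rw [interior_Ici] at ht
      rw [(hd t ht).deriv]
      have h1 := (abs_le.1 (abs_drift_le_orderSq hμ hm hγ hκ h0 (le_of_lt ht))).1
      have h2 := Real.exp_pos (-c * t)
      have h3 : -2 * drift μ t - c * orderSq μ t ≤ 0 := by simp only [c]; linarith
      nlinarith
  have h1 := hanti self_mem_Ici (mem_Ici.2 ht) ht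
  simp only [hf, hR, zero_mul] at h1
  have h2 := Real.exp_pos (-c * t)
  exact le_antisymm (by nlinarith) (orderSq_nonneg μ t)

lemma kinetic_eq_zero (hμ : IsMeasureValuedSolution m γ κ μ)
    (hm : 0 < m) (hγ : 0 < γ) (hκ : 0 < κ) (h0 : energy m κ μ 0 ≤ 0) (hR : orderSq μ 0 = 0)
    (t : ℝ) : kinetic μ t = 0 := by
  have h : ∀ t, 0 ≤ t → kinetic μ t = 0 := fun t ht => by
    have h1 := kinetic_le_orderSq hμ hm hγ hκ h0 ht
    rw [orderSq_eq_zero hμ hm hγ hκ h0 hR ht, mul_zero] at h1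
    exact le_antisymm h1 (kinetic_nonneg μ t)
  rcases le_total t 0 with ht | ht
  · exact (moment_of_nonpos μ _ _ ht).trans (h 0 le_rfl)
  · exact h t ht

lemma ae_eq_zero_of_kinetic_eq_zero (hμ : IsMeasureValuedSolution m γ κ μ) {t : ℝ}
    (h : kinetic μ t = 0) : ∀ᵐ z ∂(μ (max t 0) : Measure Phase), z.2 = 0 := by
  rw [kinetic, moment_one_sq] at h
  have h' := (integral_eq_zero_iff_of_nonneg (f := fun z : Phase => z.2 ^ 2)
    (fun z => sq_nonneg z.2) (integrable_sq hμ t)).1 h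
  filter_upwards [h'] with z hz
  simpa using hz

/-- Phase moments change only through the mean of a'(θ)ω, and ω = 0 almost everywhere. -/
lemma moment_one_eq_of_kinetic_eq_zero (hμ : IsMeasureValuedSolution m γ κ μ)
    (hm : 0 < m) (hγ : 0 < γ) (hκ : 0 < κ) (h : ∀ t, kinetic μ t = 0) {a : Torus → ℝ}
    (ha : TorusSmooth a) {t : ℝ} (ht : 0 ≤ t) :
    moment μ a (fun _ => 1) t = moment μ a (fun _ => 1) 0 := by
  obtain ⟨B, hB⟩ := (LinearGrowth.const 1).admissible ha
  have h1 := (hμ.moment_sub_moment hm hγ hκ hB ht).2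
  have h2 : ∀ s, generatorIntegral m γ κ (μ (max s 0) : Measure Phase) a (fun _ => 1) = 0 :=
    fun s => by
      have : moment μ (torusDeriv a) (fun w => w) s = 0 := by
        refine integral_eq_zero_of_ae ?_
        filter_upwards [ae_eq_zero_of_kinetic_eq_zero hμ (h s)] with z hz
        simp [hz]
      rw [hB.generatorIntegral_eq_moment hμ]
      simp [this]
  simp only [h2, intervalIntegral.integral_zero] at h1
  linarith

/-! ### Determination of phase marginals by trigonometric moments -/

lemma contDiff_fourier_coe (n : ℤ) :
    ContDiff ℝ ∞ fun x : ℝ => (fourier n (x : Torus) : ℂ) := by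
  simp_rw [fourier_coe_apply]
  refine ContDiff.cexp ?_
  refine ContDiff.div_const (ContDiff.mul contDiff_const ?_) _
  exact Complex.ofRealCLM.contDiff

lemma torusSmooth_fourier_re (n : ℤ) : TorusSmooth fun θ => (fourier n θ : ℂ).re :=
  Complex.reCLM.contDiff.comp (contDiff_fourier_coe n)

lemma torusSmooth_fourier_im (n : ℤ) : TorusSmooth fun θ => (fourier n θ : ℂ).im :=
  Complex.imCLM.contDiff.comp (contDiff_fourier_coe n)

lemma integrable_continuousMap (ν : Measure Phase) [IsFiniteMeasure ν] (f : C(Torus, ℂ)) :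
    Integrable (fun z : Phase => f z.1) ν :=
  Integrable.of_bound (f.continuous.comp continuous_fst).aestronglyMeasurable ‖f‖
    (Eventually.of_forall fun z => f.norm_coe_le_norm z.1)

/-- Trigonometric moments determine the integrals of continuous functions of the phase. -/
lemma integral_continuousMap_eq {ν₁ ν₂ : Measure Phase} [IsProbabilityMeasure ν₁]
    [IsProbabilityMeasure ν₂]
    (h : ∀ a : Torus → ℝ, TorusSmooth a → ∫ z, a z.1 ∂ν₁ = ∫ z, a z.1 ∂ν₂) (f : C(Torus, ℂ)) :
    ∫ z, f z.1 ∂ν₁ = ∫ z, f z.1 ∂ν₂ := by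
  have hspan : ∀ p ∈ Submodule.span ℂ (range (@fourier (2 * Real.pi))),
      ∫ z : Phase, p z.1 ∂ν₁ = ∫ z : Phase, p z.1 ∂ν₂ := fun p hp => by
    induction hp using Submodule.span_induction with
    | mem p hp =>
      obtain ⟨n, rfl⟩ := hp
      have i1 := integrable_continuousMap ν₁ (fourier n)
      have i2 := integrable_continuousMap ν₂ (fourier n)
      rw [← integral_re_add_im i1, ← integral_re_add_im i2]
      have e1 := h _ (torusSmooth_fourier_re n)
      have e2 := h _ (torusSmooth_fourier_im n)
      simp only [RCLike.re_to_complex, RCLike.im_to_complex]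
      rw [e1, e2]
    | zero => simp
    | add p q _ _ hp hq =>
      simp only [ContinuousMap.add_apply]
      rw [integral_add (integrable_continuousMap ν₁ p) (integrable_continuousMap ν₁ q),
        integral_add (integrable_continuousMap ν₂ p) (integrable_continuousMap ν₂ q), hp, hq]
    | smul c p _ hp =>
      simp only [ContinuousMap.smul_apply, integral_smul, hp]
  have hf : f ∈ closure (Submodule.span ℂ (range (@fourier (2 * Real.pi))) : Set C(Torus, ℂ)) := by
    rw [← Submodule.topologicalClosure_coe, span_fourier_closure_eq_top]
    trivial
  refine eq_of_forall_dist_le fun ε hε => ?_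
  obtain ⟨p, hp, hpf⟩ := Metric.mem_closure_iff.1 hf (ε / 2) (by positivity)
  have key : ∀ (ν : Measure Phase) [IsProbabilityMeasure ν],
      dist (∫ z : Phase, f z.1 ∂ν) (∫ z : Phase, p z.1 ∂ν) ≤ ε / 2 := fun ν _ => by
    rw [dist_eq_norm, ← integral_sub (integrable_continuousMap ν f) (integrable_continuousMap ν p)]
    have := norm_integral_le_of_norm_le_const (μ := ν) (f := fun z : Phase => f z.1 - p z.1)
      (C := ε / 2) (Eventually.of_forall fun z => by
        rw [← dist_eq_norm]; exact (ContinuousMap.dist_apply_le_dist z.1).trans hpf.le)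
    simpa using this
  have h1 := key ν₁
  have h2 := key ν₂
  rw [hspan p hp] at h1
  rw [dist_comm] at h2
  calc dist (∫ z : Phase, f z.1 ∂ν₁) (∫ z : Phase, f z.1 ∂ν₂) ≤ _ := dist_triangle _ _ _
    _ ≤ ε / 2 + ε / 2 := add_le_add h1 h2
    _ = ε := by ring

/-- A solution with nonpositive energy and vanishing order parameter is stationary. -/
lemma eq_initial_of_orderSq_eq_zero (hμ : IsMeasureValuedSolution m γ κ μ)
    (hm : 0 < m) (hγ : 0 < γ) (hκ : 0 < κ) (h0 : energy m κ μ 0 ≤ 0) (hR : orderSq μ 0 = 0)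
    {t : ℝ} (ht : 0 ≤ t) : μ t = μ 0 := by
  have hk := kinetic_eq_zero hμ hm hγ hκ h0 hR
  have ae1 := ae_eq_zero_of_kinetic_eq_zero hμ (hk t)
  have ae2 := ae_eq_zero_of_kinetic_eq_zero hμ (hk 0)
  rw [max_eq_left ht] at ae1
  rw [max_self] at ae2
  have hsm : ∀ a : Torus → ℝ, TorusSmooth a →
      ∫ z, a z.1 ∂(μ t : Measure Phase) = ∫ z, a z.1 ∂(μ 0 : Measure Phase) := fun a ha => by
    simpa [moment, max_eq_left ht] using moment_one_eq_of_kinetic_eq_zero hμ hm hγ hκ hk ha ht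
  suffices hmeas : (μ t : Measure Phase) = (μ 0 : Measure Phase) from Subtype.ext hmeas
  refine ext_of_forall_integral_eq_of_IsFiniteMeasure fun f => ?_
  -- Both measures live on ω = 0, so only the restriction of f to this circle matters; it is viewed
  -- as complex-valued to be approximated by Fourier monomials.
  have hfc : Continuous fun θ : Torus => ((f (θ, 0) : ℝ) : ℂ) :=
    Complex.continuous_ofReal.comp (f.continuous.comp (by fun_prop))
  have h := integral_continuousMap_eq hsm ⟨_, hfc⟩
  simp only [ContinuousMap.coe_mk, integral_complex_ofReal] at h
  have h' : ∫ z : Phase, f (z.1, 0) ∂(μ t : Measure Phase) =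
      ∫ z : Phase, f (z.1, 0) ∂(μ 0 : Measure Phase) := by exact_mod_cast h
  calc ∫ z, f z ∂(μ t : Measure Phase) = ∫ z : Phase, f (z.1, 0) ∂(μ t : Measure Phase) := by
        refine integral_congr_ae ?_
        filter_upwards [ae1] with z hz
        rw [← hz]
    _ = ∫ z : Phase, f (z.1, 0) ∂(μ 0 : Measure Phase) := h'
    _ = ∫ z, f z ∂(μ 0 : Measure Phase) := by
        refine integral_congr_ae ?_
        filter_upwards [ae2] with z hz
        rw [← hz]

end KineticKuramoto

namespace KineticKuramoto

/-! ### Transport to a bi-polar state -/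

lemma torusCos_sub_pi (α : Torus) : torusCos (α - ((Real.pi : ℝ) : Torus)) = -torusCos α := by
  rw [torusCos_sub]
  simp

/-- Half-angle formula (1 - cos x)/2 = sin²(x/2), and Jordan's inequality sin y ≥ 2y/π on [0, π/2].
-/
lemma norm_sq_le_one_sub_torusCos (α : Torus) :
    ‖α‖ ^ 2 ≤ Real.pi ^ 2 * ((1 - torusCos α) / 2) := by
  obtain ⟨x, hx, rfl⟩ : ∃ x : ℝ, |x| ≤ Real.pi ∧ (x : Torus) = α := by
    have h := AddCircle.coe_image_Ico_eq (2 * Real.pi) (-Real.pi)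
    obtain ⟨x, hx, rfl⟩ := h.symm ▸ mem_univ α
    exact ⟨x, abs_le.2 ⟨hx.1, by linarith [hx.2]⟩, rfl⟩
  have hn : ‖(x : Torus)‖ = |x| := by
    refine (AddCircle.norm_coe_eq_abs_iff (2 * Real.pi) Real.two_pi_pos.ne').2 ?_
    rw [abs_of_pos Real.two_pi_pos]
    linarith
  rw [hn, torusCos_coe]
  have h1 : 2 / Real.pi * (|x| / 2) ≤ Real.sin (|x| / 2) :=
    Real.mul_le_sin (by positivity) (by linarith)
  have h2 : (1 - Real.cos x) / 2 = Real.sin (|x| / 2) ^ 2 := by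
    have : Real.cos x = Real.cos (2 * (|x| / 2)) := by
      rw [mul_div_cancel₀ _ (two_ne_zero), Real.cos_abs]
    rw [this, Real.cos_two_mul', Real.cos_sq']
    ring
  rw [h2]
  have h3 : |x| ≤ Real.pi * Real.sin (|x| / 2) := by
    have := mul_le_mul_of_nonneg_left h1 Real.pi_pos.le
    calc |x| = Real.pi * (2 / Real.pi * (|x| / 2)) := by field_simp
      _ ≤ _ := this
  calc |x| ^ 2 ≤ (Real.pi * Real.sin (|x| / 2)) ^ 2 := by gcongr
    _ = _ := by ring

lemma torusCos_le_one (α : Torus) : torusCos α ≤ 1 := (abs_le.1 (abs_torusCos_le_one α)).2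

lemma neg_one_le_torusCos (α : Torus) : -1 ≤ torusCos α := (abs_le.1 (abs_torusCos_le_one α)).1

/-- Mixing weights that move the mean `A` to `c` at minimal cost. -/
lemma exists_mixing_weights {A c : ℝ} (hA0 : 0 ≤ A) (hc0 : 0 ≤ c) (hc1 : c ≤ 1) :
    ∃ α β : ℝ, 0 ≤ α ∧ α ≤ 1 ∧ 0 ≤ β ∧ β ≤ 1 ∧ α * A + β * (1 - A) = c ∧
      (1 - α) * A + β * (1 - A) ≤ |A - c| := by
  rcases le_or_gt c A with h | h
  · rcases hA0.eq_or_lt with h0 | h0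
    · refine ⟨0, 0, le_rfl, zero_le_one, le_rfl, zero_le_one, by linarith, ?_⟩
      rw [← h0]
      simp
    · refine ⟨c / A, 0, by positivity, (div_le_one h0).2 h, le_rfl, zero_le_one, ?_, ?_⟩
      · field_simp; ring
      · rw [abs_of_nonneg (by linarith)]
        have : c / A * A = c := by field_simp
        linarith
  · have h1 : 0 < 1 - A := by linarith
    refine ⟨1, (c - A) / (1 - A), zero_le_one, le_rfl, div_nonneg (by linarith) h1.le,
      (div_le_one h1).2 (by linarith), ?_, ?_⟩
    · field_simp; ring
    · rw [abs_of_neg (by linarith)]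
      have : (c - A) / (1 - A) * (1 - A) = c - A := by field_simp
      linarith

/-- The squared distance to the point `(φ, 0)`. -/
noncomputable def distSqTo (φ : Torus) (z : Phase) : ℝ := dist z.1 φ ^ 2 + z.2 ^ 2

lemma continuous_distSqTo (φ : Torus) : Continuous (distSqTo φ) := by
  unfold distSqTo
  fun_prop

lemma distSqTo_nonneg (φ : Torus) (z : Phase) : 0 ≤ distSqTo φ z := by
  unfold distSqTo
  positivity

lemma dist_sq_le_pi_sq (θ φ : Torus) : dist θ φ ^ 2 ≤ Real.pi ^ 2 := by
  rw [dist_eq_norm]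
  have h1 := norm_sq_le_one_sub_torusCos (θ - φ)
  have h2 := neg_one_le_torusCos (θ - φ)
  nlinarith [sq_nonneg Real.pi]

lemma integrable_distSqTo {ν : Measure Phase} [IsFiniteMeasure ν]
    (h2 : Integrable (fun z : Phase => z.2 ^ 2) ν) (φ : Torus) : Integrable (distSqTo φ) ν := by
  refine integrable_of_growth (B := Real.pi ^ 2 + 1) h2 (continuous_distSqTo φ) fun z => ?_
  rw [abs_of_nonneg (distSqTo_nonneg φ z)]
  unfold distSqTo
  have := dist_sq_le_pi_sq z.1 φ
  nlinarith [sq_nonneg Real.pi, sq_nonneg z.2, mul_nonneg (sq_nonneg Real.pi) (sq_nonneg z.2)]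

/-- An error bound for the approximation of `ν` by the bi-polar state with phase `φ` and mass `c`
at the main pole. -/
noncomputable def bipolarDefect (ν : Measure Phase) (φ : Torus) (c : ℝ) : ℝ :=
  Real.pi ^ 2 / 2 * ∫ z, torusSin (z.1 - φ) ^ 2 ∂ν
    + Real.pi ^ 2 * |(1 + ∫ z, torusCos (z.1 - φ) ∂ν) / 2 - c| + ∫ z, z.2 ^ 2 ∂ν

lemma continuous_torusSin : Continuous torusSin := TorusSmooth.torusSin.continuous

lemma continuous_torusCos : Continuous torusCos := TorusSmooth.torusCos.continuous

/-- A fuzzy partition of phase space into the parts that are sent to the two poles. -/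
lemma exists_weight {ν : Measure Phase} [IsProbabilityMeasure ν]
    (h2 : Integrable (fun z : Phase => z.2 ^ 2) ν) (φ : Torus) {c : ℝ} (hc0 : 0 ≤ c)
    (hc1 : c ≤ 1) :
    ∃ w : Phase → ℝ, Continuous w ∧ (∀ z, 0 ≤ w z) ∧ (∀ z, w z ≤ 1) ∧ ∫ z, w z ∂ν = c ∧
      ∫ z, (w z * distSqTo φ z + (1 - w z) * distSqTo (φ + ((Real.pi : ℝ) : Torus)) z) ∂ν
        ≤ bipolarDefect ν φ c := by
  set C : Phase → ℝ := fun z => torusCos (z.1 - φ) with hC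
  have hCc : Continuous C := continuous_torusCos.comp (by fun_prop)
  have hC1 : ∀ z, C z ≤ 1 := fun z => torusCos_le_one _
  have hC0 : ∀ z, -1 ≤ C z := fun z => neg_one_le_torusCos _
  have iC : Integrable C ν := Integrable.of_bound hCc.aestronglyMeasurable 1
    (Eventually.of_forall fun z => abs_torusCos_le_one _)
  have iS : Integrable (fun z : Phase => torusSin (z.1 - φ) ^ 2) ν := by
    refine Integrable.of_bound ((continuous_torusSin.comp
      (by fun_prop : Continuous fun z : Phase => z.1 - φ)).pow 2).aestronglyMeasurable 1
      (Eventually.of_forall fun z => ?_)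
    rw [Real.norm_eq_abs, abs_of_nonneg (sq_nonneg _)]
    exact torusSin_sq_le_one _
  have hmean : ∫ z, (1 + C z) / 2 ∂ν = (1 + ∫ z, C z ∂ν) / 2 := by
    rw [integral_div, integral_add (integrable_const _) iC]
    simp
  have iw1 : Integrable (fun z => (1 + C z) / 2) ν := ((integrable_const 1).add iC).div_const 2
  have iw2 : Integrable (fun z => 1 - (1 + C z) / 2) ν := (integrable_const 1).sub iw1
  have hmean2 : ∫ z, (1 - (1 + C z) / 2) ∂ν = 1 - (1 + ∫ z, C z ∂ν) / 2 := by
    rw [integral_sub (integrable_const _) iw1, hmean]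
    simp
  set A := (1 + ∫ z, C z ∂ν) / 2 with hA
  have hA0 : 0 ≤ A := by
    rw [← hmean]
    exact integral_nonneg fun z => by have := hC0 z; simp only [Pi.zero_apply]; linarith
  have hA1 : 0 ≤ 1 - A := by
    rw [← hmean2]
    exact integral_nonneg fun z => by have := hC1 z; simp only [Pi.zero_apply]; linarith
  obtain ⟨α, β, hα0, hα1, hβ0, hβ1, hmix, hcost⟩ :=
    exists_mixing_weights hA0 hc0 hc1
  -- The natural share of the pole φ is (1 + cos(θ - φ))/2, with mean A; mixing with α and β
  -- corrects the mean to exactly c.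
  set w : Phase → ℝ := fun z => α * ((1 + C z) / 2) + β * (1 - (1 + C z) / 2) with hw
  have hwc : Continuous w := by fun_prop
  have hw0 : ∀ z, 0 ≤ w z := fun z => by
    have := hC0 z
    have := hC1 z
    exact add_nonneg (mul_nonneg hα0 (by linarith)) (mul_nonneg hβ0 (by linarith))
  have hw1 : ∀ z, w z ≤ 1 := fun z => by
    have h3 := hC0 z
    have h4 := hC1 z
    simp only [hw]
    nlinarith
  refine ⟨w, hwc, hw0, hw1, ?_, ?_⟩
  · rw [← hmix, ← hmean2, ← hmean, ← integral_const_mul, ← integral_const_mul]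
    exact integral_add (iw1.const_mul α) (iw2.const_mul β)
  · have e : Real.pi ^ 2 / 2 * ∫ z, torusSin (z.1 - φ) ^ 2 ∂ν
        + Real.pi ^ 2 * ((1 - α) * A + β * (1 - A)) + ∫ z, z.2 ^ 2 ∂ν =
        ∫ z, (Real.pi ^ 2 / 2 * torusSin (z.1 - φ) ^ 2 + Real.pi ^ 2 *
          ((1 - α) * ((1 + C z) / 2) + β * (1 - (1 + C z) / 2)) + z.2 ^ 2) ∂ν := by
      have j1 := iS.const_mul (Real.pi ^ 2 / 2)
      have j2 : Integrable (fun z => Real.pi ^ 2 *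
          ((1 - α) * ((1 + C z) / 2) + β * (1 - (1 + C z) / 2))) ν :=
        ((iw1.const_mul (1 - α)).add (iw2.const_mul β)).const_mul _
      rw [integral_add (f := fun z : Phase => Real.pi ^ 2 / 2 * torusSin (z.1 - φ) ^ 2 +
        Real.pi ^ 2 * ((1 - α) * ((1 + C z) / 2) + β * (1 - (1 + C z) / 2))) (j1.add j2) h2,
        integral_add j1 j2, integral_const_mul, integral_const_mul,
        integral_add (iw1.const_mul (1 - α)) (iw2.const_mul β), integral_const_mul,
        integral_const_mul, hmean, hmean2]
    have hle : Real.pi ^ 2 / 2 * ∫ z, torusSin (z.1 - φ) ^ 2 ∂ν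
        + Real.pi ^ 2 * ((1 - α) * A + β * (1 - A)) + ∫ z, z.2 ^ 2 ∂ν ≤ bipolarDefect ν φ c := by
      unfold bipolarDefect
      gcongr
    refine le_trans ?_ hle
    rw [e]
    refine integral_mono ?_ ?_ fun z => ?_
    · have k : ∀ ψ, Integrable (fun z => distSqTo ψ z) ν := integrable_distSqTo h2
      refine Integrable.add ?_ ?_
      · refine (k φ).mono' (hwc.mul (continuous_distSqTo _)).aestronglyMeasurable
          (Eventually.of_forall fun z => ?_)
        rw [Real.norm_eq_abs, abs_of_nonneg (mul_nonneg (hw0 z) (distSqTo_nonneg _ z))]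
        exact mul_le_of_le_one_left (distSqTo_nonneg _ z) (hw1 z)
      · refine (k (φ + ((Real.pi : ℝ) : Torus))).mono'
          ((continuous_const.sub hwc).mul (continuous_distSqTo _)).aestronglyMeasurable
          (Eventually.of_forall fun z => ?_)
        have := hw1 z
        rw [Real.norm_eq_abs,
          abs_of_nonneg (mul_nonneg (by linarith) (distSqTo_nonneg _ z))]
        exact mul_le_of_le_one_left (distSqTo_nonneg _ z) (by linarith [hw0 z])
    · exact ((iS.const_mul _).add (((iw1.const_mul (1 - α)).add (iw2.const_mul β)).const_mul _)).add
        h2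
    -- With u = cos(θ - φ), the natural shares cost at most π²(1 - u²)/2 = (π²/2) sin²(θ - φ): a far
    -- pole has a small share. Reassigned mass is charged the maximal squared distance π².
    · have d1 : dist z.1 φ ^ 2 ≤ Real.pi ^ 2 * ((1 - C z) / 2) := by
        rw [dist_eq_norm]; exact norm_sq_le_one_sub_torusCos _
      have d2 : dist z.1 (φ + ((Real.pi : ℝ) : Torus)) ^ 2 ≤ Real.pi ^ 2 * ((1 + C z) / 2) := by
        rw [dist_eq_norm, ← sub_sub]
        refine (norm_sq_le_one_sub_torusCos _).trans (le_of_eq ?_)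
        rw [torusCos_sub_pi]
        ring
      have d3 := dist_sq_le_pi_sq z.1 φ
      have d4 := dist_sq_le_pi_sq z.1 (φ + ((Real.pi : ℝ) : Torus))
      have hs : torusSin (z.1 - φ) ^ 2 = 1 - C z ^ 2 := by
        have := torusSin_sq_add_torusCos_sq (z.1 - φ)
        simp only [hC]
        linarith
      have h3 := hC0 z
      have h4 := hC1 z
      simp only [hs, distSqTo, hw]
      set x := dist z.1 φ ^ 2
      set y := dist z.1 (φ + ((Real.pi : ℝ) : Torus)) ^ 2
      set u := C z
      have hx0 : 0 ≤ x := sq_nonneg _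
      have hy0 : 0 ≤ y := sq_nonneg _
      have p1 : (1 + u) / 2 * x ≤ (1 + u) / 2 * (Real.pi ^ 2 * ((1 - u) / 2)) :=
        mul_le_mul_of_nonneg_left d1 (by linarith)
      have p2 : (1 - u) / 2 * y ≤ (1 - u) / 2 * (Real.pi ^ 2 * ((1 + u) / 2)) :=
        mul_le_mul_of_nonneg_left d2 (by linarith)
      have p3 : (1 - α) * ((1 + u) / 2) * y ≤ (1 - α) * ((1 + u) / 2) * Real.pi ^ 2 :=
        mul_le_mul_of_nonneg_left d4 (mul_nonneg (by linarith) (by linarith))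
      have p4 : β * ((1 - u) / 2) * x ≤ β * ((1 - u) / 2) * Real.pi ^ 2 :=
        mul_le_mul_of_nonneg_left d3 (mul_nonneg hβ0 (by linarith))
      have p5 : 0 ≤ (1 - α) * ((1 + u) / 2) * x :=
        mul_nonneg (mul_nonneg (by linarith) (by linarith)) hx0
      have p6 : 0 ≤ β * ((1 - u) / 2) * y := mul_nonneg (mul_nonneg hβ0 (by linarith)) hy0
      nlinarith

/-- The bi-polar state with poles `φ`, `φ + π` and masses `c`, `1 - c`. -/
noncomputable def bipolarMeasure (φ : Torus) (c : ℝ) : Measure Phase :=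
  (ENNReal.ofReal c • Measure.dirac φ
      + ENNReal.ofReal (1 - c) • Measure.dirac (φ + ((Real.pi : ℝ) : Torus))).prod
        (Measure.dirac (0 : ℝ))

lemma bipolarMeasure_eq (φ : Torus) (c : ℝ) :
    bipolarMeasure φ c = ENNReal.ofReal c • Measure.dirac (φ, 0)
      + ENNReal.ofReal (1 - c) • Measure.dirac (φ + ((Real.pi : ℝ) : Torus), 0) := by
  unfold bipolarMeasure
  rw [Measure.add_prod, Measure.prod_smul_left, Measure.prod_smul_left, Measure.dirac_prod_dirac,
    Measure.dirac_prod_dirac]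

lemma isProbabilityMeasure_bipolarMeasure (φ : Torus) {c : ℝ} (hc0 : 0 ≤ c) (hc1 : c ≤ 1) :
    IsProbabilityMeasure (bipolarMeasure φ c) := by
  refine ⟨?_⟩
  rw [bipolarMeasure_eq]
  simp only [Measure.coe_add, Measure.coe_smul, Pi.add_apply, Pi.smul_apply, measure_univ,
    smul_eq_mul, mul_one]
  rw [← ENNReal.ofReal_add hc0 (by linarith)]
  simp

lemma integral_bipolarMeasure (φ : Torus) {c : ℝ} (hc0 : 0 ≤ c) (hc1 : c ≤ 1) (f : Phase → ℝ) :
    ∫ z, f z ∂(bipolarMeasure φ c) =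
      c * f (φ, 0) + (1 - c) * f (φ + ((Real.pi : ℝ) : Torus), 0) := by
  rw [bipolarMeasure_eq, integral_add_measure
    ((integrable_dirac (by simp)).smul_measure ENNReal.ofReal_ne_top)
    ((integrable_dirac (by simp)).smul_measure ENNReal.ofReal_ne_top), integral_smul_measure,
    integral_smul_measure, integral_dirac, integral_dirac, ENNReal.toReal_ofReal hc0,
    ENNReal.toReal_ofReal (by linarith)]
  rfl

lemma edist_sq_add_edist_sq (φ : Torus) (z : Phase) :
    edist z.1 φ ^ 2 + edist z.2 (0 : ℝ) ^ 2 = ENNReal.ofReal (distSqTo φ z) := by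
  unfold distSqTo
  rw [edist_dist, edist_dist, ENNReal.ofReal_add (by positivity) (by positivity),
    ENNReal.ofReal_pow dist_nonneg, ← sq_abs z.2, ENNReal.ofReal_pow (abs_nonneg _)]
  simp

lemma wasserstein2_bipolarMeasure_le {ν : Measure Phase} [IsProbabilityMeasure ν]
    (h2 : Integrable (fun z : Phase => z.2 ^ 2) ν) (φ : Torus) {c : ℝ} (hc0 : 0 ≤ c)
    (hc1 : c ≤ 1) :
    wasserstein2 ν (bipolarMeasure φ c) ≤
      ENNReal.ofReal (bipolarDefect ν φ c) ^ (1 / 2 : ℝ) := by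
  obtain ⟨w, hwc, hw0, hw1, hwint, hcost⟩ := exists_weight h2 φ hc0 hc1
  set p : Phase := (φ, 0)
  set p' : Phase := (φ + ((Real.pi : ℝ) : Torus), 0)
  set f : Phase → ℝ≥0∞ := fun z => ENNReal.ofReal (w z)
  set f' : Phase → ℝ≥0∞ := fun z => ENNReal.ofReal (1 - w z)
  have hf : Measurable f := hwc.measurable.ennreal_ofReal
  have hf' : Measurable f' := (continuous_const.sub hwc).measurable.ennreal_ofReal
  have iw : Integrable w ν := Integrable.of_bound hwc.aestronglyMeasurable 1
    (Eventually.of_forall fun z => by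
      rw [Real.norm_eq_abs, abs_of_nonneg (hw0 z)]; exact hw1 z)
  have mp : ∀ q : Phase, Measurable fun z : Phase => (z, q) := fun q => measurable_prodMk_right
  -- The coupling sends the share w of each point to the main pole and 1 - w to the opposite one.
  set ρ : Measure (Phase × Phase) :=
    (ν.withDensity f).map (fun z => (z, p)) + (ν.withDensity f').map (fun z => (z, p')) with hρ
  have m1 : ρ.map Prod.fst = ν := by
    rw [hρ, Measure.map_add _ _ measurable_fst, Measure.map_map measurable_fst (mp p),
      Measure.map_map measurable_fst (mp p')]
    have e : ∀ q : Phase, (Prod.fst ∘ fun z : Phase => (z, q)) = id := fun q => rfl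
    rw [e, e, Measure.map_id, Measure.map_id, ← withDensity_add_left hf]
    have : f + f' = 1 := by
      funext z
      simp only [f, f', Pi.add_apply, Pi.one_apply]
      rw [← ENNReal.ofReal_add (hw0 z) (by linarith [hw1 z])]
      simp
    rw [this, withDensity_one]
  have m2 : ρ.map Prod.snd = bipolarMeasure φ c := by
    rw [hρ, Measure.map_add _ _ measurable_snd, Measure.map_map measurable_snd (mp p),
      Measure.map_map measurable_snd (mp p')]
    have e : ∀ q : Phase, (Prod.snd ∘ fun z : Phase => (z, q)) = fun _ => q := fun q => rfl
    rw [e, e, Measure.map_const, Measure.map_const, withDensity_apply _ MeasurableSet.univ,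
      withDensity_apply _ MeasurableSet.univ, Measure.restrict_univ, bipolarMeasure_eq,
      ← ofReal_integral_eq_lintegral_ofReal iw (Eventually.of_forall hw0),
      ← ofReal_integral_eq_lintegral_ofReal (f := fun z => 1 - w z) ((integrable_const 1).sub iw)
        (Eventually.of_forall fun z => by have := hw1 z; simp only [Pi.zero_apply]; linarith),
      integral_sub (integrable_const _) iw, hwint]
    simp [p, p']
  have hmeas : Measurable fun q : Phase × Phase =>
      edist q.1.1 q.2.1 ^ 2 + edist q.1.2 q.2.2 ^ 2 := by
    have : Continuous fun q : Phase × Phase =>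
        edist q.1.1 q.2.1 ^ 2 + edist q.1.2 q.2.2 ^ 2 := by
      have c1 : Continuous fun q : Phase × Phase => edist q.1.1 q.2.1 := by fun_prop
      have c2 : Continuous fun q : Phase × Phase => edist q.1.2 q.2.2 := by fun_prop
      exact ((ENNReal.continuous_pow 2).comp c1).add ((ENNReal.continuous_pow 2).comp c2)
    exact this.measurable
  have hc : ∫⁻ q, (edist q.1.1 q.2.1 ^ 2 + edist q.1.2 q.2.2 ^ 2) ∂ρ ≤
      ENNReal.ofReal (bipolarDefect ν φ c) := by
    rw [hρ, lintegral_add_measure, lintegral_map hmeas (mp p), lintegral_map hmeas (mp p')]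
    simp only [p, p', edist_sq_add_edist_sq]
    rw [lintegral_withDensity_eq_lintegral_mul _ hf (continuous_distSqTo _).measurable.ennreal_ofReal,
      lintegral_withDensity_eq_lintegral_mul _ hf'
        (continuous_distSqTo _).measurable.ennreal_ofReal,
      ← lintegral_add_left (hf.mul (continuous_distSqTo _).measurable.ennreal_ofReal)]
    refine le_trans (le_of_eq ?_) (ENNReal.ofReal_le_ofReal hcost)
    have k1 : ∀ z, 0 ≤ w z * distSqTo φ z := fun z => mul_nonneg (hw0 z) (distSqTo_nonneg _ z)
    have k2 : ∀ z, 0 ≤ (1 - w z) * distSqTo (φ + ((Real.pi : ℝ) : Torus)) z := fun z =>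
      mul_nonneg (by linarith [hw1 z]) (distSqTo_nonneg _ z)
    rw [ofReal_integral_eq_lintegral_ofReal]
    · refine lintegral_congr fun z => ?_
      simp only [Pi.mul_apply, f, f']
      rw [← ENNReal.ofReal_mul (hw0 z), ← ENNReal.ofReal_mul (by linarith [hw1 z]),
        ← ENNReal.ofReal_add (k1 z) (k2 z)]
    · refine integrable_of_growth (B := 2 * (Real.pi ^ 2 + 1)) h2
        ((hwc.mul (continuous_distSqTo _)).add ((continuous_const.sub hwc).mul
          (continuous_distSqTo _))) fun z => ?_
      rw [abs_of_nonneg (add_nonneg (k1 z) (k2 z))]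
      have b : ∀ ψ, distSqTo ψ z ≤ (Real.pi ^ 2 + 1) * (1 + z.2 ^ 2) := fun ψ => by
        unfold distSqTo
        have := dist_sq_le_pi_sq z.1 ψ
        nlinarith [sq_nonneg Real.pi, sq_nonneg z.2, mul_nonneg (sq_nonneg Real.pi) (sq_nonneg z.2)]
      have b1 := mul_le_of_le_one_left (distSqTo_nonneg φ z) (hw1 z)
      have b2 := mul_le_of_le_one_left (distSqTo_nonneg (φ + ((Real.pi : ℝ) : Torus)) z)
        (by linarith [hw0 z] : 1 - w z ≤ 1)
      linarith [b φ, b (φ + ((Real.pi : ℝ) : Torus))]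
    · exact Eventually.of_forall fun z => add_nonneg (k1 z) (k2 z)
  unfold wasserstein2
  refine (iInf_le_of_le ρ (iInf_le_of_le m1 (iInf_le_of_le m2 le_rfl))).trans ?_
  exact ENNReal.rpow_le_rpow hc (by norm_num)

/-- Integrals of Lipschitz functions are controlled by the defect. -/
lemma sq_integral_sub_integral_bipolarMeasure_le {ν : Measure Phase} [IsProbabilityMeasure ν]
    (h2 : Integrable (fun z : Phase => z.2 ^ 2) ν) (φ : Torus) {c : ℝ} (hc0 : 0 ≤ c)
    (hc1 : c ≤ 1) {f : Phase → ℝ} {M : ℝ} (hM : ∀ x y, dist (f x) (f y) ≤ M) {L : NNReal}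
    (hL : LipschitzWith L f) :
    (∫ z, f z ∂ν - ∫ z, f z ∂(bipolarMeasure φ c)) ^ 2 ≤ L ^ 2 * bipolarDefect ν φ c := by
  obtain ⟨w, hwc, hw0, hw1, hwint, hcost⟩ := exists_weight h2 φ hc0 hc1
  rw [integral_bipolarMeasure φ hc0 hc1]
  set p : Phase := (φ, 0) with hp
  set p' : Phase := (φ + ((Real.pi : ℝ) : Torus), 0) with hp'
  have hfc := hL.continuous
  set h : Phase → ℝ := fun z => w z * (f z - f p) + (1 - w z) * (f z - f p') with hh
  have hhc : Continuous h := by fun_prop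
  have iw : Integrable w ν := Integrable.of_bound hwc.aestronglyMeasurable 1
    (Eventually.of_forall fun z => by
      rw [Real.norm_eq_abs, abs_of_nonneg (hw0 z)]; exact hw1 z)
  have ifz : Integrable f ν := by
    refine Integrable.of_bound hfc.aestronglyMeasurable (M + ‖f p‖)
      (Eventually.of_forall fun z => ?_)
    have := norm_sub_norm_le (f z) (f p)
    rw [← dist_eq_norm] at this
    linarith [hM z p]
  have e1 : ∫ z, h z ∂ν = ∫ z, f z ∂ν - (c * f p + (1 - c) * f p') := by
    have e : ∀ z, h z = f z - (w z * (f p - f p') + f p') := fun z => by simp only [hh]; ring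
    simp_rw [e]
    rw [integral_sub (g := fun z => w z * (f p - f p') + f p') ifz ((iw.mul_const _).add (integrable_const _)),
      integral_add (iw.mul_const _) (integrable_const _), integral_mul_const, hwint]
    simp
    ring
  have hsq : ∀ z, h z ^ 2 ≤ L ^ 2 *
      (w z * distSqTo φ z + (1 - w z) * distSqTo (φ + ((Real.pi : ℝ) : Torus)) z) := fun z => by
    have key : ∀ ψ : Torus, (f z - f (ψ, 0)) ^ 2 ≤ L ^ 2 * distSqTo ψ z := fun ψ => by
      have h1 := hL.dist_le_mul z (ψ, 0)
      have h3 : dist z (ψ, (0 : ℝ)) ^ 2 ≤ distSqTo ψ z := by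
        unfold distSqTo
        rw [Prod.dist_eq]
        rcases max_cases (dist z.1 ψ) (dist z.2 0) with hmx | hmx
        · simp only [hmx.1]; nlinarith [sq_nonneg z.2]
        · simp only [hmx.1]
          rw [Real.dist_eq, sub_zero, sq_abs]; nlinarith [sq_nonneg (dist z.1 ψ)]
      calc (f z - f (ψ, 0)) ^ 2 = dist (f z) (f (ψ, 0)) ^ 2 := by rw [Real.dist_eq, sq_abs]
        _ ≤ (L * dist z (ψ, 0)) ^ 2 := by gcongr
        _ = L ^ 2 * dist z (ψ, 0) ^ 2 := by ring
        _ ≤ _ := by gcongr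
    have k1 := mul_le_mul_of_nonneg_left (key φ) (hw0 z)
    have k2 := mul_le_mul_of_nonneg_left (key (φ + ((Real.pi : ℝ) : Torus)))
      (by linarith [hw1 z] : 0 ≤ 1 - w z)
    -- Convexity of the square; the difference of the two sides is the variance of a two-point
    -- distribution.
    have k3 : h z ^ 2 ≤ w z * (f z - f p) ^ 2 + (1 - w z) * (f z - f p') ^ 2 := by
      have e : w z * (f z - f p) ^ 2 + (1 - w z) * (f z - f p') ^ 2 - h z ^ 2 =
          w z * (1 - w z) * (f p - f p') ^ 2 := by simp only [hh]; ring
      have : 0 ≤ w z * (1 - w z) * (f p - f p') ^ 2 :=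
        mul_nonneg (mul_nonneg (hw0 z) (by linarith [hw1 z])) (sq_nonneg _)
      linarith
    simp only [hp, hp'] at k3
    linarith
  have icost : Integrable (fun z => L ^ 2 *
      (w z * distSqTo φ z + (1 - w z) * distSqTo (φ + ((Real.pi : ℝ) : Torus)) z)) ν := by
    have k : ∀ ψ, ∀ v : Phase → ℝ, Continuous v → (∀ z, 0 ≤ v z) → (∀ z, v z ≤ 1) →
        Integrable (fun z => v z * distSqTo ψ z) ν := fun ψ v hv h0 h1 => by
      refine (integrable_distSqTo h2 ψ).mono' (hv.mul (continuous_distSqTo _)).aestronglyMeasurable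
        (Eventually.of_forall fun z => ?_)
      rw [Real.norm_eq_abs, abs_of_nonneg (mul_nonneg (h0 z) (distSqTo_nonneg _ z))]
      exact mul_le_of_le_one_left (distSqTo_nonneg _ z) (h1 z)
    exact ((k _ w hwc hw0 hw1).add (k _ (fun z => 1 - w z) (continuous_const.sub hwc)
      (fun z => by linarith [hw1 z]) (fun z => by linarith [hw0 z]))).const_mul _
  have ih2 : Integrable (fun z => h z ^ 2) ν :=
    icost.mono' (hhc.pow 2).aestronglyMeasurable (Eventually.of_forall fun z => by
      rw [Real.norm_eq_abs, abs_of_nonneg (sq_nonneg _)]; exact hsq z)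
  have ih : Integrable h ν := by
    have e : h = fun z => f z - (w z * (f p - f p') + f p') := by
      funext z; simp only [hh]; ring
    rw [e]
    exact ifz.sub ((iw.mul_const _).add (integrable_const _))
  have hcs := sq_integral_mul_le ih2 (g := fun _ => (1 : ℝ)) (by simp) (by simpa using ih)
  simp only [mul_one, one_pow, integral_const, probReal_univ, smul_eq_mul] at hcs
  rw [← e1]
  refine hcs.trans ((integral_mono ih2 icost hsq).trans ?_)
  rw [integral_const_mul]
  exact mul_le_mul_of_nonneg_left hcost (by positivity)

end KineticKuramoto

namespace KineticKuramoto

variable {m γ κ : ℝ} {μ : ℝ → ProbabilityMeasure Phase}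

/-! ### From convergence of the order parameter to convergence of the measures -/

lemma orderParameter_eq_sqrt {t : ℝ} (ht : 0 ≤ t) :
    orderParameter (μ t : Measure Phase) = Real.sqrt (orderSq μ t) := by
  have hC : cosMean μ t = ∫ z, torusCos z.1 ∂(μ t : Measure Phase) := by
    rw [cosMean, moment_torusCos_one, max_eq_left ht]
  have hS : sinMean μ t = ∫ z, torusSin z.1 ∂(μ t : Measure Phase) := by
    rw [sinMean, moment_torusSin_one, max_eq_left ht]
  have e : ∫ z, torusExp z.1 ∂(μ t : Measure Phase) =
      (cosMean μ t : ℂ) + (sinMean μ t : ℂ) * Complex.I := by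
    simp_rw [torusExp_eq]
    rw [integral_add TorusSmooth.torusCos.integrable.ofReal
      (TorusSmooth.torusSin.integrable.ofReal.mul_const _), integral_mul_const,
      integral_complex_ofReal, integral_complex_ofReal, hC, hS]
  rw [orderParameter, e, Complex.norm_add_mul_I]
  rfl

lemma orderParameter_sq {t : ℝ} (ht : 0 ≤ t) :
    orderParameter (μ t : Measure Phase) ^ 2 = orderSq μ t := by
  rw [orderParameter_eq_sqrt ht, Real.sq_sqrt (orderSq_nonneg μ t)]

/-- Around a limit phase the solution concentrates on the two poles. -/
lemma tendsto_bipolarDefect (hμ : IsMeasureValuedSolution m γ κ μ)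
    (hm : 0 < m) (hγ : 0 < γ) (hκ : 0 < κ) (h0 : energy m κ μ 0 ≤ 0) {R : ℝ} (hR : 0 < R)
    {φ : Torus} (hC : Tendsto (cosMean μ) atTop (𝓝 (R * torusCos φ)))
    (hS : Tendsto (sinMean μ) atTop (𝓝 (R * torusSin φ))) :
    Tendsto (fun t => bipolarDefect (μ t : Measure Phase) φ ((1 + R) / 2)) atTop (𝓝 0) := by
  have hcs := torusSin_sq_add_torusCos_sq φ
  have i1 : ∀ t, Integrable (fun z : Phase => torusSin (z.1 - φ) ^ 2)
      (μ (max t 0) : Measure Phase) := fun t => by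
    refine Integrable.of_bound ((continuous_torusSin.comp
      (by fun_prop : Continuous fun z : Phase => z.1 - φ)).pow 2).aestronglyMeasurable 1
      (Eventually.of_forall fun z => ?_)
    rw [Real.norm_eq_abs, abs_of_nonneg (sq_nonneg _)]
    exact torusSin_sq_le_one _
  have hsin : Tendsto (fun t => ∫ z, torusSin (z.1 - φ) ^ 2 ∂(μ (max t 0) : Measure Phase)) atTop
      (𝓝 0) := by
    -- R sin(θ - φ) differs from q by at most the distance from z to its limit Re^{iφ}. Squaring the
    -- sum gives the factor 2, and division by R² needs R > 0.
    have hb : Tendsto (fun t => (2 / R ^ 2) * (spread μ t + ((cosMean μ t - R * torusCos φ) ^ 2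
        + (sinMean μ t - R * torusSin φ) ^ 2))) atTop (𝓝 0) := by
      have h1 := (hC.sub_const (R * torusCos φ)).pow 2
      have h2 := (hS.sub_const (R * torusSin φ)).pow 2
      simpa using ((tendsto_spread hμ hm hγ hκ h0).add (h1.add h2)).const_mul (2 / R ^ 2)
    refine squeeze_zero (fun t => integral_nonneg fun z => sq_nonneg _) (fun t => ?_) hb
    set d := (cosMean μ t - R * torusCos φ) ^ 2 + (sinMean μ t - R * torusSin φ) ^ 2 with hd
    have iq : Integrable (fun z : Phase => normal μ t z.1 ^ 2) (μ (max t 0) : Measure Phase) := by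
      simpa [sq] using ((TorusSmooth.normal (μ := μ) t).mul (.normal t)).integrable
    have e : 2 / R ^ 2 * (spread μ t + d) =
        ∫ z : Phase, 2 / R ^ 2 * (normal μ t z.1 ^ 2 + d) ∂(μ (max t 0) : Measure Phase) := by
      rw [integral_const_mul, integral_add iq (integrable_const _)]
      simp [spread, moment]
    rw [e]
    refine integral_mono (i1 t) ((iq.add (integrable_const d)).const_mul _) fun z => ?_
    beta_reduce
    rw [torusSin_sub, div_mul_eq_mul_div, le_div_iff₀ (by positivity)]
    have hz := torusSin_sq_add_torusCos_sq z.1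
    unfold normal
    rw [hd]
    set C := cosMean μ t
    set S := sinMean μ t
    set x := torusCos z.1
    set y := torusSin z.1
    set u := torusCos φ
    set v := torusSin φ
    have key : ((C - R * u) * y - (S - R * v) * x) ^ 2 ≤ (C - R * u) ^ 2 + (S - R * v) ^ 2 := by
      have : (C - R * u) ^ 2 + (S - R * v) ^ 2 - ((C - R * u) * y - (S - R * v) * x) ^ 2 =
          ((C - R * u) * x + (S - R * v) * y) ^ 2 := by
        linear_combination (-(C - R * u) ^ 2 - (S - R * v) ^ 2) * hz
      nlinarith [sq_nonneg ((C - R * u) * x + (S - R * v) * y)]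
    have e2 : (y * u - x * v) ^ 2 * R ^ 2 =
        ((C * y - S * x) - ((C - R * u) * y - (S - R * v) * x)) ^ 2 := by ring
    rw [e2]
    nlinarith [sq_nonneg ((C * y - S * x) + ((C - R * u) * y - (S - R * v) * x))]
  have hcos : Tendsto (fun t => ∫ z, torusCos (z.1 - φ) ∂(μ (max t 0) : Measure Phase)) atTop
      (𝓝 R) := by
    have h := (hC.mul_const (torusCos φ)).add (hS.mul_const (torusSin φ))
    have e : R * torusCos φ * torusCos φ + R * torusSin φ * torusSin φ = R := by
      linear_combination R * hcs
    rw [e] at h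
    refine h.congr fun t => ?_
    simp_rw [torusCos_sub]
    rw [integral_add (TorusSmooth.torusCos.integrable.mul_const _)
      (TorusSmooth.torusSin.integrable.mul_const _), integral_mul_const, integral_mul_const,
      ← moment_torusCos_one, ← moment_torusSin_one]
    rfl
  have hk := tendsto_kinetic hμ hm hγ hκ h0
  have h := ((hsin.const_mul (Real.pi ^ 2 / 2)).add
    ((((hcos.const_add 1).div_const 2).sub_const ((1 + R) / 2)).abs.const_mul (Real.pi ^ 2))).add hk
  simp only [mul_zero, sub_self, abs_zero, add_zero] at h
  refine h.congr' ?_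
  filter_upwards [eventually_ge_atTop 0] with t ht
  rw [bipolarDefect, kinetic, moment_one_sq, max_eq_left ht]

/-- Bounded Lipschitz functions determine weak convergence, and their integrals differ by at most L
times the square root of the defect. -/
lemma tendsto_of_tendsto_bipolarDefect (hμ : IsMeasureValuedSolution m γ κ μ) {φ : Torus} {c : ℝ}
    (hc0 : 0 ≤ c) (hc1 : c ≤ 1)
    (h : Tendsto (fun t => bipolarDefect (μ t : Measure Phase) φ c) atTop (𝓝 0))
    {ν : ProbabilityMeasure Phase} (hν : (ν : Measure Phase) = bipolarMeasure φ c) :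
    Tendsto μ atTop (𝓝 ν) := by
  refine tendsto_iff_forall_lipschitz_integral_tendsto.2 ?_
  rintro f ⟨M, hM⟩ ⟨L, hL⟩
  rw [hν, tendsto_iff_norm_sub_tendsto_zero]
  have h1 := (h.const_mul ((L : ℝ) ^ 2)).sqrt
  rw [mul_zero, Real.sqrt_zero] at h1
  refine tendsto_of_tendsto_of_tendsto_of_le_of_le' tendsto_const_nhds h1
    (Eventually.of_forall fun t => norm_nonneg _) ?_
  filter_upwards [eventually_ge_atTop 0] with t ht
  exact Real.abs_le_sqrt (sq_integral_sub_integral_bipolarMeasure_le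
    (hμ.finite_second_moment t ht) φ hc0 hc1 hM hL)

lemma tendsto_wasserstein2_of_tendsto_bipolarDefect (hμ : IsMeasureValuedSolution m γ κ μ)
    {φ : Torus} {c : ℝ} (hc0 : 0 ≤ c) (hc1 : c ≤ 1)
    (h : Tendsto (fun t => bipolarDefect (μ t : Measure Phase) φ c) atTop (𝓝 0)) :
    Tendsto (fun t => wasserstein2 (μ t : Measure Phase) (bipolarMeasure φ c)) atTop (𝓝 0) := by
  have h1 := ((ENNReal.continuous_rpow_const (y := (1 / 2 : ℝ))).tendsto _).comp
    (ENNReal.tendsto_ofReal h)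
  rw [ENNReal.ofReal_zero, ENNReal.zero_rpow_of_pos (by norm_num)] at h1
  refine tendsto_of_tendsto_of_tendsto_of_le_of_le' tendsto_const_nhds h1
    (Eventually.of_forall fun t => zero_le) ?_
  filter_upwards [eventually_ge_atTop 0] with t ht
  exact wasserstein2_bipolarMeasure_le (hμ.finite_second_moment t ht) φ hc0 hc1

end KineticKuramoto

/-! ### The dichotomy for nonpositive initial energy -/

theorem theorem3p7 (m γ κ : ℝ) (hm : 0 < m) (hγ : 0 < γ) (hκ : 0 < κ)
    (μ : ℝ → ProbabilityMeasure KineticKuramoto.Phase)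
    (hμ : KineticKuramoto.IsMeasureValuedSolution m γ κ μ)
    (hin : (1 / 2) * ∫ z, z.2 ^ 2 ∂(μ 0 : Measure KineticKuramoto.Phase)
      ≤ κ * KineticKuramoto.orderParameter (μ 0 : Measure KineticKuramoto.Phase) ^ 2 / (2 * m)) :
    (KineticKuramoto.orderParameter (μ 0 : Measure KineticKuramoto.Phase) = 0 →
      ∀ t, 0 ≤ t →
        μ t = μ 0 ∧
        (∀ᵐ z ∂(μ t : Measure KineticKuramoto.Phase), z.2 = 0) ∧
        KineticKuramoto.orderParameter (μ t : Measure KineticKuramoto.Phase) = 0) ∧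
    (0 < KineticKuramoto.orderParameter (μ 0 : Measure KineticKuramoto.Phase) →
      (∃ Rlow : ℝ, 0 < Rlow ∧ ∀ t, 0 ≤ t →
        Rlow ≤ KineticKuramoto.orderParameter (μ t : Measure KineticKuramoto.Phase)) ∧
      (∃ Rlim : ℝ, 0 < Rlim ∧
        Tendsto (fun t : ℝ =>
          KineticKuramoto.orderParameter (μ t : Measure KineticKuramoto.Phase)) atTop (𝓝 Rlim)) ∧
      (∃ (c₁ c₂ : ℝ) (ν : ProbabilityMeasure KineticKuramoto.Phase),
        KineticKuramoto.IsBipolarState c₁ c₂ (ν : Measure KineticKuramoto.Phase) ∧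
        Tendsto μ atTop (𝓝 ν) ∧
        Tendsto (fun t : ℝ => KineticKuramoto.wasserstein2
          (μ t : Measure KineticKuramoto.Phase) (ν : Measure KineticKuramoto.Phase))
          atTop (𝓝 0))) := by
  open KineticKuramoto in
  have h0 : energy m κ μ 0 ≤ 0 := by
    rw [orderParameter_sq le_rfl] at hin
    unfold energy
    rw [kinetic, moment_one_sq, max_self]
    have e : κ * orderSq μ 0 / (2 * m) = κ / (2 * m) * orderSq μ 0 := by ring
    linarith
  refine ⟨fun hR t ht => ?_, fun hR => ?_⟩
  · have hR0 : orderSq μ 0 = 0 := by rw [← orderParameter_sq le_rfl, hR]; norm_num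
    have hk := ae_eq_zero_of_kinetic_eq_zero hμ (kinetic_eq_zero hμ hm hγ hκ h0 hR0 t)
    rw [max_eq_left ht] at hk
    refine ⟨eq_initial_of_orderSq_eq_zero hμ hm hγ hκ h0 hR0 ht, hk, ?_⟩
    rw [orderParameter_eq_sqrt ht, orderSq_eq_zero hμ hm hγ hκ h0 hR0 ht, Real.sqrt_zero]
  · have hR0 : 0 < orderSq μ 0 := by rw [← orderParameter_sq le_rfl]; positivity
    obtain ⟨c, s, hcs, hC, hS⟩ := exists_tendsto_cosMean_sinMean hμ hm hγ hκ h0 hR0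
    set R := Real.sqrt (c ^ 2 + s ^ 2) with hRdef
    have hRpos : 0 < R := Real.sqrt_pos.2 hcs
    have hlim : Tendsto (fun t => Real.sqrt (orderSq μ t)) atTop (𝓝 R) :=
      ((hC.pow 2).add (hS.pow 2)).sqrt
    have hR1 : R ≤ 1 := le_of_tendsto hlim (Eventually.of_forall fun t =>
      Real.sqrt_le_one.2 (orderSq_le_one μ t))
    refine ⟨?_, ⟨R, hRpos, ?_⟩, ?_⟩
    · obtain ⟨r, hr, hrt⟩ := exists_orderSq_lower hμ hm hγ hκ h0 hR0
      refine ⟨Real.sqrt r, Real.sqrt_pos.2 hr, fun t ht => ?_⟩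
      rw [orderParameter_eq_sqrt ht]
      exact Real.sqrt_le_sqrt (hrt t ht)
    · refine hlim.congr' ?_
      filter_upwards [eventually_ge_atTop 0] with t ht
      rw [orderParameter_eq_sqrt ht]
    -- The limit phase is the argument of the limit of z, and the main pole carries (1 + R)/2, the
    -- mass for which the mean of cos(θ - φ) is R; R > 0 makes it the larger one.
    · set ζ : ℂ := ⟨c, s⟩ with hζ
      have hnorm : ‖ζ‖ = R := by
        rw [hRdef, ← Complex.norm_add_mul_I]
        congr 1
        exact (Complex.re_add_im ζ).symm
      set φ : Torus := ((Complex.arg ζ : ℝ) : Torus) with hφ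
      have hc : R * torusCos φ = c := by
        rw [hφ, torusCos_coe, ← hnorm, Complex.norm_mul_cos_arg]
      have hs : R * torusSin φ = s := by
        rw [hφ, torusSin_coe, ← hnorm, Complex.norm_mul_sin_arg]
      have hdef := tendsto_bipolarDefect hμ hm hγ hκ h0 hRpos (φ := φ) (by rwa [hc]) (by rwa [hs])
      have hc0 : 0 ≤ (1 + R) / 2 := by positivity
      have hc1 : (1 + R) / 2 ≤ 1 := by linarith
      refine ⟨(1 + R) / 2, 1 - (1 + R) / 2,
        ⟨bipolarMeasure φ ((1 + R) / 2), isProbabilityMeasure_bipolarMeasure φ hc0 hc1⟩,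
        ⟨by linarith, by linarith, by ring, φ, rfl⟩,
        tendsto_of_tendsto_bipolarDefect hμ hc0 hc1 hdef rfl,
        tendsto_wasserstein2_of_tendsto_bipolarDefect hμ hc0 hc1 hdef⟩
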